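/- **Setting.** Let $A,F:\mathbb R\to\mathbb R$ be bounded, Lipschitz continuous and uniformly positive ($A,F\ge c$ for some $c>0$), with $A$ differentiable and $A'$ uniformly $\sigma$-Hölder continuous for some $\sigma\in(0,1)$. Let $V:\mathbb R\times\mathbb R\to\mathbb R$, and let $C>0$ be such that for all $x_1,x_2,q_1,q_2\in\mathbb R$ $$|V(x_1,q_1)-V(x_2,q_2)|\le C(1+|q_1|)|x_1-x_2|+C|q_1-q_2|,$$ and, for all $\gamma\in(0,1)$ and all $x_1,x_2,q_1\in\mathbb R$ with $C|x_1-x_2|\le\gamma$, $$V(x_1,(1+\gamma)q_1)\ge V(x_1,q_1),\qquad (1+\gamma)^2V(x_1,q_1)+C|x_1-x_2|^2/\gamma\ge V(x_2,(1+\gamma)q_1).$$ Let $\Omega_0\subseteq\mathbb R$ be open and bounded, and assume one of the following: (a) there is a continuous $\eta:[0,\infty)\to(0,\infty)$ with $V(x,q)\ge\eta(|q|)$ for all $x,q\in\mathbb R$; or (b) there is a continuous $\eta:(0,\infty)\to(0,\infty)$ with $V(x,q)\ge\eta(|q|)$ for all $x\in\mathbb R$, $q\ne0$ (so that $V(x,0)=0$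 is allowed), and $\Omega_0$ has finitely many connected components. Consider the free boundary problem $$-\partial_x(A(x)\partial_xp)=F(x)\ \text{ in }\{p>0\},\qquad \partial_tp=V(x,\partial_xp)|\partial_xp|\ \text{ on }\partial\{p>0\}.\tag{1}$$ **Definitions.** Fix $T>0$. For $\Omega\subseteq\mathbb R\times[0,T)$ write $\Omega(t)=\{x:(x,t)\in\Omega\}$. All sets below have open and bounded slices $\Omega(t)$. $\Omega$ is *upper* (resp. *lower*) *semicontinuous* if for all $t\in[0,T)$ and $\varepsilon>0$ there is $c>0$ such that for all $s\in[0,T)$ with $|s-t|<c$ the set $\Omega(s)$ lies in the open $\varepsilon$-neighbourhood of $\Omega(t)$ (resp. $\Omega(t)$ lies in that of $\Omega(s)$). The function $p$ *associated* with $\Omega$ is given by: $p(\cdot,t)$ is the classical solution of $-(A\,p_x)_x=F$ in $\Omega(t)$ with zero boundary data, extended by $0$. An upper semicontinuous $\Omega$ with associated function $p$ is a *viscosity subflow* if, for every $\phi\in C^{2,1}_{x,t}(\mathbb R\times(0,T))$ and every $(x_0,t_0)\in\partial\Omega$ with $t_0\in(0,T)$ at which $p-\phi$ has a local maximum relative to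 $\overline\Omega\cap\{t\le t_0\}$, either $\phi_x=0$ or $\phi_t-V(x_0,\phi_x)|\phi_x|\le0$ at $(x_0,t_0)$. A lower semicontinuous $\Omega$ with associated function $p$ is a *viscosity superflow* if, for every such $\phi$ and every $(x_0,t_0)\in\partial\Omega$ with $t_0\in(0,T)$ at which $p-\phi$ has a local minimum relative to $\{t\le t_0\}$, either $\phi_x=0$ or $\phi_t-V(x_0,\phi_x)|\phi_x|\ge0$ at $(x_0,t_0)$. With $\Omega_\#(t)=\bigcup_{c>0}\bigcap_{|s-t|<c}\Omega(s)$ (where $s\in[0,T)$), $\Omega$ is a *viscosity flow* of (1) if $\Omega$ is a viscosity subflow and $\Omega_\#$ is a viscosity superflow. **Theorem (well-posedness for flows).** For every $T>0$ there is a unique (relatively) open set $\Omega\subseteq\mathbb R\times[0,T)$ that is a viscosity flow of (1) with $\Omega(0)=\Omega_0$. Moreover, this $\Omega$ is bounded and $\Omega(s)\subseteq\Omega(t)$ for $0\le s\le t<T$. -/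

import Mathlib

open Set Filter Topology

namespace HeleShaw

/-- Hypotheses on the interior coefficients: `A` and `F` are uniformly positive, bounded and
Lipschitz continuous, and `A` is differentiable with a uniformly Hoelder continuous derivative. -/
structure InteriorCoefficients (A F : ℝ → ℝ) : Prop where
  A_pos : ∃ c > 0, ∀ x, c ≤ A x
  F_pos : ∃ c > 0, ∀ x, c ≤ F x
  A_bdd : ∃ M, ∀ x, A x ≤ M
  F_bdd : ∃ M, ∀ x, F x ≤ M
  A_lip : ∃ K, LipschitzWith K A
  F_lip : ∃ K, LipschitzWith K F
  A_diff : Differentiable ℝ A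
  A_deriv : ∃ σ : NNReal, 0 < σ ∧ σ < 1 ∧ ∃ K, HolderWith K σ (deriv A)

/-- Regularity and structure of the free boundary velocity `V = V(x, q)`. -/
def VelocityStructure (V : ℝ → ℝ → ℝ) : Prop :=
  ∃ C > 0,
    (∀ x₁ x₂ q₁ q₂ : ℝ,
      |V x₁ q₁ - V x₂ q₂| ≤ C * (1 + |q₁|) * |x₁ - x₂| + C * |q₁ - q₂|) ∧
    ∀ γ : ℝ, 0 < γ → γ < 1 → ∀ x₁ x₂ q₁ : ℝ, C * |x₁ - x₂| ≤ γ →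
      V x₁ q₁ ≤ V x₁ ((1 + γ) * q₁) ∧
      V x₂ ((1 + γ) * q₁) ≤ (1 + γ) ^ 2 * V x₁ q₁ + C * |x₁ - x₂| ^ 2 / γ

/-- `V(x, q) ≥ η(|q|)` for all real `q`, with `η : [0, ∞) → (0, ∞)` continuous. -/
def VelocityPositive (V : ℝ → ℝ → ℝ) : Prop :=
  ∃ η : ℝ → ℝ, ContinuousOn η (Ici 0) ∧ (∀ s, 0 ≤ s → 0 < η s) ∧
    ∀ x q, η |q| ≤ V x q

/-- `V(x, q) ≥ η(|q|)` for all real `q ≠ 0`, with `η : (0, ∞) → (0, ∞)` continuous;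
`V(x, 0) = 0` is possible. -/
def VelocityPositiveAwayFromZero (V : ℝ → ℝ → ℝ) : Prop :=
  ∃ η : ℝ → ℝ, ContinuousOn η (Ioi 0) ∧ (∀ s, 0 < s → 0 < η s) ∧
    ∀ x q, q ≠ 0 → η |q| ≤ V x q

/-- The time slice `Ω(t)` of a space-time set of points `(x, t)`. -/
def slice (Ω : Set (ℝ × ℝ)) (t : ℝ) : Set ℝ := {x | (x, t) ∈ Ω}

/-- The space-time strip `ℝ × [0, T)`. -/
def strip (T : ℝ) : Set (ℝ × ℝ) := univ ×ˢ Ico 0 T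

/-- `Ω` is an open subset of `ℝ × [0, T)` (in the relative topology). -/
def IsOpenInStrip (T : ℝ) (Ω : Set (ℝ × ℝ)) : Prop :=
  ∃ O : Set (ℝ × ℝ), IsOpen O ∧ Ω = O ∩ strip T

/-- Admissible sets: bounded, with open slices that are non-decreasing in time. -/
structure IsAdmissible (T : ℝ) (Ω : Set (ℝ × ℝ)) : Prop where
  bounded : Bornology.IsBounded Ω
  mono : ∀ s t, 0 ≤ s → s ≤ t → t < T → slice Ω s ⊆ slice Ω t
  open_slice : ∀ t ∈ Ico 0 T, IsOpen (slice Ω t)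

/-- Upper semicontinuity of `t ↦ Ω(t)` in Hausdorff distance on `[0, T)`. -/
def UpperSemicont (T : ℝ) (Ω : Set (ℝ × ℝ)) : Prop :=
  ∀ t ∈ Ico 0 T, ∀ ε > 0, ∀ᶠ s in 𝓝[Ico 0 T] t,
    slice Ω s ⊆ Metric.thickening ε (slice Ω t)

/-- Lower semicontinuity of `t ↦ Ω(t)` in Hausdorff distance on `[0, T)`. -/
def LowerSemicont (T : ℝ) (Ω : Set (ℝ × ℝ)) : Prop :=
  ∀ t ∈ Ico 0 T, ∀ ε > 0, ∀ᶠ s in 𝓝[Ico 0 T] t,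
    slice Ω t ⊆ Metric.thickening ε (slice Ω s)

/-- The lower limit set `Ω_#`, whose slices are
`Ω_#(t) = liminf_{s → t} Ω(s) = ⋃_{c > 0} ⋂_{|s - t| < c} Ω(s)`, with `s` in `[0, T)`. -/
def lowerLimit (T : ℝ) (Ω : Set (ℝ × ℝ)) : Set (ℝ × ℝ) :=
  {z | z.2 ∈ Ico 0 T ∧ ∃ c > 0, ∀ s ∈ Ico 0 T, |s - z.2| < c → z.1 ∈ slice Ω s}

/-- `u` solves `-(A u')' = F` in the open set `U` classically, with zero boundary data;
`u` is extended by zero outside of `U`. -/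
structure IsDirichletSolution (A F : ℝ → ℝ) (U : Set ℝ) (u : ℝ → ℝ) : Prop where
  continuous : Continuous u
  eq_zero : ∀ x ∉ U, u x = 0
  differentiable : ∀ x ∈ U, DifferentiableAt ℝ u x
  equation : ∀ x ∈ U, HasDerivAt (fun y => A y * deriv u y) (-F x) x

/-- `p = p(x, t)` is the function associated with `Ω` on `[0, T)`. The slices have to be open
and bounded, which makes the solution of the Dirichlet problem exist and be unique. -/
def IsAssociated (A F : ℝ → ℝ) (T : ℝ) (Ω : Set (ℝ × ℝ)) (p : ℝ → ℝ → ℝ) : Prop :=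
  ∀ t ∈ Ico 0 T, IsOpen (slice Ω t) ∧ Bornology.IsBounded (slice Ω t) ∧
    IsDirichletSolution A F (slice Ω t) (fun x => p x t)

/-- The partial derivative `φ_x (x, t)`. -/
noncomputable def dx (φ : ℝ → ℝ → ℝ) (x t : ℝ) : ℝ := deriv (fun y => φ y t) x

/-- The partial derivative `φ_t (x, t)`. -/
noncomputable def dt (φ : ℝ → ℝ → ℝ) (x t : ℝ) : ℝ := deriv (fun s => φ x s) t

/-- The class `C^{2,1}_{x,t}(ℝ × (0, T))` of test functions: `φ`, `φ_x`, `φ_xx`, `φ_t` exist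
and are continuous in `(x, t)`. -/
structure IsTestFunction (T : ℝ) (φ : ℝ → ℝ → ℝ) : Prop where
  diff_x : ∀ x, ∀ t ∈ Ioo 0 T, DifferentiableAt ℝ (fun y => φ y t) x
  diff_xx : ∀ x, ∀ t ∈ Ioo 0 T, DifferentiableAt ℝ (fun y => dx φ y t) x
  diff_t : ∀ x, ∀ t ∈ Ioo 0 T, DifferentiableAt ℝ (fun s => φ x s) t
  cont : ContinuousOn (fun z : ℝ × ℝ => φ z.1 z.2) (univ ×ˢ Ioo 0 T)
  cont_x : ContinuousOn (fun z : ℝ × ℝ => dx φ z.1 z.2) (univ ×ˢ Ioo 0 T)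
  cont_xx : ContinuousOn (fun z : ℝ × ℝ => dx (dx φ) z.1 z.2) (univ ×ˢ Ioo 0 T)
  cont_t : ContinuousOn (fun z : ℝ × ℝ => dt φ z.1 z.2) (univ ×ˢ Ioo 0 T)

/-- Viscosity subflows in `ℝ × (0, T)`. -/
def IsSubflow (A F : ℝ → ℝ) (V : ℝ → ℝ → ℝ) (T : ℝ) (Ω : Set (ℝ × ℝ)) : Prop :=
  UpperSemicont T Ω ∧ ∃ p : ℝ → ℝ → ℝ, IsAssociated A F T Ω p ∧
    ∀ φ, IsTestFunction T φ → ∀ x₀ t₀, t₀ ∈ Ioo 0 T → (x₀, t₀) ∈ frontier Ω →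
      IsLocalMaxOn (fun z : ℝ × ℝ => p z.1 z.2 - φ z.1 z.2)
        (closure Ω ∩ {z | z.2 ≤ t₀}) (x₀, t₀) →
      |dx φ x₀ t₀| = 0 ∨ dt φ x₀ t₀ - V x₀ (dx φ x₀ t₀) * |dx φ x₀ t₀| ≤ 0

/-- Viscosity superflows in `ℝ × (0, T)`. -/
def IsSuperflow (A F : ℝ → ℝ) (V : ℝ → ℝ → ℝ) (T : ℝ) (Ω : Set (ℝ × ℝ)) : Prop :=
  LowerSemicont T Ω ∧ ∃ p : ℝ → ℝ → ℝ, IsAssociated A F T Ω p ∧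
    ∀ φ, IsTestFunction T φ → ∀ x₀ t₀, t₀ ∈ Ioo 0 T → (x₀, t₀) ∈ frontier Ω →
      IsLocalMinOn (fun z : ℝ × ℝ => p z.1 z.2 - φ z.1 z.2) {z | z.2 ≤ t₀} (x₀, t₀) →
      |dx φ x₀ t₀| = 0 ∨ 0 ≤ dt φ x₀ t₀ - V x₀ (dx φ x₀ t₀) * |dx φ x₀ t₀|

/-- Viscosity flows in `ℝ × (0, T)`: `Ω` is a subflow and `Ω_#` is a superflow. -/
def IsFlow (A F : ℝ → ℝ) (V : ℝ → ℝ → ℝ) (T : ℝ) (Ω : Set (ℝ × ℝ)) : Prop :=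
  IsSubflow A F V T Ω ∧ IsSuperflow A F V T (lowerLimit T Ω)

end HeleShaw

/-! In one space dimension the problem reduces to ODEs. On a component (a, b) the flux is A p_x = k
- ∫F, with the constant k = `kav A F a b` fixed by the zero boundary data. Hence the endpoint speeds
`vL`, `vR` depend on (a, b) only. They are positive, of linear growth, and locally Lipschitz up to
zero length. Finitely many disjoint intervals evolve by these ODEs until two of them touch; the two
are then merged, and each merger lowers the number of intervals (`exists_gen`). `Gen` records what
such evolutions have in common.

A generated evolution is a viscosity flow. Test functions only see times up to the time of contact,
and there a boundary point is the endpoint of an interval moving by its ODE. The derivative of the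
test function along this endpoint and its slope, compared with that of the profile, give the
inequalities, because V increases when the slope is scaled up (`Gen.super_ineq`, `Gen.sub_ineq`).

Generated evolutions are compared with arbitrary flows at a first contact, and positivity of V
supplies the strictness. If the time of the evolution is slowed by k < 1, its endpoint moves with k
times the speed that a superflow must at least have (`compare_super`). If it is sped up by 1 + κ and
has to contain a ρ-neighbourhood of a subflow, the gain κ c beats the Lipschitz error 2ρ Lv in the
speeds (`compare_sub`). Test functions linear in space and time suffice.

An initial set may have infinitely many components. The solution is therefore defined as the union
`maxEvol` of all generated evolutions starting compactly inside the initial set. With a lower bound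
c for the speeds, each point spreads at rate c, and no component is created later. So at time δ all
components have length at least 2cδ and are finite in number, and the union is itself generated
(`gen_maxEvol`). Any flow contains each of the competitors by `compare_super`. It lies in their
union by `compare_sub`: a short delay yields the margin, and openness in time absorbs the delay and
the change of time scale (`subset_of_linSub`).

The bound c is where the alternatives for V enter. If V is positive at all slopes, nothing is
needed. Otherwise the finitely many initial components have a minimal length ℓ, lengths never
decrease, and an interval of length at least ℓ has boundary slopes bounded away from zero
(`right_gap`, `left_gap`). -/

namespace HeleShaw

/-! ### The Dirichlet problem on one interval -/

/-- Quantitative form of the assumptions on the interior coefficients. -/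
structure CoefBounds (A F : ℝ → ℝ) (m M : ℝ) : Prop where
  m_pos : 0 < m
  A_ge : ∀ x, m ≤ A x
  F_ge : ∀ x, m ≤ F x
  A_le : ∀ x, A x ≤ M
  F_le : ∀ x, F x ≤ M
  A_lip : ∃ K, LipschitzWith K A
  F_cont : Continuous F

/-- The primitive of the source term. -/
noncomputable def primF (F : ℝ → ℝ) (x : ℝ) : ℝ := ∫ s in (0 : ℝ)..x, F s

/-- The weighted average of the primitive of the source over `(a, b)`. -/
noncomputable def kav (A F : ℝ → ℝ) (a b : ℝ) : ℝ :=
  (∫ s in a..b, primF F s / A s) / ∫ s in a..b, (A s)⁻¹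

/-- The solution of `-(A u')' = F` with `u e = 0` and flux `A u' = k - primF F`. -/
noncomputable def prof (A F : ℝ → ℝ) (k e y : ℝ) : ℝ := ∫ s in y..e, (primF F s - k) / A s

variable {A F : ℝ → ℝ} {m M : ℝ}

namespace CoefBounds

lemma M_pos (h : CoefBounds A F m M) : 0 < M := h.m_pos.trans_le ((h.A_ge 0).trans (h.A_le 0))

lemma A_pos (h : CoefBounds A F m M) (x : ℝ) : 0 < A x := h.m_pos.trans_le (h.A_ge x)

lemma A_ne (h : CoefBounds A F m M) (x : ℝ) : A x ≠ 0 := (h.A_pos x).ne'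

lemma A_cont (h : CoefBounds A F m M) : Continuous A := by
  obtain ⟨K, hK⟩ := h.A_lip
  exact hK.continuous

lemma hasDerivAt_primF (h : CoefBounds A F m M) (x : ℝ) : HasDerivAt (primF F) (F x) x :=
  (h.F_cont.integral_hasStrictDerivAt 0 x).hasDerivAt

lemma primF_cont (h : CoefBounds A F m M) : Continuous (primF F) :=
  continuous_iff_continuousAt.2 fun x => (h.hasDerivAt_primF x).continuousAt

lemma primF_sub (h : CoefBounds A F m M) (a b : ℝ) :
    primF F b - primF F a = ∫ s in a..b, F s :=
  intervalIntegral.integral_interval_sub_left (h.F_cont.intervalIntegrable _ _)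
    (h.F_cont.intervalIntegrable _ _)

lemma le_primF_sub (h : CoefBounds A F m M) {a b : ℝ} (hab : a ≤ b) :
    m * (b - a) ≤ primF F b - primF F a := by
  rw [h.primF_sub]
  have := intervalIntegral.integral_mono_on hab (continuous_const.intervalIntegrable (μ := MeasureTheory.volume) (u := fun _ => m) a b)
    (h.F_cont.intervalIntegrable a b) (fun x _ => h.F_ge x)
  simp only [intervalIntegral.integral_const, smul_eq_mul] at this
  linarith

lemma primF_sub_le (h : CoefBounds A F m M) {a b : ℝ} (hab : a ≤ b) :
    primF F b - primF F a ≤ M * (b - a) := by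
  rw [h.primF_sub]
  have := intervalIntegral.integral_mono_on hab (h.F_cont.intervalIntegrable a b)
    (continuous_const.intervalIntegrable (μ := MeasureTheory.volume) (u := fun _ => M) a b) (fun x _ => h.F_le x)
  simp only [intervalIntegral.integral_const, smul_eq_mul] at this
  linarith

lemma primF_strictMono (h : CoefBounds A F m M) : StrictMono (primF F) := fun a b hab => by
  have := h.le_primF_sub hab.le
  have := mul_pos h.m_pos (sub_pos.2 hab)
  linarith

lemma abs_primF_sub_le (h : CoefBounds A F m M) (a b : ℝ) :
    |primF F b - primF F a| ≤ M * |b - a| := by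
  rcases le_total a b with hab | hab
  · rw [abs_of_nonneg (sub_nonneg.2 (h.primF_strictMono.monotone hab)),
      abs_of_nonneg (sub_nonneg.2 hab)]
    exact h.primF_sub_le hab
  · rw [abs_sub_comm, abs_sub_comm b, abs_of_nonneg (sub_nonneg.2 (h.primF_strictMono.monotone hab)),
      abs_of_nonneg (sub_nonneg.2 hab)]
    exact h.primF_sub_le hab

lemma inv_cont (h : CoefBounds A F m M) : Continuous fun s => (A s)⁻¹ :=
  h.A_cont.inv₀ h.A_ne

lemma flux_cont (h : CoefBounds A F m M) (k : ℝ) : Continuous fun s => (primF F s - k) / A s :=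
  (h.primF_cont.sub continuous_const).div h.A_cont h.A_ne

lemma wt_le (h : CoefBounds A F m M) {a b : ℝ} (hab : a ≤ b) :
    ∫ s in a..b, (A s)⁻¹ ≤ (b - a) / m := by
  have := intervalIntegral.integral_mono_on hab (h.inv_cont.intervalIntegrable a b)
    (continuous_const.intervalIntegrable (μ := MeasureTheory.volume) (u := fun _ => m⁻¹) a b) (fun x _ => inv_anti₀ h.m_pos (h.A_ge x))
  simpa [div_eq_mul_inv] using this

lemma le_wt (h : CoefBounds A F m M) {a b : ℝ} (hab : a ≤ b) :
    (b - a) / M ≤ ∫ s in a..b, (A s)⁻¹ := by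
  have := intervalIntegral.integral_mono_on hab (continuous_const.intervalIntegrable (μ := MeasureTheory.volume) (u := fun _ => M⁻¹) a b)
    (h.inv_cont.intervalIntegrable a b) (fun x _ => inv_anti₀ (h.A_pos x) (h.A_le x))
  simpa [div_eq_mul_inv] using this

lemma wt_pos (h : CoefBounds A F m M) {a b : ℝ} (hab : a < b) : 0 < ∫ s in a..b, (A s)⁻¹ :=
  (div_pos (sub_pos.2 hab) h.M_pos).trans_le (h.le_wt hab.le)

lemma wt_nonneg (h : CoefBounds A F m M) {a b : ℝ} (hab : a ≤ b) : 0 ≤ ∫ s in a..b, (A s)⁻¹ :=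
  (div_nonneg (sub_nonneg.2 hab) h.M_pos.le).trans (h.le_wt hab)

lemma integral_flux (h : CoefBounds A F m M) (k a b : ℝ) :
    ∫ s in a..b, (primF F s - k) / A s =
      (∫ s in a..b, primF F s / A s) - k * ∫ s in a..b, (A s)⁻¹ := by
  rw [← intervalIntegral.integral_const_mul, ← intervalIntegral.integral_sub]
  · congr 1; ext s; ring
  · exact (h.primF_cont.div h.A_cont h.A_ne).intervalIntegrable _ _
  · exact (continuous_const.mul h.inv_cont).intervalIntegrable _ _

lemma integral_flux_kav (h : CoefBounds A F m M) {a b : ℝ} (hab : a < b) :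
    ∫ s in a..b, (primF F s - kav A F a b) / A s = 0 := by
  rw [h.integral_flux, kav, div_mul_cancel₀ _ (h.wt_pos hab).ne', sub_self]

lemma integral_flux_add (h : CoefBounds A F m M) (k a b c : ℝ) :
    (∫ s in a..b, (primF F s - k) / A s) + (∫ s in b..c, (primF F s - k) / A s) =
      ∫ s in a..c, (primF F s - k) / A s :=
  intervalIntegral.integral_add_adjacent_intervals ((h.flux_cont k).intervalIntegrable _ _)
    ((h.flux_cont k).intervalIntegrable _ _)

lemma integral_flux_change (h : CoefBounds A F m M) (k k' a b : ℝ) :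
    (∫ s in a..b, (primF F s - k) / A s) = (∫ s in a..b, (primF F s - k') / A s) +
      (k' - k) * ∫ s in a..b, (A s)⁻¹ := by
  rw [h.integral_flux, h.integral_flux]; ring

/-- Common end of the two gap estimates: a quadratic lower bound in the length is divided by ∫ 1/A ≤
(b - a)/m. -/
lemma lower_gap_aux (h : CoefBounds A F m M) {a b I g : ℝ} (hab : a < b)
    (hI : m / M * ((b - a) ^ 2 / 2) ≤ I) (hg : g * (∫ s in a..b, (A s)⁻¹) = I) :
    m ^ 2 / (2 * M) * (b - a) ≤ g := by
  have hW := h.wt_pos hab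
  have hW2 := h.wt_le hab.le
  have hm := h.m_pos
  have hM := h.M_pos
  have hd : 0 < b - a := sub_pos.2 hab
  refine le_of_mul_le_mul_right ?_ hW
  rw [hg]
  refine le_trans ?_ hI
  calc m ^ 2 / (2 * M) * (b - a) * ∫ s in a..b, (A s)⁻¹
      ≤ m ^ 2 / (2 * M) * (b - a) * ((b - a) / m) := by gcongr
    _ = m / M * ((b - a) ^ 2 / 2) := by field_simp

/-- A quantitative Hopf lemma: the outward flux at an endpoint is at least proportional to the
length of the interval, because F ≥ m. -/
lemma right_gap (h : CoefBounds A F m M) {a b : ℝ} (hab : a < b) :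
    m ^ 2 / (2 * M) * (b - a) ≤ primF F b - kav A F a b := by
  have hM := h.M_pos
  have h1 : ∫ s in a..b, m / M * (b - s) ≤ ∫ s in a..b, -((primF F s - primF F b) / A s) := by
    refine intervalIntegral.integral_mono_on hab.le (Continuous.intervalIntegrable (by fun_prop) _ _)
      ((h.flux_cont _).neg.intervalIntegrable _ _) fun x hx => ?_
    rw [← neg_div, le_div_iff₀ (h.A_pos x)]
    have := h.le_primF_sub hx.2
    have hxb : 0 ≤ b - x := sub_nonneg.2 hx.2
    calc m / M * (b - x) * A x ≤ m / M * (b - x) * M := by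
          have := h.A_le x; have := h.m_pos; gcongr
      _ = m * (b - x) := by field_simp
      _ ≤ _ := by linarith
  have h2 : ∫ s in a..b, m / M * (b - s) = m / M * ((b - a) ^ 2 / 2) := by
    rw [intervalIntegral.integral_const_mul, intervalIntegral.integral_comp_sub_left (fun x => x)]
    simp [integral_id]
  -- Since the flux integral with `kav` vanishes, the gap times ∫ 1/A equals the integral of (primF
  -- b - primF s)/A.
  have h3 := h.integral_flux_change (kav A F a b) (primF F b) a b
  rw [h.integral_flux_kav hab] at h3
  rw [h2, intervalIntegral.integral_neg] at h1
  exact h.lower_gap_aux hab h1 (by linarith)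

lemma left_gap (h : CoefBounds A F m M) {a b : ℝ} (hab : a < b) :
    m ^ 2 / (2 * M) * (b - a) ≤ kav A F a b - primF F a := by
  have hM := h.M_pos
  have h1 : ∫ s in a..b, m / M * (s - a) ≤ ∫ s in a..b, (primF F s - primF F a) / A s := by
    refine intervalIntegral.integral_mono_on hab.le (Continuous.intervalIntegrable (by fun_prop) _ _)
      ((h.flux_cont _).intervalIntegrable _ _) fun x hx => ?_
    rw [le_div_iff₀ (h.A_pos x)]
    have := h.le_primF_sub hx.1
    have hxb : 0 ≤ x - a := sub_nonneg.2 hx.1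
    calc m / M * (x - a) * A x ≤ m / M * (x - a) * M := by
          have := h.A_le x; have := h.m_pos; gcongr
      _ = m * (x - a) := by field_simp
      _ ≤ _ := by linarith
  have h2 : ∫ s in a..b, m / M * (s - a) = m / M * ((b - a) ^ 2 / 2) := by
    rw [intervalIntegral.integral_const_mul, intervalIntegral.integral_comp_sub_right (fun x => x)]
    simp [integral_id]
  have h3 := h.integral_flux_change (kav A F a b) (primF F a) a b
  rw [h.integral_flux_kav hab] at h3
  rw [h2] at h1
  exact h.lower_gap_aux hab h1 (by linarith)

lemma gap_const_pos (h : CoefBounds A F m M) : 0 < m ^ 2 / (2 * M) := by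
  have := h.m_pos; have := h.M_pos; positivity

lemma kav_lt (h : CoefBounds A F m M) {a b : ℝ} (hab : a < b) : kav A F a b < primF F b := by
  have := h.right_gap hab
  have := mul_pos h.gap_const_pos (sub_pos.2 hab)
  linarith

lemma lt_kav (h : CoefBounds A F m M) {a b : ℝ} (hab : a < b) : primF F a < kav A F a b := by
  have := h.left_gap hab
  have := mul_pos h.gap_const_pos (sub_pos.2 hab)
  linarith

/-- The change of the constant times ∫ 1/A over (a, c) is the flux integral over the added piece.
The integrand is at most M(c - a)/m and the weight at least (c - a)/M, so the length cancels and the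
Lipschitz constant does not blow up for short intervals. -/
lemma kav_right (h : CoefBounds A F m M) {a b c : ℝ} (hab : a < b) (hbc : b ≤ c) :
    |kav A F a c - kav A F a b| ≤ M ^ 2 / m * (c - b) := by
  have hac := hab.trans_le hbc
  have hm := h.m_pos
  have hM := h.M_pos
  have hW := h.wt_pos hac
  have h1 := h.integral_flux_change (kav A F a c) (kav A F a b) a c
  rw [h.integral_flux_kav hac, ← h.integral_flux_add _ a b c, h.integral_flux_kav hab,
    zero_add] at h1
  have h2 : ‖∫ s in b..c, (primF F s - kav A F a b) / A s‖ ≤ M * (c - a) / m * |c - b| := by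
    refine intervalIntegral.norm_integral_le_of_norm_le_const fun x hx => ?_
    rw [uIoc_of_le hbc] at hx
    rw [Real.norm_eq_abs, abs_div, abs_of_pos (h.A_pos x)]
    have e1 := h.kav_lt hab
    have e2 := h.lt_kav hab
    have e3 := h.primF_strictMono hx.1
    have e4 := h.primF_strictMono.monotone hx.2
    have e5 := h.primF_sub_le hac.le
    rw [abs_of_nonneg (by linarith)]
    refine div_le_div₀ (by have := sub_nonneg.2 hac.le; positivity) (by linarith) hm (h.A_ge x)
  rw [abs_of_nonneg (sub_nonneg.2 hbc), Real.norm_eq_abs] at h2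
  have h3 : |kav A F a c - kav A F a b| * ∫ s in a..c, (A s)⁻¹ ≤
      M * (c - a) / m * (c - b) := by
    rw [← abs_of_pos hW, ← abs_mul]
    refine le_trans (le_of_eq ?_) h2
    congr 1; linarith
  have h4 := h.le_wt hac.le
  refine le_of_mul_le_mul_right ?_ (div_pos (sub_pos.2 hac) hM)
  calc _ ≤ |kav A F a c - kav A F a b| * ∫ s in a..c, (A s)⁻¹ := by gcongr
    _ ≤ _ := h3
    _ = _ := by field_simp

lemma kav_left (h : CoefBounds A F m M) {a b c : ℝ} (hab : a ≤ b) (hbc : b < c) :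
    |kav A F b c - kav A F a c| ≤ M ^ 2 / m * (b - a) := by
  have hac := hab.trans_lt hbc
  have hm := h.m_pos
  have hM := h.M_pos
  have hW := h.wt_pos hac
  have h1 := h.integral_flux_change (kav A F a c) (kav A F b c) a c
  rw [h.integral_flux_kav hac, ← h.integral_flux_add _ a b c, h.integral_flux_kav hbc,
    add_zero] at h1
  have h2 : ‖∫ s in a..b, (primF F s - kav A F b c) / A s‖ ≤ M * (c - a) / m * |b - a| := by
    refine intervalIntegral.norm_integral_le_of_norm_le_const fun x hx => ?_
    rw [uIoc_of_le hab] at hx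
    rw [Real.norm_eq_abs, abs_div, abs_of_pos (h.A_pos x)]
    have e1 := h.kav_lt hbc
    have e2 := h.lt_kav hbc
    have e3 := h.primF_strictMono hx.1
    have e4 := h.primF_strictMono.monotone hx.2
    have e5 := h.primF_sub_le hac.le
    rw [abs_of_nonpos (by linarith)]
    refine div_le_div₀ (by have := sub_nonneg.2 hac.le; positivity) (by linarith) hm (h.A_ge x)
  rw [abs_of_nonneg (sub_nonneg.2 hab), Real.norm_eq_abs] at h2
  have h3 : |kav A F b c - kav A F a c| * ∫ s in a..c, (A s)⁻¹ ≤
      M * (c - a) / m * (b - a) := by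
    rw [← abs_of_pos hW, ← abs_mul, ← abs_neg]
    refine le_trans (le_of_eq ?_) h2
    congr 1; linarith
  have h4 := h.le_wt hac.le
  refine le_of_mul_le_mul_right ?_ (div_pos (sub_pos.2 hac) hM)
  calc _ ≤ |kav A F b c - kav A F a c| * ∫ s in a..c, (A s)⁻¹ := by gcongr
    _ ≤ _ := h3
    _ = _ := by field_simp

lemma kav_right' (h : CoefBounds A F m M) {a b c : ℝ} (hab : a < b) (hac : a < c) :
    |kav A F a c - kav A F a b| ≤ M ^ 2 / m * |c - b| := by
  rcases le_total b c with hbc | hbc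
  · rw [abs_of_nonneg (sub_nonneg.2 hbc)]; exact h.kav_right hab hbc
  · rw [abs_sub_comm, abs_sub_comm c, abs_of_nonneg (sub_nonneg.2 hbc)]; exact h.kav_right hac hbc

lemma kav_left' (h : CoefBounds A F m M) {a b c : ℝ} (hac : a < c) (hbc : b < c) :
    |kav A F b c - kav A F a c| ≤ M ^ 2 / m * |b - a| := by
  rcases le_total a b with hab | hab
  · rw [abs_of_nonneg (sub_nonneg.2 hab)]; exact h.kav_left hab hbc
  · rw [abs_sub_comm, abs_sub_comm b, abs_of_nonneg (sub_nonneg.2 hab)]; exact h.kav_left hab hac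

lemma kav_lip (h : CoefBounds A F m M) {a b a' b' : ℝ} (hab : a < b) (hab' : a' < b') :
    |kav A F a' b' - kav A F a b| ≤ M ^ 2 / m * (|a' - a| + |b' - b|) := by
  rcases le_total a a' with haa | haa
  · have h1 := h.kav_left' (haa.trans_lt hab') hab'
    have h2 := h.kav_right' hab (haa.trans_lt hab')
    calc |kav A F a' b' - kav A F a b|
        = |(kav A F a' b' - kav A F a b') + (kav A F a b' - kav A F a b)| := by ring_nf
      _ ≤ _ := abs_add_le _ _
      _ ≤ _ := by linarith
  · have h1 := h.kav_left' (haa.trans_lt hab) hab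
    have h2 := h.kav_right' (haa.trans_lt hab) hab'
    rw [abs_sub_comm, abs_sub_comm a] at h1
    calc |kav A F a' b' - kav A F a b|
        = |(kav A F a' b' - kav A F a' b) + (kav A F a' b - kav A F a b)| := by ring_nf
      _ ≤ _ := abs_add_le _ _
      _ ≤ _ := by linarith

lemma hasDerivAt_prof (h : CoefBounds A F m M) (k e y : ℝ) :
    HasDerivAt (prof A F k e) (-((primF F y - k) / A y)) y :=
  intervalIntegral.integral_hasDerivAt_left ((h.flux_cont k).intervalIntegrable _ _)
    (h.flux_cont k).stronglyMeasurable.stronglyMeasurableAtFilter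
    (h.flux_cont k).continuousAt

lemma prof_cont (h : CoefBounds A F m M) (k e : ℝ) : Continuous (prof A F k e) :=
  continuous_iff_continuousAt.2 fun x => (h.hasDerivAt_prof k e x).continuousAt

/-- The profile may be integrated from either endpoint, since `kav` makes the integral over (a, b)
vanish. -/
lemma prof_left_eq (h : CoefBounds A F m M) {a b : ℝ} (hab : a < b) (y : ℝ) :
    prof A F (kav A F a b) a y = prof A F (kav A F a b) b y := by
  have := h.integral_flux_add (kav A F a b) y a b
  rw [h.integral_flux_kav hab, add_zero] at this
  exact this

lemma prof_self (k e : ℝ) : prof A F k e e = 0 := intervalIntegral.integral_same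

lemma prof_left_zero (h : CoefBounds A F m M) {a b : ℝ} (hab : a < b) :
    prof A F (kav A F a b) b a = 0 := by rw [← h.prof_left_eq hab, prof_self]

/-- The function primF - k is strictly increasing. Right of its zero the profile is integrated from
b, left of it from a; the integrand then has one sign. -/
lemma prof_pos (h : CoefBounds A F m M) {a b y : ℝ} (hy : y ∈ Ioo a b) :
    0 < prof A F (kav A F a b) b y := by
  rcases le_total (kav A F a b) (primF F y) with hk | hk
  · refine intervalIntegral.intervalIntegral_pos_of_pos_on ((h.flux_cont _).intervalIntegrable _ _)
      (fun x hx => div_pos ?_ (h.A_pos x)) hy.2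
    have := h.primF_strictMono hx.1
    linarith
  · rw [← h.prof_left_eq (hy.1.trans hy.2), prof, intervalIntegral.integral_symm, neg_pos,
      ← neg_pos, ← intervalIntegral.integral_neg]
    refine intervalIntegral.intervalIntegral_pos_of_pos_on
      ((h.flux_cont _).neg.intervalIntegrable _ _)
      (fun x hx => ?_) hy.1
    rw [Left.neg_pos_iff]
    refine div_neg_of_neg_of_pos ?_ (h.A_pos x)
    have := h.primF_strictMono hx.2
    linarith

lemma prof_nonneg (h : CoefBounds A F m M) {a b y : ℝ} (hab : a < b) (hy : y ∈ Icc a b) :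
    0 ≤ prof A F (kav A F a b) b y := by
  rcases eq_or_lt_of_le hy.1 with rfl | h1
  · rw [h.prof_left_zero hab]
  rcases eq_or_lt_of_le hy.2 with rfl | h2
  · rw [prof_self]
  exact (h.prof_pos ⟨h1, h2⟩).le

/-- Domain monotonicity, from the explicit formula: the larger profile is nonnegative at both ends
of the smaller interval. One integrates from b or from a, whichever makes the difference of the flux
constants contribute with the favourable sign. -/
lemma prof_mono (h : CoefBounds A F m M) {a b a' b' y : ℝ} (hab : a < b) (ha : a' ≤ a)
    (hb : b ≤ b') (hy : y ∈ Icc a b) :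
    prof A F (kav A F a b) b y ≤ prof A F (kav A F a' b') b' y := by
  have hab' : a' < b' := ha.trans_lt (hab.trans_le hb)
  rcases le_total (kav A F a' b') (kav A F a b) with hk | hk
  · have h1 := h.integral_flux_add (kav A F a' b') y b b'
    have h2 := h.integral_flux_change (kav A F a' b') (kav A F a b) y b
    have h3 := h.prof_nonneg hab' (y := b) ⟨ha.trans hab.le, hb⟩
    have h4 := mul_nonneg (sub_nonneg.2 hk) (h.wt_nonneg hy.2)
    simp only [prof] at *
    linarith
  · rw [← h.prof_left_eq hab]
    have h1 := h.integral_flux_add (kav A F a' b') y a b'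
    have h2 := h.integral_flux_change (kav A F a' b') (kav A F a b) y a
    have h3 := h.prof_nonneg hab' (y := a) ⟨ha, hab.le.trans hb⟩
    have h4 := mul_nonneg (sub_nonneg.2 hk) (h.wt_nonneg hy.1)
    rw [intervalIntegral.integral_symm (f := fun s => (A s)⁻¹) a y] at h2
    simp only [prof] at *
    linarith

/-- Near an endpoint `e₀` the profiles are close to linear, uniformly in the endpoint and flux. -/
lemma prof_near (h : CoefBounds A F m M) (e₀ k₀ : ℝ) {ε : ℝ} (hε : 0 < ε) :
    ∃ δ > 0, ∀ e k y, |e - e₀| < δ → |k - k₀| < δ → |y - e₀| < δ →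
      |prof A F k e y - (e - y) * ((primF F e₀ - k₀) / A e₀)| ≤ ε * |e - y| := by
  have hc : ContinuousAt (fun z : ℝ × ℝ => (primF F z.1 - z.2) / A z.1) (e₀, k₀) :=
    ContinuousAt.div ((h.primF_cont.comp continuous_fst).sub continuous_snd).continuousAt
      (h.A_cont.comp continuous_fst).continuousAt (h.A_ne _)
  obtain ⟨δ, hδ, H⟩ := Metric.continuousAt_iff.1 hc ε hε
  refine ⟨δ, hδ, fun e k y he hk hy => ?_⟩
  have h1 : (e - y) * ((primF F e₀ - k₀) / A e₀) = ∫ s in y..e, (primF F e₀ - k₀) / A e₀ := by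
    rw [intervalIntegral.integral_const, smul_eq_mul]
  rw [h1, prof, ← intervalIntegral.integral_sub ((h.flux_cont k).intervalIntegrable _ _)
    (continuous_const.intervalIntegrable _ _), ← Real.norm_eq_abs]
  refine intervalIntegral.norm_integral_le_of_norm_le_const fun s hs => ?_
  have hs' : |s - e₀| < δ := by
    have := uIoc_subset_uIcc hs
    rw [abs_lt] at *
    rcases mem_uIcc.1 this with h | h <;> constructor <;> linarith
  have := H (x := (s, k)) (by rw [Prod.dist_eq]; exact max_lt hs' hk)
  exact this.le

end CoefBounds

end HeleShaw

/-! ### The Dirichlet problem on bounded open subsets of the line -/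

namespace HeleShaw

/-- The lower endpoint of the component of `U` that contains `x`. -/
noncomputable def lo (U : Set ℝ) (x : ℝ) : ℝ := sSup {y | y ≤ x ∧ y ∉ U}

/-- The upper endpoint of the component of `U` that contains `x`. -/
noncomputable def hi (U : Set ℝ) (x : ℝ) : ℝ := sInf {y | x ≤ y ∧ y ∉ U}

open Classical in
/-- The solution of the Dirichlet problem in a bounded open subset of the line. -/
noncomputable def dsol (A F : ℝ → ℝ) (U : Set ℝ) (x : ℝ) : ℝ :=
  if x ∈ U then prof A F (kav A F (lo U x) (hi U x)) (hi U x) x else 0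

/-- The interval `(a, b)` is a component of `U`. -/
structure IsComp (U : Set ℝ) (a b : ℝ) : Prop where
  lt : a < b
  left : a ∉ U
  right : b ∉ U
  sub : Ioo a b ⊆ U

variable {A F : ℝ → ℝ} {m M : ℝ} {U : Set ℝ}

/-- Boundedness makes the sets in the definitions of `lo` and `hi` nonempty, and openness of U makes
them closed, so supremum and infimum are attained outside of U. -/
lemma isComp_lo_hi (hU : IsOpen U) (hb : Bornology.IsBounded U) {x : ℝ} (hx : x ∈ U) :
    IsComp U (lo U x) (hi U x) ∧ x ∈ Ioo (lo U x) (hi U x) := by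
  obtain ⟨R, hR⟩ := hb.subset_ball 0
  have hR' : ∀ y, R ≤ |y| → y ∉ U := fun y hy h => by
    have := hR h
    simp only [Metric.mem_ball, dist_zero_right, Real.norm_eq_abs] at this
    linarith
  have cU : IsClosed Uᶜ := hU.isClosed_compl
  have hlo : lo U x ∈ {y | y ≤ x ∧ y ∉ U} := by
    refine IsClosed.csSup_mem (isClosed_Iic.inter cU) ⟨-(|x| + |R|), ?_, hR' _ ?_⟩ ⟨x, fun y h => h.1⟩
    · have := neg_abs_le x; have := abs_nonneg R; linarith
    · rw [abs_neg]; exact ((le_abs_self R).trans (by have := abs_nonneg x; linarith)).trans (le_abs_self _)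
  have hhi : hi U x ∈ {y | x ≤ y ∧ y ∉ U} := by
    refine IsClosed.csInf_mem (isClosed_Ici.inter cU) ⟨(|x| + |R|), ?_, hR' _ ?_⟩ ⟨x, fun y h => h.1⟩
    · have := le_abs_self x; have := abs_nonneg R; linarith
    · exact ((le_abs_self R).trans (by have := abs_nonneg x; linarith)).trans (le_abs_self _)
  have h1 : lo U x < x := lt_of_le_of_ne hlo.1 fun h => hlo.2 (by rw [h]; exact hx)
  have h2 : x < hi U x := lt_of_le_of_ne hhi.1 fun h => hhi.2 (by rw [← h]; exact hx)
  refine ⟨⟨h1.trans h2, hlo.2, hhi.2, fun y hy => ?_⟩, h1, h2⟩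
  by_contra hyU
  rcases le_total y x with h | h
  · exact absurd (le_csSup ⟨x, fun y h => h.1⟩ (show y ∈ {y | y ≤ x ∧ y ∉ U} from ⟨h, hyU⟩)) (not_le.2 hy.1)
  · exact absurd (csInf_le ⟨x, fun y h => h.1⟩ (show y ∈ {y | x ≤ y ∧ y ∉ U} from ⟨h, hyU⟩)) (not_le.2 hy.2)

lemma exists_isComp (hU : IsOpen U) (hb : Bornology.IsBounded U) {x : ℝ} (hx : x ∈ U) :
    ∃ a b, IsComp U a b ∧ x ∈ Ioo a b := ⟨_, _, isComp_lo_hi hU hb hx⟩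

namespace IsComp

lemma le_left {a b a' b' x : ℝ} (h : IsComp U a b) (hs : Ioo a' b' ⊆ U) (hx : x ∈ Ioo a b)
    (hx' : x ∈ Ioo a' b') : a ≤ a' := by
  by_contra hlt
  exact h.left (hs ⟨not_le.1 hlt, hx.1.trans hx'.2⟩)

lemma le_right {a b a' b' x : ℝ} (h : IsComp U a b) (hs : Ioo a' b' ⊆ U) (hx : x ∈ Ioo a b)
    (hx' : x ∈ Ioo a' b') : b' ≤ b := by
  by_contra hlt
  exact h.right (hs ⟨hx'.1.trans hx.2, not_le.1 hlt⟩)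

lemma eq_left {a b a' b' x : ℝ} (h : IsComp U a b) (h' : IsComp U a' b') (hx : x ∈ Ioo a b)
    (hx' : x ∈ Ioo a' b') : a = a' :=
  le_antisymm (h.le_left h'.sub hx hx') (h'.le_left h.sub hx' hx)

lemma eq_right {a b a' b' x : ℝ} (h : IsComp U a b) (h' : IsComp U a' b') (hx : x ∈ Ioo a b)
    (hx' : x ∈ Ioo a' b') : b = b' :=
  le_antisymm (h'.le_right h.sub hx' hx) (h.le_right h'.sub hx hx')

/-- An interval inside of `U` that meets a component lies in it. -/
lemma mem_Icc_bound {a b R : ℝ} (h : IsComp U a b) (hR : U ⊆ Icc (-R) R) : -R ≤ a ∧ b ≤ R := by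
  have : Icc a b ⊆ Icc (-R) R := by
    rw [← closure_Ioo h.lt.ne]
    exact closure_minimal (h.sub.trans hR) isClosed_Icc
  exact ⟨(this (left_mem_Icc.2 h.lt.le)).1, (this (right_mem_Icc.2 h.lt.le)).2⟩

lemma dsol_eq (h : CoefBounds A F m M) {a b x : ℝ} (hc : IsComp U a b) (hU : IsOpen U)
    (hb : Bornology.IsBounded U) (hx : x ∈ Icc a b) :
    dsol A F U x = prof A F (kav A F a b) b x := by
  rcases eq_or_lt_of_le hx.1 with rfl | h1
  · rw [dsol, if_neg hc.left, h.prof_left_zero hc.lt]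
  rcases eq_or_lt_of_le hx.2 with rfl | h2
  · rw [dsol, if_neg hc.right, CoefBounds.prof_self]
  have hxU := hc.sub ⟨h1, h2⟩
  obtain ⟨k1, k2⟩ := isComp_lo_hi hU hb hxU
  rw [dsol, if_pos hxU, k1.eq_left hc k2 ⟨h1, h2⟩, k1.eq_right hc k2 ⟨h1, h2⟩]

end IsComp

lemma dsol_of_notMem {x : ℝ} (hx : x ∉ U) : dsol A F U x = 0 := if_neg hx

namespace CoefBounds

lemma dsol_pos (h : CoefBounds A F m M) (hU : IsOpen U) (hb : Bornology.IsBounded U) {x : ℝ}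
    (hx : x ∈ U) : 0 < dsol A F U x := by
  obtain ⟨a, b, hc, hx'⟩ := exists_isComp hU hb hx
  rw [hc.dsol_eq h hU hb (Ioo_subset_Icc_self hx')]
  exact h.prof_pos hx'

lemma dsol_nonneg (h : CoefBounds A F m M) (hU : IsOpen U) (hb : Bornology.IsBounded U) (x : ℝ) :
    0 ≤ dsol A F U x := by
  by_cases hx : x ∈ U
  · exact (h.dsol_pos hU hb hx).le
  · rw [dsol_of_notMem hx]

lemma le_dsol (h : CoefBounds A F m M) (hU : IsOpen U) (hb : Bornology.IsBounded U) {a b x : ℝ}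
    (hab : a < b) (hs : Ioo a b ⊆ U) (hx : x ∈ Icc a b) :
    prof A F (kav A F a b) b x ≤ dsol A F U x := by
  rcases eq_or_lt_of_le hx.1 with rfl | h1
  · rw [h.prof_left_zero hab]; exact h.dsol_nonneg hU hb _
  rcases eq_or_lt_of_le hx.2 with rfl | h2
  · rw [prof_self]; exact h.dsol_nonneg hU hb _
  obtain ⟨a', b', hc, hx'⟩ := exists_isComp hU hb (hs ⟨h1, h2⟩)
  rw [hc.dsol_eq h hU hb (Ioo_subset_Icc_self hx')]
  exact h.prof_mono hab (hc.le_left hs hx' ⟨h1, h2⟩) (hc.le_right hs hx' ⟨h1, h2⟩) hx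

lemma dsol_le (h : CoefBounds A F m M) (hU : IsOpen U) (hb : Bornology.IsBounded U) {a b x : ℝ}
    (hab : a < b) (hx : x ∈ Icc a b)
    (hs : ∀ a' b', IsComp U a' b' → x ∈ Ioo a' b' → a ≤ a' ∧ b' ≤ b) :
    dsol A F U x ≤ prof A F (kav A F a b) b x := by
  by_cases hxU : x ∈ U
  · obtain ⟨a', b', hc, hx'⟩ := exists_isComp hU hb hxU
    obtain ⟨h1, h2⟩ := hs _ _ hc hx'
    rw [hc.dsol_eq h hU hb (Ioo_subset_Icc_self hx')]
    exact h.prof_mono hc.lt h1 h2 (Ioo_subset_Icc_self hx')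
  · rw [dsol_of_notMem hxU]; exact h.prof_nonneg hab hx

lemma abs_flux_le (h : CoefBounds A F m M) {a b s : ℝ} (hab : a < b) (hs : s ∈ Icc a b) :
    |(primF F s - kav A F a b) / A s| ≤ M * (b - a) / m := by
  rw [abs_div, abs_of_pos (h.A_pos s)]
  have e1 := h.kav_lt hab
  have e2 := h.lt_kav hab
  have e3 := h.primF_strictMono.monotone hs.1
  have e4 := h.primF_strictMono.monotone hs.2
  have e5 := h.primF_sub_le hab.le
  have := h.M_pos
  have := h.m_pos
  refine div_le_div₀ (by have := sub_nonneg.2 hab.le; positivity) ?_ h.m_pos (h.A_ge s)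
  rw [abs_le]; constructor <;> linarith

lemma prof_le_right (h : CoefBounds A F m M) {a b y : ℝ} (hab : a < b) (hy : y ∈ Icc a b) :
    prof A F (kav A F a b) b y ≤ M * (b - a) / m * (b - y) := by
  have : ‖∫ s in y..b, (primF F s - kav A F a b) / A s‖ ≤ M * (b - a) / m * |b - y| :=
    intervalIntegral.norm_integral_le_of_norm_le_const fun s hs => by
      rw [uIoc_of_le hy.2] at hs
      exact h.abs_flux_le hab ⟨hy.1.trans hs.1.le, hs.2⟩
  rw [abs_of_nonneg (sub_nonneg.2 hy.2)] at this
  exact (le_abs_self _).trans this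

lemma prof_le_left (h : CoefBounds A F m M) {a b y : ℝ} (hab : a < b) (hy : y ∈ Icc a b) :
    prof A F (kav A F a b) b y ≤ M * (b - a) / m * (y - a) := by
  rw [← h.prof_left_eq hab]
  have : ‖∫ s in y..a, (primF F s - kav A F a b) / A s‖ ≤ M * (b - a) / m * |a - y| :=
    intervalIntegral.norm_integral_le_of_norm_le_const fun s hs => by
      rw [uIoc_comm, uIoc_of_le hy.1] at hs
      exact h.abs_flux_le hab ⟨hs.1.le, hs.2.trans hy.2⟩
  rw [abs_sub_comm, abs_of_nonneg (sub_nonneg.2 hy.1)] at this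
  exact (le_abs_self _).trans this

/-- Inside a component the solution is a profile. The delicate point is continuity outside of U,
where infinitely many components may accumulate. -/
lemma isDirichletSolution_dsol (h : CoefBounds A F m M) (hU : IsOpen U)
    (hb : Bornology.IsBounded U) : IsDirichletSolution A F U (dsol A F U) := by
  have hev : ∀ {a b : ℝ}, IsComp U a b → ∀ x ∈ Ioo a b,
      dsol A F U =ᶠ[𝓝 x] prof A F (kav A F a b) b := fun {a b} hc x hx => by
    filter_upwards [isOpen_Ioo.mem_nhds hx] with y hy
    exact hc.dsol_eq h hU hb (Ioo_subset_Icc_self hy)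
  have hd : ∀ {a b : ℝ}, IsComp U a b → ∀ x ∈ Ioo a b,
      HasDerivAt (dsol A F U) (-((primF F x - kav A F a b) / A x)) x := fun hc x hx =>
    (h.hasDerivAt_prof _ _ x).congr_of_eventuallyEq (hev hc x hx)
  refine ⟨continuous_iff_continuousAt.2 fun x => ?_, fun x hx => dsol_of_notMem hx,
    fun x hx => ?_, fun x hx => ?_⟩
  · by_cases hx : x ∈ U
    · obtain ⟨a, b, hc, hx'⟩ := exists_isComp hU hb hx
      exact (hd hc x hx').continuousAt
    · obtain ⟨R, hR⟩ := hb.subset_closedBall 0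
      rw [Real.closedBall_eq_Icc, zero_sub, zero_add] at hR
      have hm := h.m_pos
      have hM := h.M_pos
      -- An endpoint of the component of y lies between x and y, and the slopes are bounded
      -- uniformly because all lengths are at most 2|R|.
      have key : ∀ y, |dsol A F U y| ≤ M * (2 * |R|) / m * |y - x| := fun y => by
        rw [abs_of_nonneg (h.dsol_nonneg hU hb y)]
        by_cases hy : y ∈ U
        · obtain ⟨a, b, hc, hy'⟩ := exists_isComp hU hb hy
          have hB := hc.mem_Icc_bound hR
          have hab : b - a ≤ 2 * |R| := by have := le_abs_self R; linarith
          have hd : 0 ≤ b - a := sub_nonneg.2 hc.lt.le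
          rw [hc.dsol_eq h hU hb (Ioo_subset_Icc_self hy')]
          rcases le_or_gt x y with hxy | hxy
          · have hxa : x ≤ a := by
              by_contra hax
              exact hx (hc.sub ⟨not_le.1 hax, hxy.trans_lt hy'.2⟩)
            refine (h.prof_le_left hc.lt (Ioo_subset_Icc_self hy')).trans ?_
            have h1 : 0 ≤ y - a := sub_nonneg.2 hy'.1.le
            have h2 : y - a ≤ |y - x| := by rw [abs_of_nonneg (by linarith)]; linarith
            gcongr
          · have hxb : b ≤ x := by
              by_contra hxb
              exact hx (hc.sub ⟨hy'.1.trans hxy, not_le.1 hxb⟩)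
            refine (h.prof_le_right hc.lt (Ioo_subset_Icc_self hy')).trans ?_
            have h1 : 0 ≤ b - y := sub_nonneg.2 hy'.2.le
            have h2 : b - y ≤ |y - x| := by rw [abs_of_nonpos (by linarith)]; linarith
            gcongr
        · rw [dsol_of_notMem hy]; positivity
      rw [ContinuousAt, dsol_of_notMem hx]
      refine squeeze_zero_norm key ?_
      have : Tendsto (fun y => M * (2 * |R|) / m * |y - x|) (𝓝 x)
          (𝓝 (M * (2 * |R|) / m * |x - x|)) := by
        refine Continuous.tendsto ?_ x
        fun_prop
      simpa using this
  · obtain ⟨a, b, hc, hx'⟩ := exists_isComp hU hb hx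
    exact (hd hc x hx').differentiableAt
  · obtain ⟨a, b, hc, hx'⟩ := exists_isComp hU hb hx
    have : HasDerivAt (fun y => kav A F a b - primF F y) (-F x) x :=
      (h.hasDerivAt_primF x).const_sub _
    refine this.congr_of_eventuallyEq ?_
    filter_upwards [isOpen_Ioo.mem_nhds hx'] with y hy
    rw [(hd hc y hy).deriv]
    have := h.A_ne y
    field_simp
    ring

/-- The difference w of two solutions has constant flux A w' on each component and vanishes at both
ends. Rolle's theorem makes this constant zero, so w is constant. -/
lemma eq_dsol (h : CoefBounds A F m M) (hU : IsOpen U) (hb : Bornology.IsBounded U) {u : ℝ → ℝ}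
    (hu : IsDirichletSolution A F U u) : u = dsol A F U := by
  have hv := h.isDirichletSolution_dsol hU hb
  ext x
  by_cases hx : x ∈ U
  swap
  · rw [hu.eq_zero x hx, hv.eq_zero x hx]
  obtain ⟨a, b, hc, hx'⟩ := exists_isComp hU hb hx
  set w : ℝ → ℝ := fun y => u y - dsol A F U y with hw
  have hwc : Continuous w := hu.continuous.sub hv.continuous
  have hwa : w a = 0 := by simp [hw, hu.eq_zero a hc.left, hv.eq_zero a hc.left]
  have hwb : w b = 0 := by simp [hw, hu.eq_zero b hc.right, hv.eq_zero b hc.right]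
  have hdw : ∀ y ∈ Ioo a b, HasDerivAt w (deriv w y) y := fun y hy =>
    ((hu.differentiable y (hc.sub hy)).sub (hv.differentiable y (hc.sub hy))).hasDerivAt
  have hdeq : ∀ y ∈ Ioo a b, deriv w y = deriv u y - deriv (dsol A F U) y := fun y hy =>
    deriv_sub (hu.differentiable y (hc.sub hy)) (hv.differentiable y (hc.sub hy))
  have hconst : ∃ c, ∀ y ∈ Ioo a b, A y * deriv w y = c := by
    have h0 : ∀ y ∈ Ioo a b, HasDerivAt (fun y => A y * deriv u y - A y * deriv (dsol A F U) y) 0 y :=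
      fun y hy => by
        have := (hu.equation y (hc.sub hy)).sub (hv.equation y (hc.sub hy))
        rwa [sub_self] at this
    obtain ⟨c, hcc⟩ := isOpen_Ioo.exists_is_const_of_deriv_eq_zero isPreconnected_Ioo
      (fun y hy => (h0 y hy).differentiableAt.differentiableWithinAt)
      (fun y hy => (h0 y hy).deriv)
    refine ⟨c, fun y hy => ?_⟩
    rw [← hcc y hy, hdeq y hy]; ring
  obtain ⟨c, hcc⟩ := hconst
  have hwd : ∀ y ∈ Ioo a b, deriv w y = c / A y := fun y hy => by
    rw [eq_div_iff (h.A_ne y), ← hcc y hy]; ring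
  have hc0 : c = 0 := by
    obtain ⟨y, hy, hy0⟩ := exists_deriv_eq_zero hc.lt hwc.continuousOn (hwa.trans hwb.symm)
    rw [← hcc y hy, hy0, mul_zero]
  have : w x = w a := by
    obtain ⟨y, hy, hys⟩ := exists_deriv_eq_slope w hx'.1 hwc.continuousOn fun y hy =>
      (hdw y ⟨hy.1, hy.2.trans hx'.2⟩).differentiableAt.differentiableWithinAt
    rw [hwd y ⟨hy.1, hy.2.trans hx'.2⟩, hc0, zero_div, eq_comm, div_eq_zero_iff] at hys
    rcases hys with h0 | h0 <;> linarith [hx'.1]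
  have h3 : u x - dsol A F U x = 0 := this.trans hwa
  linarith

end CoefBounds

end HeleShaw

/-! ### Speeds of the endpoints and the ODE for one interval -/

namespace HeleShaw

variable {A F : ℝ → ℝ} {V : ℝ → ℝ → ℝ} {m M C : ℝ}

/-- The properties of the free boundary velocity that are used in one space dimension. -/
structure VelBounds (V : ℝ → ℝ → ℝ) (C : ℝ) : Prop where
  C_pos : 0 < C
  lip : ∀ x₁ x₂ q₁ q₂ : ℝ,
    |V x₁ q₁ - V x₂ q₂| ≤ C * (1 + |q₁|) * |x₁ - x₂| + C * |q₁ - q₂|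
  mono : ∀ x q r : ℝ, 1 ≤ r → V x q ≤ V x (r * q)
  pos : ∀ x q : ℝ, q ≠ 0 → 0 < V x q

/-- The assumption covers only factors in (1, 2); a larger factor is split into equal powers. -/
lemma velocity_mono
    (h : ∀ γ : ℝ, 0 < γ → γ < 1 → ∀ x q : ℝ, V x q ≤ V x ((1 + γ) * q)) (x q r : ℝ)
    (hr : 1 ≤ r) : V x q ≤ V x (r * q) := by
  obtain ⟨n, hn⟩ := pow_unbounded_of_one_lt r (one_lt_two)
  have hn0 : n ≠ 0 := by rintro rfl; simp at hn; linarith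
  rcases eq_or_lt_of_le hr with rfl | hr1
  · rw [one_mul]
  -- As r < 2 ^ n, the root s lies in (1, 2), so γ = s - 1 is allowed at each of the n steps.
  set s : ℝ := r ^ ((n : ℝ)⁻¹) with hs
  have hsn : s ^ n = r := Real.rpow_inv_natCast_pow (by linarith) hn0
  have hs1 : 1 < s := Real.one_lt_rpow hr1 (by positivity)
  have hs2 : s < 2 := by
    refine lt_of_pow_lt_pow_left₀ n (by norm_num) ?_
    rwa [hsn]
  have key : ∀ k : ℕ, V x q ≤ V x (s ^ k * q) := fun k => by
    induction k with
    | zero => simp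
    | succ k ih =>
      refine ih.trans ((h (s - 1) (by linarith) (by linarith) x _).trans (le_of_eq ?_))
      congr 1; ring
  rw [← hsn]; exact key n

/-- The normal velocity of an endpoint `e` of a component with flux constant `k`. -/
noncomputable def spd (A F : ℝ → ℝ) (V : ℝ → ℝ → ℝ) (e k : ℝ) : ℝ := V e ((k - primF F e) / A e)

/-- The speed of the left endpoint of `(a, b)`. -/
noncomputable def vL (A F : ℝ → ℝ) (V : ℝ → ℝ → ℝ) (a b : ℝ) : ℝ := spd A F V a (kav A F a b)

/-- The speed of the right endpoint of `(a, b)`. -/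
noncomputable def vR (A F : ℝ → ℝ) (V : ℝ → ℝ → ℝ) (a b : ℝ) : ℝ := spd A F V b (kav A F a b)

namespace VelBounds

lemma cont_right (hV : VelBounds V C) (x : ℝ) : Continuous (V x) := by
  have : LipschitzWith (Real.toNNReal C) (V x) := LipschitzWith.of_dist_le_mul fun q₁ q₂ => by
    rw [Real.dist_eq, Real.dist_eq, Real.coe_toNNReal _ hV.C_pos.le]
    simpa using hV.lip x x q₁ q₂
  exact this.continuous

lemma growth (hV : VelBounds V C) (x q : ℝ) : |V x q| ≤ |V 0 0| + C * |x| + C * |q| := by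
  have h := hV.lip 0 x 0 q
  simp only [abs_zero, add_zero, mul_one, zero_sub, abs_neg] at h
  have h2 := abs_sub_abs_le_abs_sub (V x q) (V 0 0)
  rw [abs_sub_comm] at h2
  linarith

end VelBounds

namespace CoefBounds

lemma abs_slope_le (h : CoefBounds A F m M) {a b s : ℝ} (hab : a < b) (hs : s ∈ Icc a b) :
    |(kav A F a b - primF F s) / A s| ≤ M * (b - a) / m := by
  rw [← abs_neg, ← neg_div, neg_sub]
  exact h.abs_flux_le hab hs

/-- Slopes are at most a multiple of the length and V grows at most linearly; this excludes blow-up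
in finite time. -/
lemma exists_growth (h : CoefBounds A F m M) (hV : VelBounds V C) : ∃ K > 0, ∀ a b, a < b →
    |vL A F V a b| ≤ K * (1 + max |a| |b|) ∧ |vR A F V a b| ≤ K * (1 + max |a| |b|) := by
  have hm := h.m_pos
  have hM := h.M_pos
  have hC := hV.C_pos
  refine ⟨|V 0 0| + C + C * (2 * M / m), by positivity, fun a b hab => ?_⟩
  have h1 : b - a ≤ 2 * max |a| |b| := by
    have := le_abs_self b; have := neg_abs_le a
    have := le_max_left |a| |b|; have := le_max_right |a| |b|
    linarith
  have h0 : 0 ≤ max |a| |b| := (abs_nonneg a).trans (le_max_left _ _)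
  have key : ∀ e ∈ Icc a b, |e| ≤ max |a| |b| → |spd A F V e (kav A F a b)| ≤
      (|V 0 0| + C + C * (2 * M / m)) * (1 + max |a| |b|) := fun e he heb => by
    have h2 := hV.growth e ((kav A F a b - primF F e) / A e)
    have h3 := h.abs_slope_le hab he
    have h4 : M * (b - a) / m ≤ 2 * M / m * max |a| |b| := by
      calc M * (b - a) / m ≤ M * (2 * max |a| |b|) / m := by gcongr
        _ = _ := by ring
    have h5 : C * |e| ≤ C * max |a| |b| := by gcongr
    have h6 : C * |(kav A F a b - primF F e) / A e| ≤ C * (2 * M / m * max |a| |b|) := by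
      gcongr; linarith
    have h7 : 0 ≤ |V 0 0| * max |a| |b| := by positivity
    have h8 : 0 ≤ C * (2 * M / m) := by positivity
    unfold spd
    nlinarith
  exact ⟨key a (left_mem_Icc.2 hab.le) (le_max_left _ _),
    key b (right_mem_Icc.2 hab.le) (le_max_right _ _)⟩

lemma slope_lip (h : CoefBounds A F m M) {K : NNReal} (hK : LipschitzWith K A) (e e' k k' : ℝ) :
    |(k - primF F e) / A e - (k' - primF F e') / A e'| ≤
      (|k - k'| + M * |e - e'|) / m + |k' - primF F e'| * (K * |e - e'|) / m ^ 2 := by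
  have hm := h.m_pos
  have hA := h.A_pos e
  have hA' := h.A_pos e'
  have h1 : (k - primF F e) / A e - (k' - primF F e') / A e' =
      ((k - k') - (primF F e - primF F e')) / A e +
        (k' - primF F e') * (A e' - A e) / (A e * A e') := by
    field_simp; ring
  rw [h1]
  refine (abs_add_le _ _).trans (add_le_add ?_ ?_)
  · rw [abs_div, abs_of_pos hA]
    refine div_le_div₀ (by have := h.M_pos; positivity) ?_ hm (h.A_ge e)
    exact (abs_sub _ _).trans (add_le_add le_rfl (h.abs_primF_sub_le _ _))
  · rw [abs_div, abs_mul, abs_of_pos (mul_pos hA hA'), sq]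
    have := hK.dist_le_mul e' e
    rw [Real.dist_eq, Real.dist_eq, abs_sub_comm e'] at this
    have h2 : m * m ≤ A e * A e' := mul_le_mul (h.A_ge _) (h.A_ge _) hm.le hA.le
    exact div_le_div₀ (by positivity) (by gcongr) (by positivity) h2

/-- The endpoint slopes depend on (a, b) through `kav`, whose Lipschitz constant does not depend on
the length. So the bound holds for all intervals in [-R, R], however short. -/
lemma exists_speed_lip (h : CoefBounds A F m M) (hV : VelBounds V C) (R : ℝ) :
    ∃ L ≥ 0, ∀ a b a' b', a < b → a' < b' → |a| ≤ R → |b| ≤ R → |a'| ≤ R → |b'| ≤ R →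
      |vL A F V a b - vL A F V a' b'| ≤ L * (|a - a'| + |b - b'|) ∧
      |vR A F V a b - vR A F V a' b'| ≤ L * (|a - a'| + |b - b'|) := by
  obtain ⟨K, hK⟩ := h.A_lip
  have hm := h.m_pos
  have hM := h.M_pos
  have hC := hV.C_pos
  rcases lt_or_ge R 0 with hR | hR
  · exact ⟨0, le_rfl, fun a b a' b' _ _ ha => absurd (abs_nonneg a) (by linarith)⟩
  set Q := M * (2 * R) / m with hQ
  set Lq := (M ^ 2 / m + M) / m + M * (2 * R) * K / m ^ 2 with hLq
  have hQ0 : 0 ≤ Q := by positivity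
  have hLq0 : 0 ≤ Lq := by positivity
  refine ⟨C * (1 + Q) + C * Lq, by positivity, fun a b a' b' hab hab' ha hb ha' hb' => ?_⟩
  have hbox : ∀ {x y : ℝ}, |x| ≤ R → |y| ≤ R → y - x ≤ 2 * R := fun hx hy => by
    have := (abs_le.1 hx).1; have := (abs_le.1 hy).2; linarith
  have hk := h.kav_lip hab' hab
  have key : ∀ e e', e ∈ Icc a b → e' ∈ Icc a' b' → |e - e'| ≤ |a - a'| + |b - b'| →
      |spd A F V e (kav A F a b) - spd A F V e' (kav A F a' b')| ≤
        (C * (1 + Q) + C * Lq) * (|a - a'| + |b - b'|) := fun e e' he he' hee => by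
    have h1 := h.slope_lip hK e e' (kav A F a b) (kav A F a' b')
    have h2 : |kav A F a' b' - primF F e'| ≤ M * (2 * R) := by
      have e1 := h.kav_lt hab'
      have e2 := h.lt_kav hab'
      have e3 := h.primF_strictMono.monotone he'.1
      have e4 := h.primF_strictMono.monotone he'.2
      have e5 := h.primF_sub_le hab'.le
      have e6 : M * (b' - a') ≤ M * (2 * R) := by gcongr; exact hbox ha' hb'
      rw [abs_le]; constructor <;> linarith
    have h3 : |(kav A F a b - primF F e) / A e| ≤ Q :=
      (h.abs_slope_le hab he).trans (by rw [hQ]; gcongr; exact hbox ha hb)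
    set d := |a - a'| + |b - b'| with hd
    have h4 : |(kav A F a b - primF F e) / A e - (kav A F a' b' - primF F e') / A e'| ≤ Lq * d := by
      refine h1.trans ?_
      calc _ ≤ (M ^ 2 / m * d + M * d) / m + M * (2 * R) * (K * d) / m ^ 2 := by gcongr
        _ = Lq * d := by rw [hLq]; ring
    refine (hV.lip _ _ _ _).trans ?_
    calc _ ≤ C * (1 + Q) * d + C * (Lq * d) := by gcongr
      _ = _ := by ring
  exact ⟨key a a' (left_mem_Icc.2 hab.le) (left_mem_Icc.2 hab'.le)
      (le_add_of_nonneg_right (abs_nonneg _)),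
    key b b' (right_mem_Icc.2 hab.le) (right_mem_Icc.2 hab'.le)
      (le_add_of_nonneg_left (abs_nonneg _))⟩

lemma slope_left_pos (h : CoefBounds A F m M) {a b : ℝ} (hab : a < b) :
    0 < (kav A F a b - primF F a) / A a := div_pos (sub_pos.2 (h.lt_kav hab)) (h.A_pos _)

lemma slope_right_neg (h : CoefBounds A F m M) {a b : ℝ} (hab : a < b) :
    (kav A F a b - primF F b) / A b < 0 :=
  div_neg_of_neg_of_pos (sub_neg.2 (h.kav_lt hab)) (h.A_pos _)

lemma vL_pos (h : CoefBounds A F m M) (hV : VelBounds V C) {a b : ℝ} (hab : a < b) :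
    0 < vL A F V a b := hV.pos _ _ (h.slope_left_pos hab).ne'

lemma vR_pos (h : CoefBounds A F m M) (hV : VelBounds V C) {a b : ℝ} (hab : a < b) :
    0 < vR A F V a b := hV.pos _ _ (h.slope_right_neg hab).ne

/-- A lower bound for `V` for slopes in compact ranges gives a lower bound for the speeds of
intervals of length at least `ℓ`. -/
lemma exists_speed_lower (h : CoefBounds A F m M) {ℓ : ℝ}
    (hlow : ∀ Q, ∃ c > 0, ∀ x q, m ^ 2 / (2 * M) * ℓ / M ≤ |q| → |q| ≤ Q → c ≤ V x q) (R : ℝ) :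
    ∃ c > 0, ∀ a b, a < b → ℓ ≤ b - a → |a| ≤ R → |b| ≤ R →
      c ≤ vL A F V a b ∧ c ≤ vR A F V a b := by
  have hm := h.m_pos
  have hM := h.M_pos
  obtain ⟨c, hc, H⟩ := hlow (M * (2 * R) / m)
  refine ⟨c, hc, fun a b hab hℓ ha hb => ?_⟩
  have hbox : b - a ≤ 2 * R := by
    have := (abs_le.1 ha).1; have := (abs_le.1 hb).2; linarith
  have hup : ∀ e ∈ Icc a b, |(kav A F a b - primF F e) / A e| ≤ M * (2 * R) / m := fun e he =>
    (h.abs_slope_le hab he).trans (by gcongr)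
  have hlo : ∀ e g, m ^ 2 / (2 * M) * (b - a) ≤ g →
      m ^ 2 / (2 * M) * ℓ / M ≤ g / A e := fun e g hg => by
    have h0 : 0 ≤ m ^ 2 / (2 * M) * (b - a) := mul_nonneg h.gap_const_pos.le (sub_nonneg.2 hab.le)
    calc m ^ 2 / (2 * M) * ℓ / M ≤ m ^ 2 / (2 * M) * (b - a) / M := by gcongr
      _ ≤ g / A e := div_le_div₀ (h0.trans hg) hg (h.A_pos e) (h.A_le e)
  refine ⟨H _ _ ?_ (hup a (left_mem_Icc.2 hab.le)), H _ _ ?_ (hup b (right_mem_Icc.2 hab.le))⟩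
  · rw [abs_of_pos (h.slope_left_pos hab)]
    exact hlo _ _ (h.left_gap hab)
  · rw [abs_of_neg (h.slope_right_neg hab), ← neg_div, neg_sub]
    exact hlo _ _ (h.right_gap hab)

end CoefBounds

/-- The endpoints `α`, `β` of an interval move on `[s, t]` with the speeds of that interval. -/
structure IsTraj (A F : ℝ → ℝ) (V : ℝ → ℝ → ℝ) (s t : ℝ) (α β : ℝ → ℝ) : Prop where
  lt : ∀ τ ∈ Icc s t, α τ < β τ
  left : ∀ τ ∈ Icc s t, HasDerivWithinAt α (-vL A F V (α τ) (β τ)) (Icc s t) τ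
  right : ∀ τ ∈ Icc s t, HasDerivWithinAt β (vR A F V (α τ) (β τ)) (Icc s t) τ

lemma IsTraj.mono {s t s' t' : ℝ} {α β : ℝ → ℝ} (h : IsTraj A F V s t α β)
    (hs : Icc s' t' ⊆ Icc s t) : IsTraj A F V s' t' α β :=
  ⟨fun τ hτ => h.lt τ (hs hτ), fun τ hτ => (h.left τ (hs hτ)).mono hs,
    fun τ hτ => (h.right τ (hs hτ)).mono hs⟩

/-- The speeds are extended from a region D of the (a, b)-plane to a bounded Lipschitz field on the
whole plane. Picard–Lindelöf then applies on all of [s, L] at once, and the a priori bounds show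
that the solution never leaves D. -/
lemma CoefBounds.exists_isTraj (h : CoefBounds A F m M) (hV : VelBounds V C) {K : ℝ} (hK : 0 < K)
    (hgr : ∀ a b, a < b →
      |vL A F V a b| ≤ K * (1 + max |a| |b|) ∧ |vR A F V a b| ≤ K * (1 + max |a| |b|))
    {s L a b : ℝ} (hsL : s ≤ L) (hab : a < b) :
    ∃ α β : ℝ → ℝ, α s = a ∧ β s = b ∧ IsTraj A F V s L α β ∧ ∀ t ∈ Icc s L,
      b - a ≤ β t - α t ∧ 1 + max |α t| |β t| ≤ (1 + max |a| |b|) * Real.exp (K * (t - s)) := by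
  set R := (1 + max |a| |b|) * Real.exp (K * (L - s)) with hR
  obtain ⟨Lv, hLv, hlip⟩ := h.exists_speed_lip hV R
  set D : Set (ℝ × ℝ) := {z | z.1 < z.2 ∧ |z.1| ≤ R ∧ |z.2| ≤ R} with hD
  have hext : ∀ f : ℝ → ℝ → ℝ, (∀ a b a' b', a < b → a' < b' → |a| ≤ R → |b| ≤ R → |a'| ≤ R →
      |b'| ≤ R → |f a b - f a' b'| ≤ Lv * (|a - a'| + |b - b'|)) →
      (∀ z ∈ D, 0 ≤ f z.1 z.2 ∧ f z.1 z.2 ≤ K * (1 + ‖z‖)) →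
      ∃ g : ℝ × ℝ → ℝ, (∃ N, LipschitzWith N g) ∧ (∀ z, 0 ≤ g z) ∧ (∀ z, g z ≤ K * (1 + R)) ∧
        (∀ z, g z ≤ K * (1 + ‖z‖)) ∧ ∀ z ∈ D, g z = f z.1 z.2 := by
    intro f hf hfb
    have : LipschitzOnWith (Real.toNNReal (2 * Lv)) (fun z : ℝ × ℝ => f z.1 z.2) D := by
      refine LipschitzOnWith.of_dist_le_mul fun z hz w hw => ?_
      rw [Real.coe_toNNReal _ (by positivity), Real.dist_eq]
      refine (hf _ _ _ _ hz.1 hw.1 hz.2.1 hz.2.2 hw.2.1 hw.2.2).trans ?_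
      rw [Prod.dist_eq, Real.dist_eq, Real.dist_eq]
      have := le_max_left |z.1 - w.1| |z.2 - w.2|
      have := le_max_right |z.1 - w.1| |z.2 - w.2|
      nlinarith
    obtain ⟨g, hg, hgf⟩ := this.extend_real
    have hn : LipschitzWith (Real.toNNReal K) (fun z : ℝ × ℝ => K * (1 + ‖z‖)) := by
      refine LipschitzWith.of_dist_le_mul fun z w => ?_
      rw [Real.coe_toNNReal _ hK.le, Real.dist_eq, ← mul_sub, abs_mul, abs_of_pos hK,
        add_sub_add_left_eq_sub, dist_eq_norm]
      gcongr
      exact abs_norm_sub_norm_le z w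
    have h0R : 0 ≤ R := by positivity
    -- Each truncation serves one bound: nonnegativity keeps the length from shrinking, the constant
    -- gives existence up to L, and linear growth feeds Gronwall. On D none of them is active.
    refine ⟨fun z => max 0 (min (min (g z) (K * (1 + R))) (K * (1 + ‖z‖))),
      ⟨_, ((hg.min_const _).min hn).const_max 0⟩, fun z => le_max_left _ _, fun z => ?_,
      fun z => ?_, fun z hz => ?_⟩
    · exact max_le (by positivity) ((min_le_left _ _).trans (min_le_right _ _))
    · exact max_le (by positivity) (min_le_right _ _)
    · have h1 := hgf hz
      simp only at h1
      have hz2 : ‖z‖ ≤ R := by rw [Prod.norm_def]; exact max_le hz.2.1 hz.2.2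
      obtain ⟨h2, h3⟩ := hfb z hz
      have h4 : K * (1 + ‖z‖) ≤ K * (1 + R) := by gcongr
      simp only
      rw [← h1, min_eq_left (h3.trans h4), min_eq_left h3, max_eq_right h2]
  have hpos : ∀ z ∈ D, (0 ≤ vL A F V z.1 z.2 ∧ vL A F V z.1 z.2 ≤ K * (1 + ‖z‖)) ∧
      (0 ≤ vR A F V z.1 z.2 ∧ vR A F V z.1 z.2 ≤ K * (1 + ‖z‖)) := fun z hz =>
    ⟨⟨(h.vL_pos hV hz.1).le, (le_abs_self _).trans (hgr _ _ hz.1).1⟩,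
      ⟨(h.vR_pos hV hz.1).le, (le_abs_self _).trans (hgr _ _ hz.1).2⟩⟩
  obtain ⟨gL, ⟨NL, hNL⟩, gL0, gLR, gLK, gLe⟩ := hext (vL A F V)
    (fun a b a' b' h1 h2 h3 h4 h5 h6 => (hlip a b a' b' h1 h2 h3 h4 h5 h6).1)
    (fun z hz => (hpos z hz).1)
  obtain ⟨gR, ⟨NR, hNR⟩, gR0, gRR, gRK, gRe⟩ := hext (vR A F V)
    (fun a b a' b' h1 h2 h3 h4 h5 h6 => (hlip a b a' b' h1 h2 h3 h4 h5 h6).2)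
    (fun z hz => (hpos z hz).2)
  have h0R : 0 ≤ R := by positivity
  set f : ℝ × ℝ → ℝ × ℝ := fun z => (-gL z, gR z) with hf
  have hfl : ∃ N, LipschitzWith N f := ⟨_, hNL.neg.prodMk hNR⟩
  obtain ⟨N, hN⟩ := hfl
  have hfn : ∀ z, ‖f z‖ ≤ K * (1 + R) := fun z => by
    rw [Prod.norm_def, hf]
    simp only [norm_neg, Real.norm_eq_abs, abs_of_nonneg (gL0 z), abs_of_nonneg (gR0 z)]
    exact max_le (gLR z) (gRR z)
  have hfK : ∀ z, ‖f z‖ ≤ K * ‖z‖ + K := fun z => by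
    rw [Prod.norm_def, hf]
    simp only [norm_neg, Real.norm_eq_abs, abs_of_nonneg (gL0 z), abs_of_nonneg (gR0 z)]
    exact max_le ((gLK z).trans (by linarith)) ((gRK z).trans (by linarith))
  have hPL : IsPicardLindelof (fun _ => f) (tmin := s) (tmax := L) ⟨s, left_mem_Icc.2 hsL⟩ (a, b)
      (Real.toNNReal (K * (1 + R) * (L - s))) 0 (Real.toNNReal (K * (1 + R))) N := by
    refine ⟨fun t _ => hN.lipschitzOnWith, fun x _ => continuousOn_const, fun t _ x _ => ?_, ?_⟩
    · rw [Real.coe_toNNReal _ (by positivity)]; exact hfn x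
    · have hLs : 0 ≤ L - s := sub_nonneg.2 hsL
      simp only [sub_self, max_eq_left hLs, NNReal.coe_zero, sub_zero]
      rw [Real.coe_toNNReal _ (by positivity), Real.coe_toNNReal _ (by positivity)]
  obtain ⟨γ, hγs, hγ⟩ := hPL.exists_eq_forall_mem_Icc_hasDerivWithinAt₀
  simp only at hγs
  have hγc : ContinuousOn γ (Icc s L) := fun t ht => (hγ t ht).continuousWithinAt
  -- Gronwall with the linear growth of the truncated field; the resulting bound at L is the radius
  -- R that defines D.
  have hgron : ∀ t ∈ Icc s L, 1 + ‖γ t‖ ≤ (1 + max |a| |b|) * Real.exp (K * (t - s)) := by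
    intro t ht
    have := norm_le_gronwallBound_of_norm_deriv_right_le (f' := fun t => f (γ t)) (δ := max |a| |b|)
      (K := K) (ε := K) hγc (fun t ht => ((hγ t ⟨ht.1, ht.2.le⟩).mono_of_mem_nhdsWithin
        (Icc_mem_nhdsGE_of_mem ht))) (by rw [hγs]; rfl) (fun t _ => hfK _) t ht
    rw [gronwallBound_of_K_ne_0 hK.ne', div_self hK.ne'] at this
    linarith
  have hd1 : ∀ t ∈ Icc s L, HasDerivWithinAt (fun t => (γ t).1) (-gL (γ t)) (Icc s L) t :=
    fun t ht => (hasFDerivAt_fst.comp_hasDerivWithinAt t (hγ t ht) :)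
  have hd2 : ∀ t ∈ Icc s L, HasDerivWithinAt (fun t => (γ t).2) (gR (γ t)) (Icc s L) t :=
    fun t ht => (hasFDerivAt_snd.comp_hasDerivWithinAt t (hγ t ht) :)
  have hlen : ∀ t ∈ Icc s L, b - a ≤ (γ t).2 - (γ t).1 := by
    have hmono : MonotoneOn (fun t => (γ t).2 - (γ t).1) (Icc s L) := by
      refine monotoneOn_of_hasDerivWithinAt_nonneg (f' := fun t => gR (γ t) - -gL (γ t))
        (convex_Icc s L) (fun t ht => ((hd2 t ht).sub (hd1 t ht)).continuousWithinAt)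
        (fun t ht => ?_) (fun t _ => by have := gL0 (γ t); have := gR0 (γ t); linarith)
      exact ((hd2 t (interior_subset ht)).sub (hd1 t (interior_subset ht))).mono interior_subset
    intro t ht
    have := hmono (left_mem_Icc.2 hsL) ht ht.1
    simpa only [hγs] using this
  have hmem : ∀ t ∈ Icc s L, γ t ∈ D := fun t ht => by
    have h1 := hgron t ht
    have h2 : (1 + max |a| |b|) * Real.exp (K * (t - s)) ≤ R := by
      rw [hR]; gcongr; exact ht.2
    have h3 : ‖γ t‖ ≤ R := by linarith
    have h4 := hlen t ht
    exact ⟨by linarith, (norm_fst_le (γ t)).trans h3, (norm_snd_le (γ t)).trans h3⟩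
  refine ⟨fun t => (γ t).1, fun t => (γ t).2, by simp [hγs], by simp [hγs],
    ⟨fun t ht => (hmem t ht).1, fun t ht => ?_, fun t ht => ?_⟩, fun t ht => ⟨hlen t ht, ?_⟩⟩
  · rw [← gLe _ (hmem t ht)]; exact hd1 t ht
  · rw [← gRe _ (hmem t ht)]; exact hd2 t ht
  · have := hgron t ht
    rwa [Prod.norm_def] at this

end HeleShaw

/-! ### Evolution of finitely many intervals, with mergers -/

namespace HeleShaw

variable {A F : ℝ → ℝ} {V : ℝ → ℝ → ℝ} {m M C ℓ N K : ℝ}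

/-- Bounds for the intervals that occur at time `τ`. -/
def Adm (ℓ N K τ a b : ℝ) : Prop := ℓ ≤ b - a ∧ 1 + max |a| |b| ≤ N * Real.exp (K * τ)

/-- On `[s, t]` the set `S` is a union of disjoint intervals that evolve independently. -/
structure IsTrajFamily (A F : ℝ → ℝ) (V : ℝ → ℝ → ℝ) (ℓ N K s t : ℝ) {ι : Type}
    (α β : ι → ℝ → ℝ) (S : ℝ → Set ℝ) : Prop where
  traj : ∀ i, IsTraj A F V s t (α i) (β i)
  adm : ∀ τ ∈ Icc s t, ∀ i, Adm ℓ N K τ (α i τ) (β i τ)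
  disj : ∀ τ ∈ Icc s t, ∀ i j, i ≠ j → β i τ ≤ α j τ ∨ β j τ ≤ α i τ
  eq : ∀ τ ∈ Icc s t, S τ = ⋃ i, Ioo (α i τ) (β i τ)

/-- An evolution of open sets on `[s, L)` which, to the left of each time, is generated by
finitely many intervals whose endpoints solve the free boundary ODEs. -/
structure Gen (A F : ℝ → ℝ) (V : ℝ → ℝ → ℝ) (ℓ N K s L : ℝ) (S : ℝ → Set ℝ) : Prop where
  opn : ∀ t ∈ Ico s L, ∀ x ∈ S t, ∀ᶠ z in 𝓝[{z : ℝ × ℝ | s ≤ z.2}] (x, t), z.1 ∈ S z.2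
  mono : ∀ t t', s ≤ t → t ≤ t' → t' < L → S t ⊆ S t'
  rusc : ∀ t ∈ Ico s L, ∀ ε > 0, ∀ᶠ τ in 𝓝[>] t, S τ ⊆ Metric.thickening ε (S t)
  left : ∀ t ∈ Ioo s L, ∃ s' ∈ Ico s t, ∃ (ι : Type) (_ : Finite ι) (α β : ι → ℝ → ℝ),
    IsTrajFamily A F V ℓ N K s' t α β S

lemma Ioo_subset_thickening {a b a' b' ε : ℝ} (hab : a < b) (ha : |a' - a| < ε)
    (hb : |b' - b| < ε) : Ioo a' b' ⊆ Metric.thickening ε (Ioo a b) := by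
  rw [← Metric.thickening_closure, closure_Ioo hab.ne]
  intro y hy
  have hε : 0 < ε := (abs_nonneg _).trans_lt ha
  rw [abs_lt] at ha hb
  rw [Metric.mem_thickening_iff]
  rcases le_total y a with h1 | h1
  · exact ⟨a, left_mem_Icc.2 hab.le, by rw [Real.dist_eq, abs_lt]; constructor <;> linarith [hy.1]⟩
  rcases le_total b y with h2 | h2
  · exact ⟨b, right_mem_Icc.2 hab.le, by rw [Real.dist_eq, abs_lt]; constructor <;> linarith [hy.2]⟩
  · exact ⟨y, ⟨h1, h2⟩, by simpa using hε⟩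

namespace IsTraj

variable {s t : ℝ} {α β : ℝ → ℝ}

lemma contL (h : IsTraj A F V s t α β) : ContinuousOn α (Icc s t) := fun τ hτ =>
  (h.left τ hτ).continuousWithinAt

lemma contR (h : IsTraj A F V s t α β) : ContinuousOn β (Icc s t) := fun τ hτ =>
  (h.right τ hτ).continuousWithinAt

/-- If the speeds are at least `c` on `[s, t]`, the endpoints move at least by `c (t' - t)`. -/
lemma lower (h : IsTraj A F V s t α β) {c : ℝ}
    (hc : ∀ τ ∈ Icc s t, c ≤ vL A F V (α τ) (β τ) ∧ c ≤ vR A F V (α τ) (β τ)) {τ τ' : ℝ}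
    (h1 : τ ∈ Icc s t) (h2 : τ' ∈ Icc s t) (hτ : τ ≤ τ') :
    α τ' + c * (τ' - τ) ≤ α τ ∧ β τ + c * (τ' - τ) ≤ β τ' := by
  have hid : ∀ u, HasDerivWithinAt (fun r => c * r) c (interior (Icc s t)) u := fun u => by
    simpa using ((hasDerivAt_id u).const_mul c).hasDerivWithinAt
  have e1 : MonotoneOn (fun r => -α r - c * r) (Icc s t) :=
    monotoneOn_of_hasDerivWithinAt_nonneg (f' := fun r => - -vL A F V (α r) (β r) - c)
      (convex_Icc s t) (h.contL.neg.sub (by fun_prop))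
      (fun r hr => ((h.left r (interior_subset hr)).mono interior_subset).neg.sub (hid r))
      (fun r hr => by have := (hc r (interior_subset hr)).1; linarith)
  have e2 : MonotoneOn (fun r => β r - c * r) (Icc s t) :=
    monotoneOn_of_hasDerivWithinAt_nonneg (f' := fun r => vR A F V (α r) (β r) - c)
      (convex_Icc s t) (h.contR.sub (by fun_prop))
      (fun r hr => ((h.right r (interior_subset hr)).mono interior_subset).sub (hid r))
      (fun r hr => by have := (hc r (interior_subset hr)).2; linarith)
  have e3 := e1 h1 h2 hτ
  have e4 := e2 h1 h2 hτ
  simp only at e3 e4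
  constructor <;> linarith

lemma upper (h : IsTraj A F V s t α β) {c : ℝ}
    (hc : ∀ τ ∈ Icc s t, vL A F V (α τ) (β τ) ≤ c ∧ vR A F V (α τ) (β τ) ≤ c) {τ τ' : ℝ}
    (h1 : τ ∈ Icc s t) (h2 : τ' ∈ Icc s t) (hτ : τ ≤ τ') :
    α τ ≤ α τ' + c * (τ' - τ) ∧ β τ' ≤ β τ + c * (τ' - τ) := by
  have hid : ∀ u, HasDerivWithinAt (fun r => c * r) c (interior (Icc s t)) u := fun u => by
    simpa using ((hasDerivAt_id u).const_mul c).hasDerivWithinAt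
  have e1 : MonotoneOn (fun r => α r + c * r) (Icc s t) :=
    monotoneOn_of_hasDerivWithinAt_nonneg (f' := fun r => -vL A F V (α r) (β r) + c)
      (convex_Icc s t) (h.contL.add (by fun_prop))
      (fun r hr => ((h.left r (interior_subset hr)).mono interior_subset).add (hid r))
      (fun r hr => by have := (hc r (interior_subset hr)).1; linarith)
  have e2 : MonotoneOn (fun r => c * r - β r) (Icc s t) :=
    monotoneOn_of_hasDerivWithinAt_nonneg (f' := fun r => c - vR A F V (α r) (β r))
      (convex_Icc s t) (ContinuousOn.sub (by fun_prop) h.contR)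
      (fun r hr => (hid r).sub ((h.right r (interior_subset hr)).mono interior_subset))
      (fun r hr => by have := (hc r (interior_subset hr)).2; linarith)
  have e3 := e1 h1 h2 hτ
  have e4 := e2 h1 h2 hτ
  simp only at e3 e4
  constructor <;> linarith

lemma monotone (hA : CoefBounds A F m M) (hV : VelBounds V C) (h : IsTraj A F V s t α β)
    {τ τ' : ℝ} (h1 : τ ∈ Icc s t) (h2 : τ' ∈ Icc s t) (hτ : τ ≤ τ') :
    α τ' ≤ α τ ∧ β τ ≤ β τ' := by
  simpa using h.lower (c := 0) (fun τ hτ => ⟨(hA.vL_pos hV (h.lt τ hτ)).le,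
    (hA.vR_pos hV (h.lt τ hτ)).le⟩) h1 h2 hτ

end IsTraj

namespace IsTrajFamily

variable {s t : ℝ} {ι : Type} {α β : ι → ℝ → ℝ} {S : ℝ → Set ℝ}

lemma restrict (h : IsTrajFamily A F V ℓ N K s t α β S) {s' t' : ℝ} (hs : Icc s' t' ⊆ Icc s t) :
    IsTrajFamily A F V ℓ N K s' t' α β S :=
  ⟨fun i => (h.traj i).mono hs, fun τ hτ => h.adm τ (hs hτ), fun τ hτ => h.disj τ (hs hτ),
    fun τ hτ => h.eq τ (hs hτ)⟩

lemma congr (h : IsTrajFamily A F V ℓ N K s t α β S) {S' : ℝ → Set ℝ}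
    (hS : ∀ τ ∈ Icc s t, S' τ = S τ) : IsTrajFamily A F V ℓ N K s t α β S' :=
  ⟨h.traj, h.adm, h.disj, fun τ hτ => (hS τ hτ).trans (h.eq τ hτ)⟩

lemma mono (hA : CoefBounds A F m M) (hV : VelBounds V C)
    (h : IsTrajFamily A F V ℓ N K s t α β S) {τ τ' : ℝ}
    (h1 : τ ∈ Icc s t) (h2 : τ' ∈ Icc s t) (hτ : τ ≤ τ') : S τ ⊆ S τ' := by
  rw [h.eq τ h1, h.eq τ' h2]
  exact iUnion_mono fun i => Ioo_subset_Ioo ((h.traj i).monotone hA hV h1 h2 hτ).1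
    ((h.traj i).monotone hA hV h1 h2 hτ).2

lemma isComp (h : IsTrajFamily A F V ℓ N K s t α β S) {τ : ℝ} (hτ : τ ∈ Icc s t) (i : ι) :
    IsComp (S τ) (α i τ) (β i τ) := by
  have hlt := fun j => (h.traj j).lt τ hτ
  refine ⟨hlt i, ?_, ?_, by rw [h.eq τ hτ]; exact subset_iUnion (fun i => Ioo (α i τ) (β i τ)) i⟩
  all_goals
    rw [h.eq τ hτ, mem_iUnion]
    rintro ⟨j, hj⟩
    by_cases hij : i = j
    · subst hij; exact absurd hj (by simp)
    have := hlt i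
    rcases h.disj τ hτ i j hij with hd | hd <;> linarith [hj.1, hj.2]

lemma opn (h : IsTrajFamily A F V ℓ N K s t α β S) {τ x : ℝ} (hτ : τ ∈ Icc s t) (hx : x ∈ S τ) :
    ∀ᶠ z in 𝓝[{z : ℝ × ℝ | z.2 ∈ Icc s t}] (x, τ), z.1 ∈ S z.2 := by
  rw [h.eq τ hτ, mem_iUnion] at hx
  obtain ⟨i, hi⟩ := hx
  have hm : MapsTo Prod.snd {z : ℝ × ℝ | z.2 ∈ Icc s t} (Icc s t) := fun z hz => hz
  have hs : ContinuousWithinAt Prod.snd {z : ℝ × ℝ | z.2 ∈ Icc s t} (x, τ) :=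
    continuous_snd.continuousWithinAt
  have hf : ContinuousWithinAt Prod.fst {z : ℝ × ℝ | z.2 ∈ Icc s t} (x, τ) :=
    continuous_fst.continuousWithinAt
  have e1 : ContinuousWithinAt (fun z : ℝ × ℝ => α i z.2) {z : ℝ × ℝ | z.2 ∈ Icc s t} (x, τ) :=
    ContinuousWithinAt.comp (f := Prod.snd) (g := α i) ((h.traj i).contL τ hτ) hs hm
  have e2 : ContinuousWithinAt (fun z : ℝ × ℝ => β i z.2) {z : ℝ × ℝ | z.2 ∈ Icc s t} (x, τ) :=
    ContinuousWithinAt.comp (f := Prod.snd) (g := β i) ((h.traj i).contR τ hτ) hs hm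
  filter_upwards [e1.eventually_lt hf hi.1, hf.eventually_lt e2 hi.2, self_mem_nhdsWithin]
    with z h1 h2 h3
  rw [h.eq z.2 h3]
  exact mem_iUnion.2 ⟨i, h1, h2⟩

lemma usc [Finite ι] (h : IsTrajFamily A F V ℓ N K s t α β S) {τ ε : ℝ} (hτ : τ ∈ Icc s t)
    (hε : 0 < ε) : ∀ᶠ τ' in 𝓝[Icc s t] τ,
      S τ' ⊆ Metric.thickening ε (S τ) ∧ S τ ⊆ Metric.thickening ε (S τ') := by
  have e1 : ∀ i, ∀ᶠ τ' in 𝓝[Icc s t] τ, |α i τ' - α i τ| < ε := fun i =>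
    Metric.tendsto_nhds.1 ((h.traj i).contL τ hτ) ε hε
  have e2 : ∀ i, ∀ᶠ τ' in 𝓝[Icc s t] τ, |β i τ' - β i τ| < ε := fun i =>
    Metric.tendsto_nhds.1 ((h.traj i).contR τ hτ) ε hε
  filter_upwards [eventually_all.2 e1, eventually_all.2 e2, self_mem_nhdsWithin] with τ' h1 h2 h3
  rw [h.eq τ hτ, h.eq τ' h3, Metric.thickening_iUnion, Metric.thickening_iUnion]
  refine ⟨iUnion_mono fun i => Ioo_subset_thickening ((h.traj i).lt τ hτ) (h1 i) (h2 i),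
    iUnion_mono fun i => Ioo_subset_thickening ((h.traj i).lt τ' h3) ?_ ?_⟩
  · rw [abs_sub_comm]; exact h1 i
  · rw [abs_sub_comm]; exact h2 i

end IsTrajFamily

/-- Restart at a merging time t. The glued evolution takes the value S t at t itself, so a contact
point is still missing at t and is filled in only afterwards. Since S' t lies in the closure of S t,
this is invisible to thickenings, and upper semicontinuity from the right survives. -/
lemma gen_glue (hA : CoefBounds A F m M) (hV : VelBounds V C) {s t L : ℝ} {ι : Type} [Finite ι]
    {α β : ι → ℝ → ℝ} {S S' : ℝ → Set ℝ} (hst : s ≤ t)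
    (h : IsTrajFamily A F V ℓ N K s t α β S) (h' : Gen A F V ℓ N K t L S')
    (h1 : S t ⊆ S' t) (h2 : S' t ⊆ closure (S t)) :
    Gen A F V ℓ N K s L (fun τ => if τ ≤ t then S τ else S' τ) := by
  refine ⟨fun τ hτ x hx => ?_, fun τ τ' hs hττ hL => ?_, fun τ hτ ε hε => ?_, fun τ hτ => ?_⟩
  · have hsnd : Tendsto Prod.snd (𝓝 (x, τ)) (𝓝 τ) := continuous_snd.tendsto _
    rcases lt_trichotomy τ t with hlt | rfl | hgt
    · rw [if_pos hlt.le] at hx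
      have := h.opn ⟨hτ.1, hlt.le⟩ hx
      rw [eventually_nhdsWithin_iff] at this ⊢
      filter_upwards [this, hsnd.eventually_lt_const hlt] with z hz hz2 hz3
      rw [if_pos hz2.le]
      exact hz ⟨hz3, hz2.le⟩
    · rw [if_pos le_rfl] at hx
      have e1 := h.opn ⟨hτ.1, le_rfl⟩ hx
      have e2 := h'.opn τ ⟨le_rfl, hτ.2⟩ x (h1 hx)
      rw [eventually_nhdsWithin_iff] at e1 e2 ⊢
      filter_upwards [e1, e2] with z hz hz2 hz3
      split_ifs with hc
      · exact hz ⟨hz3, hc⟩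
      · exact hz2 (not_le.1 hc).le
    · rw [if_neg (not_le.2 hgt)] at hx
      have := h'.opn τ ⟨hgt.le, hτ.2⟩ x hx
      rw [eventually_nhdsWithin_iff] at this ⊢
      filter_upwards [this, hsnd.eventually_const_lt hgt] with z hz hz2 hz3
      rw [if_neg (not_le.2 hz2)]
      exact hz hz2.le
  · split_ifs with c1 c2 c2
    · exact h.mono hA hV ⟨hs, c1⟩ ⟨hs.trans hττ, c2⟩ hττ
    · exact (h.mono hA hV ⟨hs, c1⟩ ⟨hst, le_rfl⟩ c1).trans
        (h1.trans (h'.mono _ _ le_rfl (not_le.1 c2).le hL))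
    · exact absurd (hττ.trans c2) c1
    · exact h'.mono _ _ (not_le.1 c1).le hττ hL
  · rcases lt_trichotomy τ t with hlt | rfl | hgt
    · rw [if_pos hlt.le]
      have := h.usc ⟨hτ.1, hlt.le⟩ hε
      rw [eventually_nhdsWithin_iff] at this ⊢
      filter_upwards [this, eventually_lt_nhds hlt] with r hr hr2 hr3
      rw [if_pos hr2.le]
      exact (hr ⟨hτ.1.trans (le_of_lt hr3), hr2.le⟩).1
    · rw [if_pos le_rfl]
      filter_upwards [h'.rusc τ ⟨le_rfl, hτ.2⟩ ε hε, self_mem_nhdsWithin] with r hr hr2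
      rw [if_neg (not_le.2 hr2)]
      refine hr.trans ?_
      rw [← Metric.thickening_closure (s := S τ)]
      exact Metric.thickening_mono le_rfl _ |>.trans (Metric.thickening_subset_of_subset ε h2)
    · rw [if_neg (not_le.2 hgt)]
      filter_upwards [h'.rusc τ ⟨hgt.le, hτ.2⟩ ε hε, self_mem_nhdsWithin] with r hr hr2
      rw [if_neg (not_le.2 (hgt.trans hr2))]
      exact hr
  · rcases le_or_gt τ t with hle | hgt
    · refine ⟨s, ⟨le_rfl, hτ.1⟩, ι, inferInstance, α, β,
        (h.restrict (Icc_subset_Icc_right hle)).congr fun r hr => ?_⟩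
      rw [if_pos (hr.2.trans hle)]
    · obtain ⟨s', hs', κ, hκ, α', β', hf⟩ := h'.left τ ⟨hgt, hτ.2⟩
      -- The midpoint keeps the time interval strictly after t: s' may equal t, where the glued
      -- evolution is S t and not S' t.
      refine ⟨(s' + τ) / 2, ⟨by linarith [hs'.1, hs'.2], by linarith [hs'.2]⟩, κ, hκ, α', β',
        (hf.restrict (Icc_subset_Icc_left (by linarith [hs'.2]))).congr fun r hr => ?_⟩
      rw [if_neg (not_le.2 (by linarith [hs'.1, hs'.2, hr.1]))]

lemma gen_trivial (L : ℝ) (S : ℝ → Set ℝ) : Gen A F V ℓ N K L L S :=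
  ⟨fun _ ht => absurd ht.1 (not_le.2 ht.2), fun _ _ h1 h2 h3 => absurd (h1.trans h2) (not_le.2 h3),
    fun _ ht => absurd ht.1 (not_le.2 ht.2), fun _ ht => absurd (ht.1.trans ht.2) (lt_irrefl _)⟩

lemma gen_of_family (hA : CoefBounds A F m M) (hV : VelBounds V C) {s L : ℝ} {ι : Type} [Finite ι]
    {α β : ι → ℝ → ℝ} {S : ℝ → Set ℝ} (hs : s ≤ L)
    (h : IsTrajFamily A F V ℓ N K s L α β S) : Gen A F V ℓ N K s L S := by
  simpa using gen_glue hA hV hs h (gen_trivial L S) subset_rfl subset_closure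

/-- Disjoint evolving intervals stay disjoint up to and including the first time of contact. -/
lemma disjoint_or_contact {s L : ℝ} {ι : Type} [Finite ι] {α β : ι → ℝ → ℝ}
    (ht : ∀ i, IsTraj A F V s L (α i) (β i))
    (hd : ∀ i j, i ≠ j → β i s ≤ α j s ∨ β j s ≤ α i s) :
    (∀ τ ∈ Icc s L, ∀ i j, i ≠ j → β i τ ≤ α j τ ∨ β j τ ≤ α i τ) ∨
    ∃ t ∈ Icc s L, (∀ τ ∈ Icc s t, ∀ i j, i ≠ j → β i τ ≤ α j τ ∨ β j τ ≤ α i τ) ∧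
      ∃ i j, i ≠ j ∧ β i t = α j t := by
  set B : Set ℝ := ⋃ p : ι × ι, {τ | τ ∈ Icc s L ∧ p.1 ≠ p.2 ∧ β p.1 τ = α p.2 τ} with hB
  have hBc : IsClosed B := by
    refine isClosed_iUnion_of_finite fun p => ?_
    by_cases hp : p.1 = p.2
    · convert isClosed_empty; ext; simp [hp]
    · have : {τ | τ ∈ Icc s L ∧ p.1 ≠ p.2 ∧ β p.1 τ = α p.2 τ} =
          {τ | τ ∈ Icc s L ∧ β p.1 τ - α p.2 τ ∈ ({0} : Set ℝ)} := by
        ext τ; simp [hp, sub_eq_zero]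
      rw [this]
      exact ((ht p.1).contR.sub (ht p.2).contL).preimage_isClosed_of_isClosed isClosed_Icc
        isClosed_singleton
  -- By the intermediate value theorem an overlap at time τ is preceded by a contact.
  have key : ∀ τ ∈ Icc s L, ∀ i j, i ≠ j → ¬(β i τ ≤ α j τ ∨ β j τ ≤ α i τ) →
      ∃ τ' ∈ Icc s τ, τ' ∈ B ∧ (β i τ' = α j τ' ∨ β j τ' = α i τ') := by
    intro τ hτ i j hij hn
    push Not at hn
    have hsub : Icc s τ ⊆ Icc s L := Icc_subset_Icc_right hτ.2
    have aux : ∀ i j, i ≠ j → β i s ≤ α j s → α j τ < β i τ →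
        ∃ τ' ∈ Icc s τ, τ' ∈ B ∧ β i τ' = α j τ' := by
      intro i j hij h1 h2
      obtain ⟨τ', hτ', h0⟩ := intermediate_value_Icc hτ.1
        (((ht i).contR.sub (ht j).contL).mono hsub)
        (show (0 : ℝ) ∈ Icc (β i s - α j s) (β i τ - α j τ) from ⟨by linarith, by linarith⟩)
      have h3 : β i τ' = α j τ' := sub_eq_zero.1 h0
      exact ⟨τ', hτ', mem_iUnion.2 ⟨(i, j), hsub hτ', hij, h3⟩, h3⟩
    rcases hd i j hij with h1 | h1
    · obtain ⟨τ', a, b, c⟩ := aux i j hij h1 hn.1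
      exact ⟨τ', a, b, Or.inl c⟩
    · obtain ⟨τ', a, b, c⟩ := aux j i hij.symm h1 hn.2
      exact ⟨τ', a, b, Or.inr c⟩
  rcases B.eq_empty_or_nonempty with hE | hne
  · left
    intro τ hτ i j hij
    by_contra hn
    obtain ⟨τ', _, h, _⟩ := key τ hτ i j hij hn
    rw [hE] at h
    exact h
  · right
    have hbdd : BddBelow B := ⟨s, fun τ hτ => by
      obtain ⟨p, hp⟩ := mem_iUnion.1 hτ
      exact hp.1.1⟩
    have hmem := hBc.csInf_mem hne hbdd
    obtain ⟨⟨i, j⟩, h1, hij, h2⟩ := mem_iUnion.1 hmem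
    refine ⟨sInf B, h1, fun τ hτ i j hij => ?_, i, j, hij, h2⟩
    by_contra hn
    obtain ⟨τ', hτ', hB', h⟩ := key τ ⟨hτ.1, hτ.2.trans h1.2⟩ i j hij hn
    -- A violation up to the first contact time would have its contact at the same time. But
    -- intervals that merely touch satisfy the disjointness condition.
    have h3 := csInf_le hbdd hB'
    have h4 : τ' = τ := le_antisymm hτ'.2 (hτ.2.trans h3)
    subst h4
    exact hn (h.imp le_of_eq le_of_eq)

/-- Finite unions of disjoint intervals can be evolved up to any time. -/
theorem exists_gen (hA : CoefBounds A F m M) (hV : VelBounds V C) (hK : 0 < K)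
    (hgr : ∀ a b, a < b →
      |vL A F V a b| ≤ K * (1 + max |a| |b|) ∧ |vR A F V a b| ≤ K * (1 + max |a| |b|)) {L : ℝ}
    (n : ℕ) : ∀ (f : Finset (ℝ × ℝ)) (s : ℝ), f.card ≤ n → s ≤ L →
      (∀ p ∈ f, p.1 < p.2 ∧ Adm ℓ N K s p.1 p.2) →
      (∀ p ∈ f, ∀ q ∈ f, p ≠ q → p.2 ≤ q.1 ∨ q.2 ≤ p.1) →
      ∃ S : ℝ → Set ℝ, S s = ⋃ p ∈ f, Ioo p.1 p.2 ∧ Gen A F V ℓ N K s L S := by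
  induction n with
  | zero =>
    intro f s hf hs h1 h2
    have hf0 : f = ∅ := Finset.card_eq_zero.1 (Nat.le_zero.1 hf)
    subst hf0
    refine ⟨fun _ => ∅, by simp, gen_of_family (ι := Empty) hA hV hs (α := fun i => i.elim)
      (β := fun i => i.elim) ⟨fun i => i.elim, fun _ _ i => i.elim, fun _ _ i => i.elim,
        fun _ _ => by simp⟩⟩
  | succ n ih =>
    intro f s hf hs h1 h2
    have hex : ∀ p : ℝ × ℝ, ∃ αβ : (ℝ → ℝ) × (ℝ → ℝ), p ∈ f → αβ.1 s = p.1 ∧ αβ.2 s = p.2 ∧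
        IsTraj A F V s L αβ.1 αβ.2 ∧ ∀ t ∈ Icc s L, Adm ℓ N K t (αβ.1 t) (αβ.2 t) := by
      intro p
      by_cases hp : p ∈ f
      · obtain ⟨α, β, e1, e2, e3, e4⟩ := hA.exists_isTraj hV hK hgr hs (h1 p hp).1
        refine ⟨(α, β), fun _ => ⟨e1, e2, e3, fun t ht => ⟨?_, ?_⟩⟩⟩
        · exact (h1 p hp).2.1.trans (e4 t ht).1
        · refine (e4 t ht).2.trans ?_
          calc _ ≤ N * Real.exp (K * s) * Real.exp (K * (t - s)) := by
                gcongr; exact (h1 p hp).2.2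
            _ = _ := by rw [mul_assoc, ← Real.exp_add]; ring_nf
      · exact ⟨(id, id), fun h => absurd h hp⟩
    choose γ hγ using hex
    have htr : ∀ i : f, IsTraj A F V s L (γ i).1 (γ i).2 := fun i => (hγ i i.2).2.2.1
    have hadm : ∀ t ∈ Icc s L, ∀ i : f, Adm ℓ N K t ((γ i).1 t) ((γ i).2 t) := fun t ht i =>
      (hγ i i.2).2.2.2 t ht
    set S : ℝ → Set ℝ := fun t => ⋃ i : f, Ioo ((γ i).1 t) ((γ i).2 t) with hS
    have hSs : S s = ⋃ p ∈ f, Ioo p.1 p.2 := by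
      refine (iUnion_subtype _ _).trans ?_
      refine iUnion₂_congr fun p hp => ?_
      rw [(hγ p hp).1, (hγ p hp).2.1]
    rcases disjoint_or_contact htr (fun i j hij => by
      rw [(hγ i i.2).1, (hγ i i.2).2.1, (hγ j j.2).1, (hγ j j.2).2.1]
      exact h2 i i.2 j j.2 (fun h => hij (Subtype.ext h))) with hd | ⟨t, ht, hd, p, q, hpq, hc⟩
    · exact ⟨S, hSs, gen_of_family hA hV hs ⟨htr, hadm, hd, fun _ _ => rfl⟩⟩
    · have hsub : Icc s t ⊆ Icc s L := Icc_subset_Icc_right ht.2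
      have hfam : IsTrajFamily A F V ℓ N K s t (fun i : f => (γ i).1) (fun i : f => (γ i).2) S :=
        ⟨fun i => (htr i).mono hsub, fun τ hτ => hadm τ (hsub hτ), hd, fun _ _ => rfl⟩
      have htt : t ∈ Icc s t := right_mem_Icc.2 ht.1
      have hlt := fun i => (htr i).lt t ht
      classical
      -- Only one touching pair is merged. If other intervals touch at the same time, the next stage
      -- of the induction has its contact at its initial time.
      set g := insert ((γ p).1 t, (γ q).2 t)
        (((f.erase p).erase q).image fun r => ((γ r).1 t, (γ r).2 t)) with hg
      have hgc : g.card ≤ n := by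
        refine (Finset.card_insert_le _ _).trans ?_
        have e1 := Finset.card_image_le (s := (f.erase p).erase q)
          (f := fun r => ((γ r).1 t, (γ r).2 t))
        have e2 : (q : ℝ × ℝ) ∈ f.erase p :=
          Finset.mem_erase.2 ⟨fun h => hpq (Subtype.ext h.symm), q.2⟩
        rw [Finset.card_erase_of_mem e2, Finset.card_erase_of_mem p.2] at e1
        have e3 : 0 < (f.erase p).card := Finset.card_pos.2 ⟨_, e2⟩
        rw [Finset.card_erase_of_mem p.2] at e3
        omega
      have hmemg : ∀ r ∈ g, r = ((γ p).1 t, (γ q).2 t) ∨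
          ∃ i : f, i ≠ p ∧ i ≠ q ∧ r = ((γ i).1 t, (γ i).2 t) := by
        intro r hr
        rcases Finset.mem_insert.1 hr with h | h
        · exact Or.inl h
        · obtain ⟨i, hi, rfl⟩ := Finset.mem_image.1 h
          rw [Finset.mem_erase, Finset.mem_erase] at hi
          exact Or.inr ⟨⟨i, hi.2.2⟩, fun h => hi.2.1 (congrArg Subtype.val h),
            fun h => hi.1 (congrArg Subtype.val h), rfl⟩
      have hpq' : (γ p).1 t < (γ q).2 t := by
        have := hlt p; have := hlt q; linarith
      have hsep : ∀ i : f, i ≠ p → i ≠ q → (γ i).2 t ≤ (γ p).1 t ∨ (γ q).2 t ≤ (γ i).1 t := by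
        intro i h1 h2
        have := hlt i; have := hlt p; have := hlt q
        rcases hd t htt i p h1 with h3 | h3
        · exact Or.inl h3
        rcases hd t htt i q h2 with h4 | h4
        · exfalso; linarith
        · exact Or.inr h4
      obtain ⟨S', hS's, hS'⟩ := ih g t hgc ht.2 (fun r hr => by
          rcases hmemg r hr with rfl | ⟨i, -, -, rfl⟩
          · refine ⟨hpq', ?_, ?_⟩
            · have := (hadm t ht q).1
              have := hlt p
              simp only; linarith
            · have e1 := (hadm t ht p).2
              have e2 := (hadm t ht q).2
              have e3 := le_max_left |(γ p).1 t| |(γ p).2 t|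
              have e4 := le_max_right |(γ q).1 t| |(γ q).2 t|
              have : max |(γ p).1 t| |(γ q).2 t| ≤ N * Real.exp (K * t) - 1 :=
                max_le (by linarith) (by linarith)
              simp only; linarith
          · exact ⟨hlt i, hadm t ht i⟩) (fun r hr r' hr' hne => by
          rcases hmemg r hr with rfl | ⟨i, hi1, hi2, rfl⟩ <;>
          rcases hmemg r' hr' with rfl | ⟨j, hj1, hj2, rfl⟩
          · exact absurd rfl hne
          · exact (hsep j hj1 hj2).symm
          · exact hsep i hi1 hi2
          · exact hd t htt i j (by rintro rfl; exact hne rfl))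
      refine ⟨fun τ => if τ ≤ t then S τ else S' τ, ?_, gen_glue hA hV ht.1 hfam hS' ?_ ?_⟩
      · simp only; rw [if_pos ht.1]; exact hSs
      · rw [hS's]
        refine iUnion_subset fun i => ?_
        by_cases hip : i = p
        · refine subset_iUnion₂_of_subset ((γ p).1 t, (γ q).2 t) (Finset.mem_insert_self _ _) ?_
          subst hip
          exact Ioo_subset_Ioo le_rfl (by have := hlt q; linarith)
        by_cases hiq : i = q
        · refine subset_iUnion₂_of_subset ((γ p).1 t, (γ q).2 t) (Finset.mem_insert_self _ _) ?_
          subst hiq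
          exact Ioo_subset_Ioo (by have := hlt p; linarith) le_rfl
        · refine subset_iUnion₂_of_subset ((γ i).1 t, (γ i).2 t) (Finset.mem_insert_of_mem
            (Finset.mem_image.2 ⟨i, ?_, rfl⟩)) subset_rfl
          rw [Finset.mem_erase, Finset.mem_erase]
          exact ⟨fun h => hiq (Subtype.ext h), fun h => hip (Subtype.ext h), i.2⟩
      · rw [hS's]
        refine iUnion₂_subset fun r hr => ?_
        have hsubS : ∀ i : f, Icc ((γ i).1 t) ((γ i).2 t) ⊆ closure (S t) := fun i => by
          rw [← closure_Ioo (hlt i).ne]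
          exact closure_mono (subset_iUnion (fun i : f => Ioo ((γ i).1 t) ((γ i).2 t)) i)
        rcases hmemg r hr with rfl | ⟨i, -, -, rfl⟩
        · intro y hy
          rcases le_total y ((γ p).2 t) with hy2 | hy2
          · exact hsubS p ⟨hy.1.le, hy2⟩
          · exact hsubS q ⟨by rw [← hc]; exact hy2, hy.2.le⟩
        · exact Ioo_subset_Icc_self.trans (hsubS i)

end HeleShaw

/-! ### Speed of propagation of generated evolutions -/

namespace HeleShaw

variable {A F : ℝ → ℝ} {V : ℝ → ℝ → ℝ} {m M C ℓ N K : ℝ}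

/-- Continuous induction downwards in time. It suits `Gen`, which describes the evolution by
intervals only to the left of each time; the limit step is handled by semicontinuity from the right.
-/
lemma backward_induction {P : ℝ → Prop} {a b : ℝ} (hab : a ≤ b) (hb : P b)
    (hstep : ∀ t ∈ Ioc a b, P t → ∃ t' < t, ∀ r ∈ Icc t' t, a ≤ r → P r)
    (hlim : ∀ t ∈ Ico a b, (∀ r ∈ Ioc t b, P r) → P t) : P a := by
  set T : Set ℝ := {t | t ∈ Icc a b ∧ ∀ r ∈ Icc t b, P r} with hT
  have hbT : b ∈ T := ⟨⟨hab, le_rfl⟩, fun r hr => by rwa [le_antisymm hr.2 hr.1]⟩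
  have hbdd : BddBelow T := ⟨a, fun t ht => ht.1.1⟩
  have h0a : a ≤ sInf T := le_csInf ⟨b, hbT⟩ fun t ht => ht.1.1
  have h0b : sInf T ≤ b := csInf_le hbdd hbT
  have h1 : ∀ r ∈ Ioc (sInf T) b, P r := fun r hr => by
    obtain ⟨t, ht, htr⟩ := exists_lt_of_csInf_lt ⟨b, hbT⟩ hr.1
    exact ht.2 r ⟨htr.le, hr.2⟩
  have h2 : P (sInf T) := by
    rcases eq_or_lt_of_le h0b with h | h
    · rwa [h]
    · exact hlim _ ⟨h0a, h⟩ h1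
  rcases eq_or_lt_of_le h0a with h | h
  · rwa [h]
  exfalso
  obtain ⟨t', ht', H⟩ := hstep _ ⟨h, h0b⟩ h2
  have h3 : max a t' ∈ T := by
    refine ⟨⟨le_max_left _ _, (max_lt h ht').le.trans h0b⟩, fun r hr => ?_⟩
    rcases le_or_gt r (sInf T) with hr2 | hr2
    · exact H r ⟨(le_max_right _ _).trans hr.1, hr2⟩ ((le_max_left _ _).trans hr.1)
    · exact h1 r ⟨hr2, hr.2⟩
  exact absurd (csInf_le hbdd h3) (not_le.2 (max_lt h ht'))

lemma exists_between_dist {x y d₁ d₂ : ℝ} (h₁ : 0 ≤ d₁) (h₂ : 0 < d₂) (h : |y - x| < d₁ + d₂) :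
    ∃ x', |x' - x| ≤ d₁ ∧ |y - x'| < d₂ := by
  rw [abs_lt] at h
  rcases le_total y (x - d₁) with h3 | h3
  · exact ⟨x - d₁, by rw [abs_le]; constructor <;> linarith, by rw [abs_lt]; constructor <;> linarith⟩
  rcases le_total (x + d₁) y with h4 | h4
  · exact ⟨x + d₁, by rw [abs_le]; constructor <;> linarith, by rw [abs_lt]; constructor <;> linarith⟩
  · exact ⟨y, by rw [abs_le]; constructor <;> linarith, by simpa using h₂⟩

/-- A compact subset of a time slice of an open evolution stays inside for nearby times. -/
lemma tube {X : ℝ → Set ℝ} {I : Set ℝ} {t : ℝ} {Q : Set ℝ} (hQ : IsCompact Q)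
    (h : ∀ x ∈ Q, ∀ᶠ z in 𝓝[{z : ℝ × ℝ | z.2 ∈ I}] (x, t), z.1 ∈ X z.2) :
    ∀ᶠ τ in 𝓝[I] t, Q ⊆ X τ := by
  rw [eventually_nhdsWithin_iff]
  have : ∀ᶠ τ in 𝓝 t, ∀ x ∈ Q, τ ∈ I → x ∈ X τ := by
    refine hQ.eventually_forall_of_forall_eventually fun x hx => ?_
    have h1 := h x hx
    rw [eventually_nhdsWithin_iff] at h1
    exact (continuous_swap.tendsto (t, x)).eventually h1
  filter_upwards [this] with τ hτ hI x hx using hτ x hx hI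

lemma Adm.bound {τ L a b : ℝ} (hK : 0 < K) (h : Adm ℓ N K τ a b) (hτ : τ ≤ L) :
    |a| ≤ N * Real.exp (K * L) ∧ |b| ≤ N * Real.exp (K * L) := by
  have h1 := h.2
  have e1 := le_max_left |a| |b|
  have e2 := le_max_right |a| |b|
  have e3 := abs_nonneg a
  have hN : 0 ≤ N := by
    by_contra hN
    have := mul_neg_of_neg_of_pos (not_le.1 hN) (Real.exp_pos (K * τ))
    linarith
  have : N * Real.exp (K * τ) ≤ N * Real.exp (K * L) := by gcongr
  constructor <;> linarith

/-- Two-sided bounds for the speeds of the intervals with endpoints in `[-R, R]` and length at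
least `ℓ`. -/
def SpeedBounds (A F : ℝ → ℝ) (V : ℝ → ℝ → ℝ) (ℓ R c c' : ℝ) : Prop :=
  ∀ a b, a < b → ℓ ≤ b - a → |a| ≤ R → |b| ≤ R →
    (c ≤ vL A F V a b ∧ c ≤ vR A F V a b) ∧ (vL A F V a b ≤ c' ∧ vR A F V a b ≤ c')

namespace Gen

variable {s L : ℝ} {S : ℝ → Set ℝ}

lemma isOpen (h : Gen A F V ℓ N K s L S) {t : ℝ} (ht : t ∈ Ico s L) : IsOpen (S t) := by
  rw [isOpen_iff_mem_nhds]
  intro x hx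
  have h1 := h.opn t ht x hx
  have h2 : Tendsto (fun y => (y, t)) (𝓝 x) (𝓝[{z : ℝ × ℝ | s ≤ z.2}] (x, t)) :=
    tendsto_nhdsWithin_iff.2 ⟨(Continuous.prodMk_left t).tendsto x, .of_forall fun _ => ht.1⟩
  exact h2.eventually h1

lemma subset_Icc (h : Gen A F V ℓ N K s L S) (hK : 0 < K) {t : ℝ} (ht : t ∈ Ico s L) :
    S t ⊆ Icc (-(N * Real.exp (K * L))) (N * Real.exp (K * L)) := by
  have ht' : (t + L) / 2 ∈ Ioo s L := ⟨by linarith [ht.1, ht.2], by linarith [ht.2]⟩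
  refine (h.mono t ((t + L) / 2) ht.1 (by linarith [ht.2]) ht'.2).trans ?_
  obtain ⟨s', hs', ι, _, α, β, hf⟩ := h.left _ ht'
  rw [hf.eq _ (right_mem_Icc.2 hs'.2.le)]
  refine iUnion_subset fun i x hx => ?_
  have := (hf.adm _ (right_mem_Icc.2 hs'.2.le) i).bound hK ht'.2.le
  rw [abs_le, abs_le] at this
  exact ⟨this.1.1.trans hx.1.le, hx.2.le.trans this.2.2⟩

lemma bounded (h : Gen A F V ℓ N K s L S) (hK : 0 < K) {t : ℝ} (ht : t ∈ Ico s L) :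
    Bornology.IsBounded (S t) := (Metric.isBounded_Icc _ _).subset (h.subset_Icc hK ht)

lemma family_speed {ι : Type} {α β : ι → ℝ → ℝ} {s' t c c' : ℝ} (hK : 0 < K)
    (hc : SpeedBounds A F V ℓ (N * Real.exp (K * L)) c c')
    (hf : IsTrajFamily A F V ℓ N K s' t α β S) (ht : t ≤ L) (i : ι) {τ : ℝ} (hτ : τ ∈ Icc s' t) :
    (c ≤ vL A F V (α i τ) (β i τ) ∧ c ≤ vR A F V (α i τ) (β i τ)) ∧
      (vL A F V (α i τ) (β i τ) ≤ c' ∧ vR A F V (α i τ) (β i τ) ≤ c') := by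
  have h1 := hf.adm τ hτ i
  have h2 := h1.bound hK (hτ.2.trans ht)
  exact hc _ _ ((hf.traj i).lt τ hτ) h1.1 h2.1 h2.2

/-- Every interval advances on both sides at least at speed c. A displacement reachable from time r
is split into a part made before time τ and a part made afterwards. -/
lemma ball_subset (h : Gen A F V ℓ N K s L S) (hK : 0 < K) {c c' : ℝ} (hc0 : 0 < c)
    (hc : SpeedBounds A F V ℓ (N * Real.exp (K * L)) c c') {t t' : ℝ} (hs : s ≤ t) (htt : t ≤ t')
    (hL : t' < L) : ∀ x ∈ S t, ∀ y, |y - x| < c * (t' - t) → y ∈ S t' := by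
  refine backward_induction (P := fun τ => ∀ x ∈ S τ, ∀ y, |y - x| < c * (t' - τ) → y ∈ S t') htt
    ?_ ?_ ?_
  · intro x _ y hy
    rw [sub_self, mul_zero] at hy
    exact absurd hy (not_lt.2 (abs_nonneg _))
  · intro τ hτ hP
    obtain ⟨s', hs', ι, _, α, β, hf⟩ := h.left τ ⟨hs.trans_lt hτ.1, hτ.2.trans_lt hL⟩
    refine ⟨s', hs'.2, fun r hr _ x hx y hy => ?_⟩
    have hrr : τ ∈ Icc s' τ := right_mem_Icc.2 hs'.2.le
    have hball : ∀ x', |x' - x| < c * (τ - r) ∨ |x' - x| ≤ c * (τ - r) → x' ∈ S τ := by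
      intro x' hx'
      replace hx' : |x' - x| ≤ c * (τ - r) := hx'.elim le_of_lt id
      rw [hf.eq r hr, mem_iUnion] at hx
      obtain ⟨i, hi⟩ := hx
      obtain ⟨e1, e2⟩ := (hf.traj i).lower
        (fun u hu => (family_speed hK hc hf (hτ.2.trans hL.le) i hu).1) hr hrr hr.2
      rw [abs_le] at hx'
      rw [hf.eq τ hrr]
      exact mem_iUnion.2 ⟨i, by linarith [hi.1], by linarith [hi.2]⟩
    rcases eq_or_lt_of_le hτ.2 with rfl | hlt
    · exact hball y (Or.inl hy)
    · obtain ⟨x', h1, h2⟩ := exists_between_dist (x := x) (y := y) (d₁ := c * (τ - r))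
        (d₂ := c * (t' - τ)) (mul_nonneg hc0.le (sub_nonneg.2 hr.2))
        (mul_pos hc0 (sub_pos.2 hlt)) (by linarith)
      exact hP x' (hball x' (Or.inr h1)) y h2
  · intro τ hτ hP x hx y hy
    have h1 : ∀ᶠ r in 𝓝[>] τ, |y - x| < c * (t' - r) := by
      refine nhdsWithin_le_nhds ?_
      have : Tendsto (fun r => c * (t' - r)) (𝓝 τ) (𝓝 (c * (t' - τ))) :=
        Continuous.tendsto (by fun_prop) τ
      exact this.eventually_const_lt hy
    obtain ⟨r, hr1, hr2⟩ := (h1.and (Ioo_mem_nhdsGT hτ.2)).exists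
    exact hP r ⟨hr2.1, hr2.2.le⟩ x
      (h.mono τ r (hs.trans hτ.1) hr2.1.le (hr2.2.trans hL) hx) y hr1

/-- The counterpart for the maximal speed c'. The extra ε pays for the jumps to nearby points in the
limit step, where only right upper semicontinuity is known. -/
lemma near (h : Gen A F V ℓ N K s L S) (hK : 0 < K) {c c' : ℝ} (hc0 : 0 ≤ c')
    (hc : SpeedBounds A F V ℓ (N * Real.exp (K * L)) c c') {t t' : ℝ} (hs : s ≤ t) (htt : t ≤ t')
    (hL : t' < L) : ∀ x ∈ S t', ∀ ε > 0, ∃ y ∈ S t, |x - y| < c' * (t' - t) + ε := by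
  intro x hx
  refine backward_induction (P := fun τ => ∀ ε > 0, ∃ y ∈ S τ, |x - y| < c' * (t' - τ) + ε) htt
    ?_ ?_ ?_
  · intro ε hε
    exact ⟨x, hx, by simpa using hε⟩
  · intro τ hτ hP
    obtain ⟨s', hs', ι, _, α, β, hf⟩ := h.left τ ⟨hs.trans_lt hτ.1, hτ.2.trans_lt hL⟩
    refine ⟨s', hs'.2, fun r hr _ ε hε => ?_⟩
    obtain ⟨y, hy, hxy⟩ := hP (ε / 2) (half_pos hε)
    have hrr : τ ∈ Icc s' τ := right_mem_Icc.2 hs'.2.le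
    rw [hf.eq τ hrr, mem_iUnion] at hy
    obtain ⟨i, hi⟩ := hy
    obtain ⟨e1, e2⟩ := (hf.traj i).upper
      (fun u hu => (family_speed hK hc hf (hτ.2.trans hL.le) i hu).2) hr hrr hr.2
    obtain ⟨e3, e4⟩ := (hf.traj i).lower (c := min c 0)
      (fun u hu => ⟨(min_le_left _ _).trans (family_speed hK hc hf (hτ.2.trans hL.le) i hu).1.1,
        (min_le_left _ _).trans (family_speed hK hc hf (hτ.2.trans hL.le) i hu).1.2⟩) hr hrr hr.2
    have hlt := (hf.traj i).lt r hr
    have hε2 := half_pos hε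
    have hd : 0 ≤ c' * (τ - r) := mul_nonneg hc0 (sub_nonneg.2 hr.2)
    obtain ⟨y', hy', hyy⟩ : ∃ y' ∈ Ioo (α i r) (β i r), |y - y'| < c' * (τ - r) + ε / 2 := by
      have h1 : y ∈ Metric.thickening (c' * (τ - r) + ε / 2) (Ioo (α i r) (β i r)) := by
        rw [← Metric.thickening_closure, closure_Ioo hlt.ne, Metric.mem_thickening_iff]
        rcases le_total y (α i r) with h1 | h1
        · exact ⟨_, left_mem_Icc.2 hlt.le, by
            rw [Real.dist_eq, abs_lt]; constructor <;> linarith [hi.1]⟩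
        rcases le_total (β i r) y with h2 | h2
        · exact ⟨_, right_mem_Icc.2 hlt.le, by
            rw [Real.dist_eq, abs_lt]; constructor <;> linarith [hi.2]⟩
        · exact ⟨y, ⟨h1, h2⟩, by rw [dist_self]; positivity⟩
      exact Metric.mem_thickening_iff.1 h1
    refine ⟨y', by rw [hf.eq r hr]; exact mem_iUnion.2 ⟨i, hy'⟩, ?_⟩
    have := abs_sub_le x y y'
    linarith
  · intro τ hτ hP ε hε
    obtain ⟨r, hr1, hr2⟩ := ((h.rusc τ ⟨hs.trans hτ.1, hτ.2.trans hL⟩ (ε / 2) (half_pos hε)).and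
      (Ioo_mem_nhdsGT hτ.2)).exists
    obtain ⟨y, hy, hxy⟩ := hP r ⟨hr2.1, hr2.2.le⟩ (ε / 2) (half_pos hε)
    obtain ⟨y', hy', hyy⟩ := Metric.mem_thickening_iff.1 (hr1 hy)
    rw [Real.dist_eq] at hyy
    refine ⟨y', hy', ?_⟩
    have := abs_sub_le x y y'
    have : c' * (t' - r) ≤ c' * (t' - τ) := by gcongr; exact hr2.1.le
    linarith

/-- No component is created: each point is joined to a point of each earlier slice. -/
lemma joined (hA : CoefBounds A F m M) (hV : VelBounds V C) (h : Gen A F V ℓ N K s L S)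
    (hK : 0 < K) {c c' : ℝ} (hc0 : 0 < c)
    (hc : SpeedBounds A F V ℓ (N * Real.exp (K * L)) c c') {t t' : ℝ} (hs : s ≤ t) (htt : t ≤ t')
    (hL : t' < L) : ∀ x ∈ S t', ∃ y ∈ S t, uIcc x y ⊆ S t' := by
  intro x hx
  refine backward_induction (P := fun τ => ∃ y ∈ S τ, uIcc x y ⊆ S t') htt ?_ ?_ ?_
  · exact ⟨x, hx, by simpa using hx⟩
  · intro τ hτ ⟨y, hy, hxy⟩
    obtain ⟨s', hs', ι, _, α, β, hf⟩ := h.left τ ⟨hs.trans_lt hτ.1, hτ.2.trans_lt hL⟩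
    refine ⟨s', hs'.2, fun r hr _ => ?_⟩
    have hrr : τ ∈ Icc s' τ := right_mem_Icc.2 hs'.2.le
    have hy2 := hy
    rw [hf.eq τ hrr, mem_iUnion] at hy2
    obtain ⟨i, hi⟩ := hy2
    obtain ⟨y', hy'⟩ := nonempty_Ioo.2 ((hf.traj i).lt r hr)
    have hmon := (hf.traj i).monotone hA hV hr hrr hr.2
    refine ⟨y', by rw [hf.eq r hr]; exact mem_iUnion.2 ⟨i, hy'⟩, ?_⟩
    refine (uIcc_subset_uIcc_union_uIcc (b := y)).trans (union_subset hxy ?_)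
    refine Subset.trans ?_ (((hf.isComp hrr i).sub).trans
      (h.mono τ t' (hs.trans hτ.1.le) hτ.2 hL))
    exact ordConnected_Ioo.uIcc_subset hi ⟨hmon.1.trans_lt hy'.1, hy'.2.trans_le hmon.2⟩
  · intro τ hτ hP
    -- Choosing r below the midpoint leaves at least the time t' - r₁ for y to spread. The ball that
    -- it fills by t' covers the segment from y to a point of S τ.
    set r₁ := (τ + t') / 2 with hr₁
    have hr1 : τ < r₁ := by linarith [hτ.2]
    have hr2 : r₁ < t' := by linarith [hτ.2]
    obtain ⟨r, hra, hrb⟩ := ((h.rusc τ ⟨hs.trans hτ.1, hτ.2.trans hL⟩ (c * (t' - r₁))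
      (mul_pos hc0 (sub_pos.2 hr2))).and (Ioo_mem_nhdsGT hr1)).exists
    obtain ⟨y, hy, hxy⟩ := hP r ⟨hrb.1, (hrb.2.trans hr2).le⟩
    obtain ⟨y', hy', hyy⟩ := Metric.mem_thickening_iff.1 (hra hy)
    rw [Real.dist_eq] at hyy
    refine ⟨y', hy', (uIcc_subset_uIcc_union_uIcc (b := y)).trans (union_subset hxy ?_)⟩
    intro u hu
    refine h.ball_subset hK hc0 hc (hs.trans (hτ.1.trans hrb.1.le)) (hrb.2.trans hr2).le hL y hy u ?_
    have h1 : |u - y| ≤ |y - y'| := by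
      rw [abs_sub_comm y]; exact abs_sub_left_of_mem_uIcc hu
    have h2 : c * (t' - r₁) ≤ c * (t' - r) := by gcongr; exact hrb.2.le
    linarith

end Gen

end HeleShaw

/-! ### Viscosity inequalities at moving endpoints -/

namespace HeleShaw

variable {A F : ℝ → ℝ} {V : ℝ → ℝ → ℝ} {m M C ℓ N K : ℝ}

/-- The superflow property for test functions that are linear in space and time. -/
def LinSuper (A F : ℝ → ℝ) (V : ℝ → ℝ → ℝ) (s T : ℝ) (X : ℝ → Set ℝ) : Prop :=
  ∀ t ∈ Ioo s T, ∀ x ∈ closure (X t), x ∉ X t → ∀ σ q v : ℝ, (σ = 1 ∨ σ = -1) → 0 < q →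
    (∀ᶠ z in 𝓝[{z : ℝ × ℝ | z.2 ≤ t}] (x, t),
      q * (σ * (x - z.1) - v * (t - z.2)) ≤ dsol A F (X z.2) z.1) → V x (-σ * q) ≤ v

/-- The subflow property for test functions that are linear in space and time. -/
def LinSub (A F : ℝ → ℝ) (V : ℝ → ℝ → ℝ) (s T : ℝ) (X : ℝ → Set ℝ) : Prop :=
  ∀ t ∈ Ioo s T, ∀ x ∈ closure (X t), x ∉ X t → ∀ σ q v : ℝ, (σ = 1 ∨ σ = -1) → 0 < q →
    (∀ᶠ z in 𝓝[{z : ℝ × ℝ | z.2 ≤ t ∧ z.1 ∈ closure (X z.2)}] (x, t),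
      dsol A F (X z.2) z.1 ≤ q * (σ * (x - z.1) - v * (t - z.2))) → v ≤ V x (-σ * q)

lemma abs_sign {σ : ℝ} (hσ : σ = 1 ∨ σ = -1) : |σ| = 1 := by
  rcases hσ with rfl | rfl <;> simp

lemma mul_sign_sq {σ : ℝ} (hσ : σ = 1 ∨ σ = -1) : σ * σ = 1 := by
  rcases hσ with rfl | rfl <;> simp

/-- Profiles near an endpoint, compared to linear functions. -/
lemma CoefBounds.prof_side_near (h : CoefBounds A F m M) {σ e₀ k₀ : ℝ} (hσ : σ = 1 ∨ σ = -1) :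
    (∀ q < σ * ((primF F e₀ - k₀) / A e₀), ∃ δ > 0, ∀ e k y, |e - e₀| < δ → |k - k₀| < δ →
      |y - e₀| < δ → 0 ≤ σ * (e - y) → q * (σ * (e - y)) ≤ prof A F k e y) ∧
    (∀ q > σ * ((primF F e₀ - k₀) / A e₀), ∃ δ > 0, ∀ e k y, |e - e₀| < δ → |k - k₀| < δ →
      |y - e₀| < δ → 0 ≤ σ * (e - y) → prof A F k e y ≤ q * (σ * (e - y))) := by
  have habs : ∀ {u : ℝ}, 0 ≤ σ * u → |u| = σ * u := fun {u} hu => by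
    rw [← abs_of_nonneg hu, abs_mul, abs_sign hσ, one_mul]
  have hid : ∀ u g : ℝ, u * g = (σ * g) * (σ * u) := fun u g => by
    have := mul_sign_sq hσ
    calc u * g = (σ * σ) * (u * g) := by rw [this, one_mul]
      _ = _ := by ring
  refine ⟨fun q hq => ?_, fun q hq => ?_⟩
  all_goals
    obtain ⟨δ, hδ, H⟩ := h.prof_near e₀ k₀ (sub_pos.2 hq)
    refine ⟨δ, hδ, fun e k y he hk hy hs => ?_⟩
    have h1 := H e k y he hk hy
    rw [habs hs, hid (e - y), abs_le] at h1
    nlinarith [h1.1, h1.2]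

lemma endpoint_lower {e : ℝ → ℝ} {σ w v t : ℝ} {I : Set ℝ} (hσ : σ = 1 ∨ σ = -1)
    (he : HasDerivWithinAt e (σ * w) I t) :
    (w < v → ∀ᶠ τ in 𝓝[I] t, τ ≤ t → -(v * (t - τ)) ≤ σ * (e τ - e t)) ∧
    (v < w → ∀ᶠ τ in 𝓝[I] t, τ ≤ t → σ * (e τ - e t) ≤ -(v * (t - τ))) := by
  refine ⟨fun hv => ?_, fun hv => ?_⟩
  all_goals
    filter_upwards [(hasDerivWithinAt_iff_isLittleO.1 he).def (sub_pos.2 hv)] with τ h1 hτ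
    rw [Real.norm_eq_abs, Real.norm_eq_abs, abs_of_nonpos (sub_nonpos.2 hτ), smul_eq_mul,
      abs_le] at h1
    rcases hσ with rfl | rfl <;> nlinarith [h1.1, h1.2]

section Contact

variable {s T t x σ w : ℝ} {X : ℝ → Set ℝ} {e kk : ℝ → ℝ}

lemma eventually_snd {I : Set ℝ} {t x : ℝ} {P : ℝ → Prop} {Z : Set (ℝ × ℝ)}
    (hZ : MapsTo Prod.snd Z I) (h : ∀ᶠ τ in 𝓝[I] t, P τ) : ∀ᶠ z in 𝓝[Z] (x, t), P z.2 :=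
  (continuous_snd.continuousWithinAt (s := Z) (x := (x, t))).tendsto_nhdsWithin hZ |>.eventually h

/-- If a moving profile touches the pressure of a superflow from below at a boundary point, the
endpoint of the profile moves at least with the velocity given by the slope of the profile. A linear
test function with slightly smaller slope q and slightly larger speed v fits below the profile; then
v and q tend to their limits by continuity of V. -/
lemma contact_super (hA : CoefBounds A F m M) (hV : VelBounds V C) (hX : LinSuper A F V s T X)
    (ht : t ∈ Ioo s T) (hx : x ∈ closure (X t)) (hx' : x ∉ X t) (hσ : σ = 1 ∨ σ = -1)
    (he : HasDerivWithinAt e (σ * w) (Iic t) t) (hex : e t = x)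
    (hk : ContinuousWithinAt kk (Iic t) t) (hs : 0 < σ * ((primF F x - kk t) / A x))
    (hnn : ∀ᶠ z in 𝓝[{z : ℝ × ℝ | z.2 ≤ t}] (x, t), 0 ≤ dsol A F (X z.2) z.1)
    (H : ∀ᶠ z in 𝓝[{z : ℝ × ℝ | z.2 ≤ t}] (x, t), 0 ≤ σ * (e z.2 - z.1) →
      prof A F (kk z.2) (e z.2) z.1 ≤ dsol A F (X z.2) z.1) :
    spd A F V x (kk t) ≤ w := by
  set hh := σ * ((primF F x - kk t) / A x) with hhh
  have hm : MapsTo Prod.snd {z : ℝ × ℝ | z.2 ≤ t} (Iic t) := fun z hz => hz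
  have key : ∀ q ∈ Ioo 0 hh, ∀ v > w, V x (-σ * q) ≤ v := by
    intro q hq v hv
    refine hX t ht x hx hx' σ q v hσ hq.1 ?_
    obtain ⟨δ, hδ, Hδ⟩ := (hA.prof_side_near hσ).1 q hq.2
    have e1 := eventually_snd (x := x) hm (Metric.tendsto_nhds.1 he.continuousWithinAt δ hδ)
    have e2 := eventually_snd (x := x) hm (Metric.tendsto_nhds.1 hk δ hδ)
    have e3 : ∀ᶠ z in 𝓝[{z : ℝ × ℝ | z.2 ≤ t}] (x, t), dist z.1 x < δ :=
      Metric.tendsto_nhds.1 (continuous_fst.continuousWithinAt (x := (x, t))) δ hδ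
    have e4 := eventually_snd (x := x) hm ((endpoint_lower hσ he).1 hv)
    filter_upwards [H, hnn, e1, e2, e3, e4, self_mem_nhdsWithin] with z H h0 h1 h2 h3 h4 h5
    have h6 := h4 h5
    rw [hex] at h1 h6
    have h7 : σ * (x - z.1) - v * (t - z.2) ≤ σ * (e z.2 - z.1) := by nlinarith
    -- Inside the moving interval the profile is the barrier; outside of it the test function is
    -- nonpositive while the pressure is nonnegative.
    rcases le_or_gt 0 (σ * (e z.2 - z.1)) with h8 | h8
    · exact (mul_le_mul_of_nonneg_left h7 hq.1.le).trans ((Hδ _ _ _ h1 h2 h3 h8).trans (H h8))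
    · exact (mul_nonpos_of_nonneg_of_nonpos hq.1.le (h7.trans h8.le)).trans h0
  have key2 : ∀ q ∈ Ioo 0 hh, V x (-σ * q) ≤ w := fun q hq =>
    le_of_forall_gt_imp_ge_of_dense fun v hv => key q hq v hv
  have h1 : (kk t - primF F x) / A x = -σ * hh := by
    rw [hhh, ← mul_assoc, neg_mul, mul_sign_sq hσ]; ring
  have h2 : Tendsto (fun q => V x (-σ * q)) (𝓝[<] hh) (𝓝 (V x (-σ * hh))) :=
    (((hV.cont_right x).comp (continuous_const.mul continuous_id)).tendsto hh).mono_left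
      nhdsWithin_le_nhds
  rw [spd, h1]
  refine le_of_tendsto h2 ?_
  filter_upwards [Ioo_mem_nhdsLT hs] with q hq using key2 q hq

/-- The mirror image with slopes q above and speeds v below the limits. The test is restricted to
the closures of the slices, which have to lie on the inner side of the moving endpoint. -/
lemma contact_sub (hA : CoefBounds A F m M) (hV : VelBounds V C) (hX : LinSub A F V s T X)
    (ht : t ∈ Ioo s T) (hx : x ∈ closure (X t)) (hx' : x ∉ X t) (hσ : σ = 1 ∨ σ = -1)
    (he : HasDerivWithinAt e (σ * w) (Iic t) t) (hex : e t = x)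
    (hk : ContinuousWithinAt kk (Iic t) t) (hs : 0 < σ * ((primF F x - kk t) / A x))
    (H : ∀ᶠ z in 𝓝[{z : ℝ × ℝ | z.2 ≤ t ∧ z.1 ∈ closure (X z.2)}] (x, t),
      0 ≤ σ * (e z.2 - z.1) ∧ dsol A F (X z.2) z.1 ≤ prof A F (kk z.2) (e z.2) z.1) :
    w ≤ spd A F V x (kk t) := by
  set hh := σ * ((primF F x - kk t) / A x) with hhh
  have hm : MapsTo Prod.snd {z : ℝ × ℝ | z.2 ≤ t ∧ z.1 ∈ closure (X z.2)} (Iic t) :=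
    fun z hz => hz.1
  have key : ∀ q > hh, ∀ v < w, v ≤ V x (-σ * q) := by
    intro q hq v hv
    refine hX t ht x hx hx' σ q v hσ (hs.trans hq) ?_
    obtain ⟨δ, hδ, Hδ⟩ := (hA.prof_side_near hσ).2 q hq
    have e1 := eventually_snd (x := x) hm (Metric.tendsto_nhds.1 he.continuousWithinAt δ hδ)
    have e2 := eventually_snd (x := x) hm (Metric.tendsto_nhds.1 hk δ hδ)
    have e3 : ∀ᶠ z in 𝓝[{z : ℝ × ℝ | z.2 ≤ t ∧ z.1 ∈ closure (X z.2)}] (x, t), dist z.1 x < δ :=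
      Metric.tendsto_nhds.1 (continuous_fst.continuousWithinAt (x := (x, t))) δ hδ
    have e4 := eventually_snd (x := x) hm ((endpoint_lower hσ he).2 hv)
    filter_upwards [H, e1, e2, e3, e4, self_mem_nhdsWithin] with z H h1 h2 h3 h4 h5
    have h6 := h4 h5.1
    rw [hex] at h1 h6
    have h7 : σ * (e z.2 - z.1) ≤ σ * (x - z.1) - v * (t - z.2) := by nlinarith
    exact H.2.trans ((Hδ _ _ _ h1 h2 h3 H.1).trans
      (mul_le_mul_of_nonneg_left h7 (hs.trans hq).le))
  have key2 : ∀ q > hh, w ≤ V x (-σ * q) := fun q hq =>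
    le_of_forall_lt_imp_le_of_dense fun v hv => key q hq v hv
  have h1 : (kk t - primF F x) / A x = -σ * hh := by
    rw [hhh, ← mul_assoc, neg_mul, mul_sign_sq hσ]; ring
  have h2 : Tendsto (fun q => V x (-σ * q)) (𝓝[>] hh) (𝓝 (V x (-σ * hh))) :=
    (((hV.cont_right x).comp (continuous_const.mul continuous_id)).tendsto hh).mono_left
      nhdsWithin_le_nhds
  rw [spd, h1]
  refine ge_of_tendsto h2 ?_
  filter_upwards [self_mem_nhdsWithin] with q hq using key2 q hq

end Contact

/-- The right endpoint of `(a, b)` for `σ = 1`, the left endpoint for `σ = -1`. -/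
noncomputable def side (σ a b : ℝ) : ℝ := if σ = 1 then b else a

@[simp] lemma side_one (a b : ℝ) : side 1 a b = b := if_pos rfl

@[simp] lemma side_neg_one (a b : ℝ) : side (-1) a b = a := if_neg (by norm_num)

lemma CoefBounds.prof_side (h : CoefBounds A F m M) {a b σ : ℝ} (hσ : σ = 1 ∨ σ = -1)
    (hab : a < b) (y : ℝ) :
    prof A F (kav A F a b) (side σ a b) y = prof A F (kav A F a b) b y := by
  rcases hσ with rfl | rfl
  · simp
  · rw [side_neg_one, h.prof_left_eq hab]

lemma CoefBounds.slope_side_pos (h : CoefBounds A F m M) {a b σ : ℝ} (hσ : σ = 1 ∨ σ = -1)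
    (hab : a < b) :
    0 < σ * ((primF F (side σ a b) - kav A F a b) / A (side σ a b)) := by
  rcases hσ with rfl | rfl
  · rw [side_one, one_mul]
    exact div_pos (sub_pos.2 (h.kav_lt hab)) (h.A_pos _)
  · rw [side_neg_one, neg_one_mul, ← neg_div, neg_sub]
    exact h.slope_left_pos hab

namespace IsTraj

variable {s t : ℝ} {α β : ℝ → ℝ}

lemma hasDeriv_side (h : IsTraj A F V s t α β) {σ τ : ℝ} (hσ : σ = 1 ∨ σ = -1)
    (hτ : τ ∈ Icc s t) : HasDerivWithinAt (fun r => side σ (α r) (β r))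
      (σ * spd A F V (side σ (α τ) (β τ)) (kav A F (α τ) (β τ))) (Icc s t) τ := by
  rcases hσ with rfl | rfl
  · simpa [vR] using h.right τ hτ
  · simpa [vL] using h.left τ hτ

end IsTraj

lemma nonneg_deriv_of_le_right {g : ℝ → ℝ} {g' a : ℝ} (hg : HasDerivWithinAt g g' (Ici a) a)
    (h : ∀ᶠ r in 𝓝[>] a, g a ≤ g r) : 0 ≤ g' := by
  have h1 := (hasDerivWithinAt_iff_tendsto_slope.1 hg)
  rw [Ici_sdiff_left] at h1
  refine ge_of_tendsto h1 ?_
  filter_upwards [h, self_mem_nhdsWithin] with r hr hr2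
  rw [slope_def_field]
  exact div_nonneg (sub_nonneg.2 hr) (sub_nonneg.2 (le_of_lt hr2))

lemma nonneg_deriv_of_le_left {g : ℝ → ℝ} {g' a : ℝ} (hg : HasDerivWithinAt g g' (Iic a) a)
    (h : ∀ᶠ r in 𝓝[<] a, g r ≤ g a) : 0 ≤ g' := by
  have h1 := (hasDerivWithinAt_iff_tendsto_slope.1 hg)
  rw [Iic_sdiff_right] at h1
  refine ge_of_tendsto h1 ?_
  filter_upwards [h, self_mem_nhdsWithin] with r hr hr2
  rw [slope_def_field]
  exact div_nonneg_of_nonpos (sub_nonpos.2 hr) (sub_nonpos.2 (le_of_lt hr2))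

lemma HasDerivWithinAt.iic_of_Icc {e : ℝ → ℝ} {e' s t : ℝ} (hst : s < t)
    (h : HasDerivWithinAt e e' (Icc s t) t) : HasDerivWithinAt e e' (Iic t) t :=
  h.mono_of_mem_nhdsWithin (Icc_mem_nhdsLE hst)

/-- At an endpoint of a moving interval, a touching function has the right slopes. -/
lemma touching_derivs {φ : ℝ × ℝ → ℝ} {φ' : ℝ × ℝ →L[ℝ] ℝ} {x t σ w : ℝ} {e : ℝ → ℝ}
    (hφ : HasFDerivAt φ φ' (x, t)) (he : HasDerivWithinAt e (σ * w) (Iic t) t) (hex : e t = x) :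
    HasDerivWithinAt (fun τ => φ (e τ, τ)) (φ' (1, 0) * (σ * w) + φ' (0, 1)) (Iic t) t ∧
    HasDerivAt (fun r => φ (x - σ * r, t)) (-σ * φ' (1, 0)) 0 := by
  have hlin : ∀ u v : ℝ, φ' (u, v) = φ' (1, 0) * u + φ' (0, 1) * v := fun u v => by
    have : ((u, v) : ℝ × ℝ) = u • (1, 0) + v • (0, 1) := by simp
    rw [this, map_add, map_smul, map_smul]; simp [mul_comm]
  constructor
  · have h1 : HasDerivWithinAt (fun τ => (e τ, τ)) (σ * w, 1) (Iic t) t :=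
      he.prodMk (hasDerivWithinAt_id t _)
    have := HasFDerivAt.comp_hasDerivWithinAt_of_eq t hφ h1 (by rw [hex])
    rw [hlin, mul_one] at this
    exact this
  · have h1 : HasDerivAt (fun r : ℝ => (x - σ * r, t)) (-σ, 0) 0 := by
      refine HasDerivAt.prodMk ?_ (hasDerivAt_const _ _)
      simpa using ((hasDerivAt_id (0 : ℝ)).const_mul σ).const_sub x
    have := HasFDerivAt.comp_hasDerivAt_of_eq 0 hφ h1 (by simp)
    rw [hlin, mul_zero, add_zero, mul_comm] at this
    exact this

lemma prof_side_deriv (hA : CoefBounds A F m M) (k x σ : ℝ) :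
    HasDerivAt (fun r => prof A F k x (x - σ * r)) (σ * ((primF F x - k) / A x)) 0 := by
  have h1 : HasDerivAt (fun r : ℝ => x - σ * r) (-σ) 0 := by
    simpa using ((hasDerivAt_id (0 : ℝ)).const_mul σ).const_sub x
  have h2 := HasDerivAt.comp_of_eq 0 (hA.hasDerivAt_prof k x x) h1 (by simp)
  exact h2.congr_deriv (by ring)

lemma VelBounds.mono_side (hV : VelBounds V C) {x σ q r : ℝ} (hq : 0 < q) (hqr : q ≤ r) :
    V x (-σ * q) ≤ V x (-σ * r) := by
  have := hV.mono x (-σ * q) (r / q) ((one_le_div hq).2 hqr)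
  refine this.trans (le_of_eq ?_)
  congr 1
  field_simp

namespace Gen

variable {s L : ℝ} {S : ℝ → Set ℝ}

/-- The two families of points at which a test function is evaluated at an endpoint: the endpoint
itself at earlier times, where the pressure is zero, and points inside at time t, where the pressure
is the profile. -/
lemma touch_left (hA : CoefBounds A F m M) (h : Gen A F V ℓ N K s L S) (hK : 0 < K) {t : ℝ}
    (ht : t ∈ Ioo s L) {s' : ℝ} {ι : Type} {α β : ι → ℝ → ℝ} (hs' : s' < t)
    (hf : IsTrajFamily A F V ℓ N K s' t α β S) (i : ι) {σ : ℝ} (hσ : σ = 1 ∨ σ = -1) :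
    (∀ᶠ τ in 𝓝[<] t, side σ (α i τ) (β i τ) ∉ S τ ∧
      side σ (α i τ) (β i τ) ∈ closure (S τ)) ∧
    (∀ᶠ r in 𝓝[>] (0 : ℝ), side σ (α i t) (β i t) - σ * r ∈ S t ∧
      dsol A F (S t) (side σ (α i t) (β i t) - σ * r) =
      prof A F (kav A F (α i t) (β i t)) (side σ (α i t) (β i t)) (side σ (α i t) (β i t) - σ * r)) := by
  constructor
  · filter_upwards [Ioo_mem_nhdsLT hs'] with τ hτ
    have hc := hf.isComp (Ioo_subset_Icc_self hτ) i
    have h1 : Icc (α i τ) (β i τ) ⊆ closure (S τ) := by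
      rw [← closure_Ioo hc.lt.ne]; exact closure_mono hc.sub
    rcases hσ with rfl | rfl
    · exact ⟨by simpa using hc.right, h1 (by simpa using hc.lt.le)⟩
    · exact ⟨by simpa using hc.left, h1 (by simpa using hc.lt.le)⟩
  · have hc := hf.isComp (right_mem_Icc.2 hs'.le) i
    filter_upwards [Ioo_mem_nhdsGT (sub_pos.2 hc.lt)] with r hr
    have h1 : side σ (α i t) (β i t) - σ * r ∈ Ioo (α i t) (β i t) := by
      rcases hσ with rfl | rfl
      · rw [side_one]; constructor <;> linarith [hr.1, hr.2]
      · rw [side_neg_one]; constructor <;> linarith [hr.1, hr.2]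
    refine ⟨hc.sub h1, ?_⟩
    rw [hA.prof_side hσ hc.lt, hc.dsol_eq hA (h.isOpen ⟨ht.1.le, ht.2⟩)
      (h.bounded hK ⟨ht.1.le, ht.2⟩) (Ioo_subset_Icc_self h1)]

/-- The sign σ marks the side on which φ increases into the positivity set. Spatial contact gives
|φ_x| ≤ slope of the profile, contact along the moving endpoint gives φ_t ≥ w |φ_x|, and V is
monotone in the slope. -/
lemma super_ineq (hA : CoefBounds A F m M) (hV : VelBounds V C) (h : Gen A F V ℓ N K s L S)
    (hK : 0 < K) {t x : ℝ} (ht : t ∈ Ioo s L) (hx : x ∉ S t) {φ : ℝ × ℝ → ℝ}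
    {φ' : ℝ × ℝ →L[ℝ] ℝ} (hφ : HasFDerivAt φ φ' (x, t)) (hne : φ' (1, 0) ≠ 0)
    (H : ∀ᶠ z in 𝓝[{z : ℝ × ℝ | z.2 ≤ t}] (x, t), φ z - φ (x, t) ≤ dsol A F (S z.2) z.1) :
    V x (φ' (1, 0)) * |φ' (1, 0)| ≤ φ' (0, 1) := by
  obtain ⟨σ, hσ, hσφ⟩ : ∃ σ : ℝ, (σ = 1 ∨ σ = -1) ∧ φ' (1, 0) = -σ * |φ' (1, 0)| := by
    rcases lt_or_gt_of_ne hne with h0 | h0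
    · exact ⟨1, Or.inl rfl, by rw [abs_of_neg h0]; ring⟩
    · exact ⟨-1, Or.inr rfl, by rw [abs_of_pos h0]; ring⟩
  set p := |φ' (1, 0)| with hp
  have hp0 : 0 < p := abs_pos.2 hne
  have hσσ := mul_sign_sq hσ
  obtain ⟨s', hs', ι, _, α, β, hf⟩ := h.left t ht
  have htt : t ∈ Icc s' t := right_mem_Icc.2 hs'.2.le
  have hr0 : Tendsto (fun r : ℝ => (x - σ * r, t)) (𝓝[>] 0) (𝓝[{z : ℝ × ℝ | z.2 ≤ t}] (x, t)) := by
    refine tendsto_nhdsWithin_iff.2 ⟨?_, .of_forall fun _ => le_refl t⟩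
    refine (Continuous.tendsto' (by fun_prop) 0 _ (by simp)).mono_left nhdsWithin_le_nhds
  have hr1 := hr0.eventually H
  -- points next to `x` on one side lie in the slice
  have hd := (touching_derivs (σ := σ) (w := 0) (e := fun _ => x) hφ
    (by simpa using hasDerivWithinAt_const t (Iic t) x) rfl).2
  have hd' : HasDerivAt (fun r => φ (x - σ * r, t)) p 0 := by
    convert hd using 1; rw [hσφ, ← mul_assoc, neg_mul_neg, hσσ, one_mul]
  have hpos : ∀ᶠ r in 𝓝[>] (0 : ℝ), x - σ * r ∈ S t := by
    have h1 := (hasDerivAt_iff_tendsto_slope.1 hd').mono_left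
      (nhdsWithin_mono 0 (fun r (hr : r ∈ Ioi (0 : ℝ)) => ne_of_gt hr))
    filter_upwards [h1.eventually_const_lt hp0, hr1, self_mem_nhdsWithin] with r h2 h3 h4
    by_contra hn
    rw [dsol_of_notMem hn] at h3
    rw [slope_def_field, sub_zero, mul_zero, sub_zero] at h2
    exact absurd h2 (not_lt.2 (div_nonpos_of_nonpos_of_nonneg h3 (le_of_lt h4)))
  -- A one-sided neighbourhood of x lies in the slice but x does not, so x is an endpoint of the
  -- component containing this neighbourhood.
  obtain ⟨i, hi⟩ : ∃ i, side σ (α i t) (β i t) = x := by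
    obtain ⟨r₀, hr₀, hr₀'⟩ := mem_nhdsGT_iff_exists_Ioo_subset.1 hpos
    have hr₀p : 0 < r₀ := hr₀
    have hy : x - σ * (r₀ / 2) ∈ S t := hr₀' ⟨by linarith, by linarith⟩
    rw [hf.eq t htt, mem_iUnion] at hy
    obtain ⟨i, hi⟩ := hy
    have hc := hf.isComp htt i
    refine ⟨i, ?_⟩
    rcases hσ with rfl | rfl
    · rw [side_one]
      have hsub : Ioo (x - r₀) x ⊆ S t := fun y hy => by
        have := hr₀' (show x - y ∈ Ioo 0 r₀ from ⟨by linarith [hy.2], by linarith [hy.1]⟩)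
        simpa using this
      refine le_antisymm ?_ (hc.le_right hsub hi ⟨by linarith, by linarith⟩)
      by_contra hlt
      exact hx (hc.sub ⟨by linarith [hi.1], not_le.1 hlt⟩)
    · rw [side_neg_one]
      have hsub : Ioo x (x + r₀) ⊆ S t := fun y hy => by
        have := hr₀' (show y - x ∈ Ioo 0 r₀ from ⟨by linarith [hy.1], by linarith [hy.2]⟩)
        simpa using this
      refine le_antisymm (hc.le_left hsub hi ⟨by linarith, by linarith⟩) ?_
      by_contra hlt
      exact hx (hc.sub ⟨not_le.1 hlt, by linarith [hi.2]⟩)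
  obtain ⟨t1, t2⟩ := h.touch_left hA hK ht hs'.2 hf i hσ
  have hder := HasDerivWithinAt.iic_of_Icc hs'.2 ((hf.traj i).hasDeriv_side hσ htt)
  have hslope := hA.slope_side_pos hσ ((hf.traj i).lt t htt)
  rw [hi] at hder t2 hslope
  set k := kav A F (α i t) (β i t) with hk
  set w := spd A F V x k with hw
  set hh := σ * ((primF F x - k) / A x) with hhh
  -- the slope of the test function is at most that of the profile
  have hle : p ≤ hh := by
    refine sub_nonneg.1 (nonneg_deriv_of_le_right
      ((prof_side_deriv hA k x σ).sub hd').hasDerivWithinAt ?_)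
    filter_upwards [t2, hr1] with r h1 h2
    simp only [Pi.sub_apply, mul_zero, sub_zero, CoefBounds.prof_self]
    rw [h1.2] at h2
    linarith
  -- Along the endpoint the pressure vanishes at earlier times, so φ is at most its value at the
  -- contact point there.
  have htime : 0 ≤ φ' (1, 0) * (σ * w) + φ' (0, 1) := by
    refine nonneg_deriv_of_le_left (touching_derivs hφ hder hi).1 ?_
    have h1 : Tendsto (fun τ => (side σ (α i τ) (β i τ), τ)) (𝓝[<] t)
        (𝓝[{z : ℝ × ℝ | z.2 ≤ t}] (x, t)) := by
      refine tendsto_nhdsWithin_iff.2 ⟨?_, ?_⟩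
      · have := (hder.continuousWithinAt.prodMk continuousWithinAt_id).mono_left
          (nhdsWithin_mono t Iio_subset_Iic_self)
        simpa [hi] using this
      · filter_upwards [self_mem_nhdsWithin] with τ hτ using le_of_lt hτ
    filter_upwards [h1.eventually H, t1] with τ h2 h3
    rw [dsol_of_notMem h3.1] at h2
    rw [hi]
    linarith
  have hw2 : w = V x (-σ * hh) := by
    rw [hw, spd, hhh, ← mul_assoc, neg_mul, hσσ]
    congr 1; ring
  have hmono := hV.mono_side (x := x) (σ := σ) hp0 hle
  rw [hσφ] at htime ⊢
  have : -σ * p * (σ * w) = -(p * w) := by linear_combination (-(p * w)) * hσσ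
  rw [this, hw2] at htime
  have := mul_le_mul_of_nonneg_right hmono hp0.le
  rw [hσφ] at hp
  linarith

/-- The reversed comparison: the test function is at least as steep as the profile, whose slope is
positive. So φ_x cannot vanish here. -/
lemma sub_ineq (hA : CoefBounds A F m M) (hV : VelBounds V C) (h : Gen A F V ℓ N K s L S)
    (hK : 0 < K) {t x : ℝ} (ht : t ∈ Ioo s L) (hxc : x ∈ closure (S t)) (hx : x ∉ S t)
    {φ : ℝ × ℝ → ℝ} {φ' : ℝ × ℝ →L[ℝ] ℝ} (hφ : HasFDerivAt φ φ' (x, t))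
    (H : ∀ᶠ z in 𝓝[{z : ℝ × ℝ | z.2 ≤ t ∧ z.1 ∈ closure (S z.2)}] (x, t),
      dsol A F (S z.2) z.1 ≤ φ z - φ (x, t)) :
    φ' (0, 1) ≤ V x (φ' (1, 0)) * |φ' (1, 0)| := by
  obtain ⟨s', hs', ι, _, α, β, hf⟩ := h.left t ht
  have htt : t ∈ Icc s' t := right_mem_Icc.2 hs'.2.le
  -- With finitely many intervals the closure of the slice is the union of the closed intervals, so
  -- a boundary point is an endpoint.
  obtain ⟨i, σ, hσ, hi⟩ : ∃ i, ∃ σ : ℝ, (σ = 1 ∨ σ = -1) ∧ side σ (α i t) (β i t) = x := by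
    rw [hf.eq t htt, closure_iUnion_of_finite, mem_iUnion] at hxc
    obtain ⟨i, hi⟩ := hxc
    have hc := hf.isComp htt i
    rw [closure_Ioo hc.lt.ne] at hi
    refine ⟨i, ?_⟩
    rcases eq_or_lt_of_le hi.1 with h1 | h1
    · exact ⟨-1, Or.inr rfl, by simpa using h1⟩
    rcases eq_or_lt_of_le hi.2 with h2 | h2
    · exact ⟨1, Or.inl rfl, by simpa using h2.symm⟩
    · exact absurd (hc.sub ⟨h1, h2⟩) hx
  have hσσ := mul_sign_sq hσ
  obtain ⟨t1, t2⟩ := h.touch_left hA hK ht hs'.2 hf i hσ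
  have hder := HasDerivWithinAt.iic_of_Icc hs'.2 ((hf.traj i).hasDeriv_side hσ htt)
  have hslope := hA.slope_side_pos hσ ((hf.traj i).lt t htt)
  rw [hi] at hder t2 hslope
  set k := kav A F (α i t) (β i t) with hk
  set w := spd A F V x k with hw
  set hh := σ * ((primF F x - k) / A x) with hhh
  have hle : hh ≤ -σ * φ' (1, 0) := by
    refine sub_nonneg.1 (nonneg_deriv_of_le_right
      ((touching_derivs hφ hder hi).2.sub (prof_side_deriv hA k x σ)).hasDerivWithinAt ?_)
    have hr0 : Tendsto (fun r : ℝ => (x - σ * r, t)) (𝓝[>] 0) (𝓝 (x, t)) :=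
      (Continuous.tendsto' (by fun_prop) 0 _ (by simp)).mono_left nhdsWithin_le_nhds
    rw [eventually_nhdsWithin_iff] at H
    filter_upwards [t2, hr0.eventually H] with r h1 h2
    simp only [Pi.sub_apply, mul_zero, sub_zero, CoefBounds.prof_self]
    have h3 := h2 ⟨le_rfl, subset_closure h1.1⟩
    rw [h1.2] at h3
    linarith
  have hp : |φ' (1, 0)| = -σ * φ' (1, 0) := by
    rw [← abs_of_pos (hslope.trans_le hle), abs_mul, abs_neg, abs_sign hσ, one_mul]
  set p := |φ' (1, 0)| with hpdef
  have hp0 : 0 < p := by rw [hp]; exact hslope.trans_le hle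
  rw [← hp] at hle
  have hσφ : φ' (1, 0) = -σ * p := by rw [hp]; linear_combination (-(φ' (1, 0))) * hσσ
  have htime : 0 ≤ -(φ' (1, 0) * (σ * w) + φ' (0, 1)) := by
    refine nonneg_deriv_of_le_left (touching_derivs hφ hder hi).1.neg ?_
    have h1 : Tendsto (fun τ => (side σ (α i τ) (β i τ), τ)) (𝓝[<] t) (𝓝 (x, t)) := by
      have := (hder.continuousWithinAt.prodMk continuousWithinAt_id).mono_left
        (nhdsWithin_mono t Iio_subset_Iic_self)
      simpa [hi] using this
    rw [eventually_nhdsWithin_iff] at H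
    filter_upwards [h1.eventually H, t1, self_mem_nhdsWithin] with τ h2 h3 h4
    have h5 := h2 ⟨le_of_lt h4, h3.2⟩
    rw [dsol_of_notMem h3.1] at h5
    simp only [Pi.neg_apply]
    rw [hi]
    linarith
  have hw2 : w = V x (-σ * hh) := by
    rw [hw, spd, hhh, ← mul_assoc, neg_mul, hσσ]
    congr 1; ring
  have hmono := hV.mono_side (x := x) (σ := σ) hslope hle
  have h1 : φ' (1, 0) * (σ * w) = -(p * w) := by
    rw [hσφ]; linear_combination (-(p * w)) * hσσ
  rw [h1] at htime
  rw [hσφ]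
  rw [← hw2] at hmono
  have := mul_le_mul_of_nonneg_right hmono hp0.le
  linarith

end Gen

end HeleShaw

/-! ### Comparison of generated evolutions with superflows and subflows -/

namespace HeleShaw

variable {A F : ℝ → ℝ} {V : ℝ → ℝ → ℝ} {m M C ℓ N K : ℝ}

lemma forward_induction {P : ℝ → Prop} {a b : ℝ} (h0 : P a)
    (hright : ∀ t ∈ Ico a b, P t → ∀ᶠ τ in 𝓝[>] t, P τ)
    (hleft : ∀ t ∈ Ioc a b, (∀ τ ∈ Ico a t, P τ) → P t) : ∀ t ∈ Icc a b, P t := by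
  intro t ht
  by_contra hn
  set B : Set ℝ := {τ | τ ∈ Icc a t ∧ ¬P τ}
  have hB : t ∈ B := ⟨⟨ht.1, le_rfl⟩, hn⟩
  have hbdd : BddBelow B := ⟨a, fun τ hτ => hτ.1.1⟩
  have h1 : a ≤ sInf B := le_csInf ⟨t, hB⟩ fun τ hτ => hτ.1.1
  have h2 : sInf B ≤ t := csInf_le hbdd hB
  have h3 : ∀ τ ∈ Ico a (sInf B), P τ := fun τ hτ => by
    by_contra hτn
    exact absurd (csInf_le hbdd ⟨⟨hτ.1, hτ.2.le.trans h2⟩, hτn⟩) (not_le.2 hτ.2)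
  have h4 : P (sInf B) := by
    rcases eq_or_lt_of_le h1 with h | h
    · rwa [← h]
    · exact hleft _ ⟨h, h2.trans ht.2⟩ h3
  rcases eq_or_lt_of_le h2 with h | h
  · exact hn (h ▸ h4)
  obtain ⟨u, hu, hu'⟩ := mem_nhdsGT_iff_exists_Ioo_subset.1 (hright _ ⟨h1, h.trans_le ht.2⟩ h4)
  obtain ⟨τ, hτ, hτu⟩ := exists_lt_of_csInf_lt ⟨t, hB⟩ hu
  rcases eq_or_lt_of_le (csInf_le hbdd hτ) with h5 | h5
  · exact hτ.2 (h5 ▸ h4)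
  · exact hτ.2 (hu' ⟨h5, hτu⟩)

/-- Evolutions of bounded sets that are open in space-time. -/
structure IsOpenEvolution (s T : ℝ) (X : ℝ → Set ℝ) : Prop where
  opn : ∀ t ∈ Ico s T, ∀ x ∈ X t, ∀ᶠ z in 𝓝[{z : ℝ × ℝ | s ≤ z.2}] (x, t), z.1 ∈ X z.2
  bdd : ∀ t ∈ Ico s T, Bornology.IsBounded (X t)
  rusc : ∀ t ∈ Ico s T, ∀ ε > 0, ∀ᶠ τ in 𝓝[>] t, X τ ⊆ Metric.thickening ε (X t)
  lusc : ∀ t ∈ Ioo s T, ∀ ε > 0, ∀ᶠ τ in 𝓝[<] t, X τ ⊆ Metric.thickening ε (X t)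

lemma IsOpenEvolution.isOpen {s T t : ℝ} {X : ℝ → Set ℝ} (h : IsOpenEvolution s T X)
    (ht : t ∈ Ico s T) : IsOpen (X t) := by
  rw [isOpen_iff_mem_nhds]
  intro x hx
  have h1 := h.opn t ht x hx
  have h2 : Tendsto (fun y => (y, t)) (𝓝 x) (𝓝[{z : ℝ × ℝ | s ≤ z.2}] (x, t)) :=
    tendsto_nhdsWithin_iff.2 ⟨(Continuous.prodMk_left t).tendsto x, .of_forall fun _ => ht.1⟩
  exact h2.eventually h1

lemma IsOpenEvolution.eventually_mem {s T t x : ℝ} {X : ℝ → Set ℝ} (h : IsOpenEvolution s T X)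
    (ht : t ∈ Ico s T) (hx : x ∈ X t) : ∀ᶠ τ in 𝓝[Ici s] t, x ∈ X τ := by
  have h2 : Tendsto (fun τ => (x, τ)) (𝓝[Ici s] t) (𝓝[{z : ℝ × ℝ | s ≤ z.2}] (x, t)) :=
    tendsto_nhdsWithin_iff.2 ⟨((Continuous.prodMk_right x).tendsto t).mono_left nhdsWithin_le_nhds,
      by filter_upwards [self_mem_nhdsWithin] with τ hτ using hτ⟩
  exact h2.eventually (h.opn t ht x hx)

lemma Gen.isOpenEvolution {s L : ℝ} {S : ℝ → Set ℝ} (h : Gen A F V ℓ N K s L S) (hK : 0 < K) :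
    IsOpenEvolution s L S where
  opn := h.opn
  bdd _ ht := h.bounded hK ht
  rusc := h.rusc
  lusc t ht ε hε := by
    filter_upwards [Ioo_mem_nhdsLT ht.1] with τ hτ
    exact (h.mono τ t hτ.1.le hτ.2.le ht.2).trans (Metric.self_subset_thickening hε _)

lemma CoefBounds.continuousWithinAt_kav (hA : CoefBounds A F m M) {f g : ℝ → ℝ} {I : Set ℝ} {t : ℝ}
    (hf : ContinuousWithinAt f I t) (hg : ContinuousWithinAt g I t) (hlt : f t < g t) :
    ContinuousWithinAt (fun τ => kav A F (f τ) (g τ)) I t := by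
  have h1 : Tendsto (fun r => M ^ 2 / m * (|f r - f t| + |g r - g t|)) (𝓝[I] t)
      (𝓝 (M ^ 2 / m * (|f t - f t| + |g t - g t|))) :=
    ((hf.sub_const _).abs.add (hg.sub_const _).abs).const_mul _
  simp only [sub_self, abs_zero, add_zero, mul_zero] at h1
  rw [ContinuousWithinAt, tendsto_iff_dist_tendsto_zero]
  refine squeeze_zero' (.of_forall fun _ => dist_nonneg) ?_ h1
  filter_upwards [hf.eventually_lt hg hlt] with r hr
  exact hA.kav_lip hlt hr

section Time

variable {s s' k t : ℝ}

lemma time_tendsto_left (hk : 0 < k) :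
    Tendsto (fun τ => s' + k * (τ - s)) (𝓝[≤] t) (𝓝[≤] (s' + k * (t - s))) := by
  refine tendsto_nhdsWithin_iff.2 ⟨(Continuous.tendsto (by fun_prop) t).mono_left
    nhdsWithin_le_nhds, ?_⟩
  filter_upwards [self_mem_nhdsWithin] with τ hτ
  have : k * (τ - s) ≤ k * (t - s) := by gcongr; exact hτ
  exact add_le_add le_rfl this

lemma time_tendsto_right (hk : 0 < k) :
    Tendsto (fun τ => s' + k * (τ - s)) (𝓝[>] t) (𝓝[>] (s' + k * (t - s))) := by
  refine tendsto_nhdsWithin_iff.2 ⟨(Continuous.tendsto (by fun_prop) t).mono_left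
    nhdsWithin_le_nhds, ?_⟩
  filter_upwards [self_mem_nhdsWithin] with τ hτ
  have : k * (t - s) < k * (τ - s) := by gcongr; exact hτ
  exact add_lt_add_of_le_of_lt le_rfl this

lemma time_hasDeriv {e : ℝ → ℝ} {e' : ℝ} (hk : 0 < k)
    (he : HasDerivWithinAt e e' (Iic (s' + k * (t - s))) (s' + k * (t - s))) :
    HasDerivWithinAt (fun τ => e (s' + k * (τ - s))) (k * e') (Iic t) t := by
  have h1 : HasDerivWithinAt (fun τ => s' + k * (τ - s)) k (Iic t) t := by
    have := ((((hasDerivAt_id t).sub_const s).const_mul k).const_add s').hasDerivWithinAt (s := Iic t)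
    simpa using this
  have h2 : MapsTo (fun τ => s' + k * (τ - s)) (Iic t) (Iic (s' + k * (t - s))) := fun τ hτ => by
    have : k * (τ - s) ≤ k * (t - s) := by gcongr; exact hτ
    exact add_le_add le_rfl this
  exact (he.comp t h1 h2).congr_deriv (by ring)

end Time

/-- An evolution with decelerated time stays inside of a superflow. -/
theorem compare_super (hA : CoefBounds A F m M) (hV : VelBounds V C) (hK : 0 < K) {s₀ L : ℝ}
    {S : ℝ → Set ℝ} (hS : Gen A F V ℓ N K s₀ L S) {s T : ℝ} {X : ℝ → Set ℝ}
    (hX : LinSuper A F V s T X) (hXe : IsOpenEvolution s T X) {s' k : ℝ} (hs' : s₀ ≤ s')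
    (hk0 : 0 < k) (hk1 : k < 1) (h0 : closure (S s') ⊆ X s) {b : ℝ} (hbT : b < T)
    (hbL : s' + k * (b - s) < L) :
    ∀ t ∈ Icc s b, closure (S (s' + k * (t - s))) ⊆ X t := by
  have hθ : ∀ t ∈ Icc s b, s' + k * (t - s) ∈ Ico s₀ L := fun t ht => by
    have h1 : 0 ≤ k * (t - s) := mul_nonneg hk0.le (sub_nonneg.2 ht.1)
    have h2 : k * (t - s) ≤ k * (b - s) := by gcongr; exact ht.2
    exact ⟨by linarith, by linarith⟩
  refine forward_induction (by simpa using h0) (fun t ht hP => ?_) (fun t ht hP => ?_)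
  · have htT : t ∈ Ico s T := ⟨ht.1, ht.2.trans hbT⟩
    have hθt := hθ t ⟨ht.1, ht.2.le⟩
    have hQ : IsCompact (closure (S (s' + k * (t - s)))) := (hS.bounded hK hθt).isCompact_closure
    -- Compact inclusion in an open set has a margin ε. It stays in X for a short time, while S does
    -- not leave it by upper semicontinuity from the right.
    obtain ⟨ε, hε, hεs⟩ := hQ.exists_cthickening_subset_open (hXe.isOpen htT) hP
    have e1 := tube (I := Ici s) (hQ.cthickening (r := ε))
      fun x hx => hXe.opn t htT x (hεs hx)
    have e2 := (time_tendsto_right (s := s) (s' := s') hk0).eventually (hS.rusc _ hθt ε hε)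
    filter_upwards [e1.filter_mono (nhdsWithin_mono t fun τ hτ => ht.1.trans (le_of_lt hτ)), e2]
      with τ h1 h2
    refine (closure_minimal (h2.trans ?_) Metric.isClosed_cthickening).trans h1
    rw [Metric.cthickening_closure]
    exact Metric.thickening_subset_cthickening _ _
  -- the first time of contact
  have htT : t ∈ Ioo s T := ⟨ht.1, ht.2.trans_lt hbT⟩
  have htT' : t ∈ Ico s T := ⟨ht.1.le, htT.2⟩
  have hθt := hθ t ⟨ht.1.le, ht.2⟩
  set r := s' + k * (t - s) with hr
  have hr0 : s₀ < r := by
    have := mul_pos hk0 (sub_pos.2 ht.1); linarith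
  have hXo := hXe.isOpen htT'
  have hXb := hXe.bdd t htT'
  obtain ⟨s'', hs'', ι, _, α, β, hf⟩ := hS.left r ⟨hr0, hθt.2⟩
  have hrr : r ∈ Icc s'' r := right_mem_Icc.2 hs''.2.le
  rw [hf.eq r hrr, closure_iUnion_of_finite]
  refine iUnion_subset fun i => ?_
  have hc := hf.isComp hrr i
  set a := α i r with ha
  set b' := β i r with hb'
  have hab : a < b' := hc.lt
  have hIcc : ∀ᶠ u in 𝓝[≤] r, u ∈ Icc s'' r := Icc_mem_nhdsLE hs''.2
  have cα : ContinuousWithinAt (α i) (Iic r) r :=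
    (HasDerivWithinAt.iic_of_Icc hs''.2 ((hf.traj i).left r hrr)).continuousWithinAt
  have cβ : ContinuousWithinAt (β i) (Iic r) r :=
    (HasDerivWithinAt.iic_of_Icc hs''.2 ((hf.traj i).right r hrr)).continuousWithinAt
  have tl := time_tendsto_left (s := s) (s' := s') (t := t) hk0
  have cα' : ContinuousWithinAt (fun τ => α i (s' + k * (τ - s))) (Iic t) t := cα.tendsto.comp tl
  have cβ' : ContinuousWithinAt (fun τ => β i (s' + k * (τ - s))) (Iic t) t := cβ.tendsto.comp tl
  -- before the contact time the moving interval is inside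
  have hin : ∀ᶠ τ in 𝓝[≤] t, τ < t → Ioo (α i (s' + k * (τ - s))) (β i (s' + k * (τ - s))) ⊆ X τ := by
    filter_upwards [tl.eventually hIcc, Icc_mem_nhdsLE ht.1] with τ h1 h2 h3
    exact (hf.isComp h1 i).sub.trans (subset_closure.trans (hP τ ⟨h2.1, h3⟩))
  have hinlt : ∀ᶠ τ in 𝓝[<] t, Ioo (α i (s' + k * (τ - s))) (β i (s' + k * (τ - s))) ⊆ X τ := by
    filter_upwards [hin.filter_mono (nhdsWithin_mono t Iio_subset_Iic_self), self_mem_nhdsWithin]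
      with τ h1 h2 using h1 h2
  -- Upper semicontinuity from the left passes the inclusion at earlier times to the limit only up
  -- to closure, so holes of X t inside of the interval have to be excluded separately.
  have hsubc : Icc a b' ⊆ closure (X t) := by
    rw [← closure_Ioo hab.ne]
    refine closure_minimal (fun y hy => ?_) isClosed_closure
    rw [Metric.mem_closure_iff]
    intro ε hε
    obtain ⟨τ, ⟨⟨h1, h2⟩, h3⟩, h4⟩ := (((hinlt.and (hXe.lusc t htT ε hε)).and
      ((cα'.eventually_lt continuousWithinAt_const hy.1).filter_mono
        (nhdsWithin_mono t Iio_subset_Iic_self))).and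
      ((continuousWithinAt_const.eventually_lt cβ' hy.2).filter_mono
        (nhdsWithin_mono t Iio_subset_Iic_self))).exists
    exact Metric.mem_thickening_iff.1 (h2 (h1 ⟨h3, h4⟩))
  have hnn : ∀ x, ∀ᶠ z in 𝓝[{z : ℝ × ℝ | z.2 ≤ t}] (x, t), 0 ≤ dsol A F (X z.2) z.1 := fun x => by
    have hm : MapsTo Prod.snd {z : ℝ × ℝ | z.2 ≤ t} (Iic t) := fun z hz => hz
    filter_upwards [eventually_snd (x := x) hm (Icc_mem_nhdsLE ht.1)] with z hz
    have hz' : z.2 ∈ Ico s T := ⟨hz.1, hz.2.trans_lt htT.2⟩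
    exact hA.dsol_nonneg (hXe.isOpen hz') (hXe.bdd _ hz') _
  have hm : MapsTo Prod.snd {z : ℝ × ℝ | z.2 ≤ t} (Iic t) := fun z hz => hz
  have hopbd : ∀ x, ∀ᶠ z in 𝓝[{z : ℝ × ℝ | z.2 ≤ t}] (x, t),
      IsOpen (X z.2) ∧ Bornology.IsBounded (X z.2) := fun x => by
    filter_upwards [eventually_snd (x := x) hm (Icc_mem_nhdsLE ht.1)] with z hz
    have hz' : z.2 ∈ Ico s T := ⟨hz.1, hz.2.trans_lt htT.2⟩
    exact ⟨hXe.isOpen hz', hXe.bdd _ hz'⟩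
  have hfst : ∀ x, Tendsto Prod.fst (𝓝[{z : ℝ × ℝ | z.2 ≤ t}] (x, t)) (𝓝 x) := fun x =>
    (continuous_fst.continuousWithinAt (x := (x, t))).tendsto
  by_cases hfull : Ioo a b' ⊆ X t
  · -- contact at an endpoint of the moving interval is impossible
    have hend : ∀ σ : ℝ, (σ = 1 ∨ σ = -1) → side σ a b' ∈ X t := by
      intro σ hσ
      by_contra hx
      set x := side σ a b' with hxdef
      have hxc : x ∈ closure (X t) := hsubc (by
        rcases hσ with rfl | rfl
        · rw [hxdef, side_one]; exact right_mem_Icc.2 hab.le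
        · rw [hxdef, side_neg_one]; exact left_mem_Icc.2 hab.le)
      have hder := time_hasDeriv hk0
        (HasDerivWithinAt.iic_of_Icc hs''.2 ((hf.traj i).hasDeriv_side hσ hrr))
      have hkav := hA.continuousWithinAt_kav cα' cβ' hab
      have hcon := contact_super hA hV hX htT hxc hx hσ (w := k * spd A F V x (kav A F a b'))
        (hder.congr_deriv (by rw [hxdef]; ring)) rfl hkav (hA.slope_side_pos hσ hab) (hnn x) (by
          have e1 : ∀ᶠ z in 𝓝[{z : ℝ × ℝ | z.2 ≤ t}] (x, t), σ = 1 →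
              α i (s' + k * (z.2 - s)) < z.1 := by
            rcases hσ with rfl | rfl
            · rw [side_one] at hxdef
              have := eventually_snd (x := x) hm
                (cα'.eventually_lt_const (u := (a + b') / 2) (by show a < _; linarith))
              filter_upwards [this, (hfst x).eventually_const_lt
                (show (a + b') / 2 < x by linarith)] with z h1 h2 _ using h1.trans h2
            · exact .of_forall fun z h => absurd h (by norm_num)
          have e2 : ∀ᶠ z in 𝓝[{z : ℝ × ℝ | z.2 ≤ t}] (x, t), σ = -1 →
              z.1 < β i (s' + k * (z.2 - s)) := by
            rcases hσ with rfl | rfl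
            · exact .of_forall fun z h => absurd h (by norm_num)
            · rw [side_neg_one] at hxdef
              have := eventually_snd (x := x) hm
                (cβ'.eventually_const_lt (u := (a + b') / 2) (by show _ < b'; linarith))
              filter_upwards [this, (hfst x).eventually_lt_const
                (show x < (a + b') / 2 by linarith)] with z h1 h2 _ using h2.trans h1
          filter_upwards [e1, e2, eventually_snd (x := x) hm hin, hopbd x,
            eventually_snd (x := x) hm (tl.eventually hIcc), self_mem_nhdsWithin]
            with z h1 h2 h3 h4 h5 h6 h7
          have hlt := (hf.traj i).lt _ h5
          have hsub : Ioo (α i (s' + k * (z.2 - s))) (β i (s' + k * (z.2 - s))) ⊆ X z.2 := by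
            rcases lt_or_eq_of_le (show z.2 ≤ t from h6) with h | h
            · exact h3 h
            · rw [h]; exact hfull
          rw [hA.prof_side hσ hlt]
          refine hA.le_dsol h4.1 h4.2 hlt hsub ?_
          rcases hσ with rfl | rfl
          · rw [side_one] at h7
            exact ⟨(h1 rfl).le, by linarith⟩
          · rw [side_neg_one] at h7
            exact ⟨by linarith, (h2 rfl).le⟩)
      have hpos : 0 < spd A F V x (kav A F a b') := by
        refine hV.pos _ _ fun h => ?_
        have := hA.slope_side_pos hσ hab
        rw [← neg_sub, neg_div, h] at this
        simp at this
      -- The decelerated endpoint moves at k times its own speed, whereas the superflow property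
      -- demands at least the full positive speed.
      have hcon' : spd A F V x (kav A F a b') ≤ k * spd A F V x (kav A F a b') := hcon
      nlinarith
    rw [closure_Ioo hab.ne]
    intro x hx
    rcases eq_or_lt_of_le hx.1 with h1 | h1
    · have := hend (-1) (Or.inr rfl)
      rwa [side_neg_one, h1] at this
    rcases eq_or_lt_of_le hx.2 with h2 | h2
    · have := hend 1 (Or.inl rfl)
      rwa [side_one, ← h2] at this
    · exact hfull ⟨h1, h2⟩
  · -- a hole inside of the moving interval is impossible
    exfalso
    obtain ⟨y', hy', hyn'⟩ := not_subset.1 hfull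
    obtain ⟨y₀, hy₀⟩ := nonempty_Ioo.2 hab
    obtain ⟨y, hyI, hyX⟩ := mem_closure_iff.1 (hsubc (Ioo_subset_Icc_self hy₀)) _ isOpen_Ioo hy₀
    obtain ⟨a₁, b₁, hc₁, hy₁⟩ := exists_isComp hXo hXb hyX
    -- As X t is dense in (a, b') but misses y', the component of a point y of X t has an endpoint
    -- strictly inside (a, b'), on the side facing y'.
    obtain ⟨σ, hσ, hx₁⟩ : ∃ σ : ℝ, (σ = 1 ∨ σ = -1) ∧ side σ a₁ b₁ ∈ Ioo a b' := by
      rcases le_total y y' with h | h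
      · refine ⟨1, Or.inl rfl, ?_⟩
        rw [side_one]
        have : b₁ ≤ y' := by
          by_contra hlt
          exact hyn' (hc₁.sub ⟨hy₁.1.trans_le h, not_le.1 hlt⟩)
        exact ⟨hyI.1.trans hy₁.2, this.trans_lt hy'.2⟩
      · refine ⟨-1, Or.inr rfl, ?_⟩
        rw [side_neg_one]
        have : y' ≤ a₁ := by
          by_contra hlt
          exact hyn' (hc₁.sub ⟨not_le.1 hlt, h.trans_lt hy₁.2⟩)
        exact ⟨hy'.1.trans_le this, hy₁.1.trans hyI.2⟩
    set x := side σ a₁ b₁ with hxdef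
    have hxn : x ∉ X t := by
      rcases hσ with rfl | rfl
      · rw [hxdef, side_one]; exact hc₁.right
      · rw [hxdef, side_neg_one]; exact hc₁.left
    have hslope := hA.slope_side_pos hσ hc₁.lt
    rw [← hxdef] at hslope
    set q := σ * ((primF F x - kav A F a₁ b₁) / A x) / 2 with hq
    have hq0 : 0 < q := half_pos hslope
    obtain ⟨δ, hδ, Hδ⟩ := (hA.prof_side_near (e₀ := x) (k₀ := kav A F a₁ b₁) hσ).1 q
      (half_lt_self hslope)
    -- A test function of speed 0 is admissible at the edge of the hole. Before t, X contains a
    -- fixed interval around x, whose profile is bounded away from zero near x; at t the profile on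
    -- the component of X t suffices. The conclusion V ≤ 0 contradicts positivity.
    have hcon := hX t htT x (hsubc (Ioo_subset_Icc_self hx₁)) hxn σ q 0 hσ hq0 (by
      set a₂ := (a + x) / 2 with ha₂
      set b₂ := (x + b') / 2 with hb₂
      have hxa : a₂ < x := by linarith [hx₁.1]
      have hxb : x < b₂ := by linarith [hx₁.2]
      have e1 := eventually_snd (x := x) hm
        (cα'.eventually_lt_const (u := a₂) (by show a < _; linarith [hx₁.1]))
      have e2 := eventually_snd (x := x) hm
        (cβ'.eventually_const_lt (u := b₂) (by show _ < b'; linarith [hx₁.2]))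
      have e3 : ∀ᶠ y in 𝓝 x, q * (σ * (x - y)) < prof A F (kav A F a₂ b₂) b₂ y := by
        refine ContinuousAt.eventually_lt (Continuous.continuousAt (by fun_prop))
          (hA.prof_cont _ _).continuousAt ?_
        rw [sub_self, mul_zero, mul_zero]
        exact hA.prof_pos ⟨hxa, hxb⟩
      have e4 : ∀ᶠ y in 𝓝 x, y ∈ Ioo a₂ b₂ := isOpen_Ioo.mem_nhds ⟨hxa, hxb⟩
      have e5 : ∀ᶠ y in 𝓝 x, 0 ≤ σ * (x - y) → y ∈ Icc a₁ b₁ := by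
        rcases hσ with rfl | rfl
        · rw [side_one] at hxdef
          filter_upwards [eventually_gt_nhds (show a₁ < x by rw [hxdef]; exact hc₁.lt)] with y h1 h2
          exact ⟨h1.le, by linarith⟩
        · rw [side_neg_one] at hxdef
          filter_upwards [eventually_lt_nhds (show x < b₁ by rw [hxdef]; exact hc₁.lt)] with y h1 h2
          exact ⟨by linarith, h1.le⟩
      have e6 : ∀ᶠ y in 𝓝 x, |y - x| < δ := Metric.ball_mem_nhds x hδ
      filter_upwards [e1, e2, (hfst x).eventually e3, (hfst x).eventually e4,
        (hfst x).eventually e5, (hfst x).eventually e6, hnn x, hopbd x,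
        eventually_snd (x := x) hm hin, self_mem_nhdsWithin]
        with z h1 h2 h3 h4 h5 h6 h7 h8 h9 h10
      rw [zero_mul, sub_zero]
      rcases lt_or_eq_of_le (show z.2 ≤ t from h10) with h | h
      · refine h3.le.trans (hA.le_dsol h8.1 h8.2 (hxa.trans hxb) ?_ (Ioo_subset_Icc_self h4))
        exact (Ioo_subset_Ioo h1.le h2.le).trans (h9 h)
      · rcases le_or_gt 0 (σ * (x - z.1)) with h0 | h0
        · have := Hδ x (kav A F a₁ b₁) z.1 (by simpa using hδ) (by simpa using hδ) h6 h0
          rw [h, hc₁.dsol_eq hA hXo hXb (h5 h0), ← hA.prof_side hσ hc₁.lt]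
          exact this
        · exact (mul_nonpos_of_nonneg_of_nonpos hq0.le h0.le).trans h7)
    refine absurd hcon (not_le.2 (hV.pos _ _ ?_))
    rcases hσ with h | h <;> rw [h] <;> simp [hq0.ne']

/-- A subflow stays inside of an evolution with accelerated time, with a margin `ρ`. -/
theorem compare_sub (hA : CoefBounds A F m M) (hV : VelBounds V C) (hK : 0 < K) {s₀ L : ℝ}
    {S : ℝ → Set ℝ} (hS : Gen A F V ℓ N K s₀ L S) {c c' Lv : ℝ}
    (hc : SpeedBounds A F V ℓ (N * Real.exp (K * L)) c c')
    (hLv : ∀ a b a' b', a < b → a' < b' → |a| ≤ N * Real.exp (K * L) →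
      |b| ≤ N * Real.exp (K * L) → |a'| ≤ N * Real.exp (K * L) → |b'| ≤ N * Real.exp (K * L) →
      |vL A F V a b - vL A F V a' b'| ≤ Lv * (|a - a'| + |b - b'|) ∧
      |vR A F V a b - vR A F V a' b'| ≤ Lv * (|a - a'| + |b - b'|))
    {s T : ℝ} {X : ℝ → Set ℝ}
    (hX : LinSub A F V s T X) (hXe : IsOpenEvolution s T X) {s' κ ρ : ℝ} (hs' : s₀ ≤ s')
    (hκ : 0 < κ) (hρ : 0 < ρ) (hρκ : Lv * (2 * ρ) < κ * c)
    (h0 : Metric.cthickening ρ (X s) ⊆ S s') {b : ℝ} (hbT : b < T)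
    (hbL : s' + (1 + κ) * (b - s) < L) :
    ∀ t ∈ Icc s b, Metric.cthickening ρ (X t) ⊆ S (s' + (1 + κ) * (t - s)) := by
  have hk0 : 0 < 1 + κ := by linarith
  have hθ : ∀ t ∈ Icc s b, s' + (1 + κ) * (t - s) ∈ Ico s₀ L := fun t ht => by
    have h1 : 0 ≤ (1 + κ) * (t - s) := mul_nonneg hk0.le (sub_nonneg.2 ht.1)
    have h2 : (1 + κ) * (t - s) ≤ (1 + κ) * (b - s) := by gcongr; exact ht.2
    exact ⟨by linarith, by linarith⟩
  refine forward_induction (by simpa using h0) (fun t ht hP => ?_) (fun t ht hP => ?_)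
  · have htT : t ∈ Ico s T := ⟨ht.1, ht.2.trans hbT⟩
    have hθt := hθ t ⟨ht.1, ht.2.le⟩
    have hQ : IsCompact (Metric.cthickening ρ (X t)) := by
      rw [← Metric.cthickening_closure]
      exact (hXe.bdd t htT).isCompact_closure.cthickening
    obtain ⟨ε, hε, hεs⟩ := hQ.exists_cthickening_subset_open (hS.isOpen hθt) hP
    have e2 : ∀ᶠ τ in 𝓝[>] t, τ ∈ Ioo t b := Ioo_mem_nhdsGT ht.2
    filter_upwards [hXe.rusc t htT ε hε, e2] with τ h1 h2
    have h3 : (1 + κ) * (t - s) ≤ (1 + κ) * (τ - s) := by gcongr; exact h2.1.le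
    refine Subset.trans ?_ (hεs.trans (hS.mono _ _ hθt.1 (by linarith)
      (hθ τ ⟨ht.1.trans h2.1.le, h2.2.le⟩).2))
    rw [cthickening_cthickening hε.le hρ.le, add_comm, ← cthickening_cthickening hρ.le hε.le]
    exact Metric.cthickening_subset_of_subset _ (h1.trans (Metric.thickening_subset_cthickening _ _))
  have htT : t ∈ Ioo s T := ⟨ht.1, ht.2.trans_lt hbT⟩
  have htT' : t ∈ Ico s T := ⟨ht.1.le, htT.2⟩
  have hθt := hθ t ⟨ht.1.le, ht.2⟩
  set r := s' + (1 + κ) * (t - s) with hr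
  have hr0 : s₀ < r := by
    have := mul_pos hk0 (sub_pos.2 ht.1); linarith
  obtain ⟨s'', hs'', ι, _, α, β, hf⟩ := hS.left r ⟨hr0, hθt.2⟩
  have hrr : r ∈ Icc s'' r := right_mem_Icc.2 hs''.2.le
  have hIcc : ∀ᶠ u in 𝓝[≤] r, u ∈ Icc s'' r := Icc_mem_nhdsLE hs''.2
  have tl := time_tendsto_left (s := s) (s' := s') (t := t) hk0
  -- inclusion with margin, up to and including the time of contact
  have hmarg : ∀ τ ∈ Icc s t, ∀ y ∈ X τ, ∀ u, |u - y| ≤ ρ → u ∈ S (s' + (1 + κ) * (τ - s)) := by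
    intro τ hτ y hy u hu
    have hcl : ∀ {Y : Set ℝ}, y ∈ Y → u ∈ Metric.cthickening ρ Y := fun hY =>
      Metric.closedBall_subset_cthickening hY ρ (by rwa [Metric.mem_closedBall, Real.dist_eq])
    -- At the contact time itself, openness in space-time puts the point y of X τ into slightly
    -- earlier slices; then S is monotone in time.
    rcases lt_or_eq_of_le hτ.2 with h | rfl
    · exact hP τ ⟨hτ.1, h⟩ (hcl hy)
    · have h1 := (hXe.eventually_mem htT' hy).filter_mono
        (nhdsWithin_mono τ (fun v (hv : v ∈ Icc s τ) => hv.1))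
      have h2 : ∀ᶠ v in 𝓝[<] τ, y ∈ X v := by
        filter_upwards [(nhdsWithin_Icc_eq_nhdsLE ht.1 ▸ h1).filter_mono
          (nhdsWithin_mono τ Iio_subset_Iic_self)] with v hv using hv
      obtain ⟨v, hv, hv2⟩ := (h2.and (Ioo_mem_nhdsLT ht.1)).exists
      have h3 : (1 + κ) * (v - s) ≤ (1 + κ) * (τ - s) := by gcongr; exact hv2.2.le
      exact hS.mono _ _ (hθ v ⟨hv2.1.le, hv2.2.le.trans ht.2⟩).1 (by linarith) hθt.2
        (hP v ⟨hv2.1.le, hv2.2⟩ (hcl hv))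
  -- The margin keeps points of X at distance more than ρ from the ends of the intervals. Finiteness
  -- of the family passes this to closures, with closed shrunk intervals.
  have hcov : ∀ τ ∈ Icc s t, s' + (1 + κ) * (τ - s) ∈ Icc s'' r → ∀ y ∈ closure (X τ), ∃ i,
      α i (s' + (1 + κ) * (τ - s)) + ρ < β i (s' + (1 + κ) * (τ - s)) - ρ ∧
      y ∈ Icc (α i (s' + (1 + κ) * (τ - s)) + ρ) (β i (s' + (1 + κ) * (τ - s)) - ρ) := by
    intro τ hτ hτr y hy
    have h1 : X τ ⊆ ⋃ i, Ioo (α i (s' + (1 + κ) * (τ - s)) + ρ) (β i (s' + (1 + κ) * (τ - s)) - ρ) := by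
      intro u hu
      have h2 := hmarg τ hτ u hu u (by simpa using hρ.le)
      rw [hf.eq _ hτr, mem_iUnion] at h2
      obtain ⟨i, hi⟩ := h2
      have hcc := hf.isComp hτr i
      refine mem_iUnion.2 ⟨i, ?_, ?_⟩
      · by_contra hlt
        refine hcc.left (hmarg τ hτ u hu _ ?_)
        rw [abs_le]; constructor <;> linarith [hi.1]
      · by_contra hlt
        refine hcc.right (hmarg τ hτ u hu _ ?_)
        rw [abs_le]; constructor <;> linarith [hi.2]
    have h2 := closure_mono h1 hy
    rw [closure_iUnion_of_finite, mem_iUnion] at h2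
    obtain ⟨i, hi⟩ := h2
    refine ⟨i, ?_, closure_minimal Ioo_subset_Icc_self isClosed_Icc hi⟩
    by_contra hlt
    rw [Ioo_eq_empty hlt, closure_empty] at hi
    exact hi
  -- the contact point
  rw [Metric.cthickening_eq_biUnion_closedBall _ hρ.le]
  refine iUnion₂_subset fun x hx z hz => ?_
  by_contra hzn
  rw [Metric.mem_closedBall, Real.dist_eq] at hz
  obtain ⟨i, hlt, hxi⟩ := hcov t ⟨ht.1.le, le_rfl⟩ hrr x hx
  have hxX : x ∉ X t := fun h => hzn (hmarg t ⟨ht.1.le, le_rfl⟩ x h z hz)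
  have hci := hf.isComp hrr i
  rw [← hr] at hlt hxi
  set a := α i r with ha
  set b' := β i r with hb'
  rw [abs_le] at hz
  obtain ⟨σ, hσ, hxσ⟩ : ∃ σ : ℝ, (σ = 1 ∨ σ = -1) ∧ side σ (a + ρ) (b' - ρ) = x := by
    rcases eq_or_lt_of_le hxi.1 with h1 | h1
    · exact ⟨-1, Or.inr rfl, by rw [side_neg_one, h1]⟩
    rcases eq_or_lt_of_le hxi.2 with h2 | h2
    · exact ⟨1, Or.inl rfl, by rw [side_one, h2]⟩
    · exact absurd (hci.sub ⟨by linarith, by linarith⟩) hzn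
  have cα : ContinuousWithinAt (α i) (Iic r) r :=
    (HasDerivWithinAt.iic_of_Icc hs''.2 ((hf.traj i).left r hrr)).continuousWithinAt
  have cβ : ContinuousWithinAt (β i) (Iic r) r :=
    (HasDerivWithinAt.iic_of_Icc hs''.2 ((hf.traj i).right r hrr)).continuousWithinAt
  have cα' : ContinuousWithinAt (fun τ => α i (s' + (1 + κ) * (τ - s)) + ρ) (Iic t) t :=
    (cα.tendsto.comp tl).add_const ρ
  have cβ' : ContinuousWithinAt (fun τ => β i (s' + (1 + κ) * (τ - s)) - ρ) (Iic t) t :=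
    (cβ.tendsto.comp tl).sub_const ρ
  have hside : ∀ u v, side σ (u + ρ) (v - ρ) = side σ u v - σ * ρ := fun u v => by
    rcases hσ with rfl | rfl <;> simp
  have hder := time_hasDeriv (s := s) (s' := s') (t := t) hk0
    (HasDerivWithinAt.iic_of_Icc hs''.2 ((hf.traj i).hasDeriv_side hσ hrr))
  -- The barrier is the profile on the interval shrunk by ρ. Its ends move with the accelerated
  -- speed of the full interval, while its slopes are those of the shrunk one.
  have hcon := contact_sub hA hV hX htT hx hxX hσ
    (e := fun τ => side σ (α i (s' + (1 + κ) * (τ - s)) + ρ) (β i (s' + (1 + κ) * (τ - s)) - ρ))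
    (kk := fun τ => kav A F (α i (s' + (1 + κ) * (τ - s)) + ρ) (β i (s' + (1 + κ) * (τ - s)) - ρ))
    (w := (1 + κ) * spd A F V (side σ a b') (kav A F a b'))
    (by
      simp only [hside]
      exact (hder.sub_const (σ * ρ)).congr_deriv (by ring))
    hxσ (hA.continuousWithinAt_kav cα' cβ' hlt)
    (by rw [← hxσ]; exact hA.slope_side_pos hσ hlt) (by
      have hm : MapsTo Prod.snd {z : ℝ × ℝ | z.2 ≤ t ∧ z.1 ∈ closure (X z.2)} (Iic t) :=
        fun z hz => hz.1
      have e1 : ∀ᶠ z in 𝓝[{z : ℝ × ℝ | z.2 ≤ t ∧ z.1 ∈ closure (X z.2)}] (x, t), |z.1 - x| < ρ :=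
        Metric.tendsto_nhds.1 (continuous_fst.continuousWithinAt (x := (x, t))) ρ hρ
      filter_upwards [e1, eventually_snd (x := x) hm (tl.eventually hIcc),
        eventually_snd (x := x) hm (Icc_mem_nhdsLE ht.1), self_mem_nhdsWithin] with z h1 h2 h3 h4
      set τ := z.2 with hτ
      set y := z.1 with hy
      obtain ⟨j, hj1, hj2⟩ := hcov τ h3 h2 y h4.2
      have hmon := (hf.traj j).monotone hA hV h2 hrr h2.2
      -- Points near x cannot lie in another shrunk interval, since distinct shrunk intervals are at
      -- least 2ρ apart at the contact time and grow until then.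
      have hji : j = i := by
        by_contra hne
        rw [abs_lt] at h1
        rcases hf.disj r hrr j i hne with h | h <;> linarith [hj2.1, hj2.2, hxi.1, hxi.2]
      subst hji
      refine ⟨?_, ?_⟩
      · rcases hσ with rfl | rfl
        · rw [side_one]; linarith [hj2.2]
        · rw [side_neg_one]; linarith [hj2.1]
      · have hτT : τ ∈ Ico s T := ⟨h3.1, h3.2.trans_lt htT.2⟩
        rw [hA.prof_side hσ hj1]
        refine hA.dsol_le (hXe.isOpen hτT) (hXe.bdd τ hτT) hj1 hj2 fun a' b'' hc' hy' => ?_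
        have hcj := hf.isComp h2 j
        constructor
        · by_contra hlt'
          refine hcj.left (hmarg τ h3 _ (hc'.sub ⟨not_le.1 hlt', hj2.1.trans_lt hy'.2⟩) _ ?_)
          rw [abs_le]; constructor <;> linarith
        · by_contra hlt'
          refine hcj.right (hmarg τ h3 _ (hc'.sub ⟨hy'.1.trans_le hj2.2, not_le.1 hlt'⟩) _ ?_)
          rw [abs_le]; constructor <;> linarith)
  have hcon' : (1 + κ) * spd A F V (side σ a b') (kav A F a b') ≤
      spd A F V x (kav A F (a + ρ) (b' - ρ)) := hcon
  have hadm := hf.adm r hrr i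
  obtain ⟨hba, hbb⟩ := hadm.bound hK hθt.2.le
  have hsp := (Gen.family_speed hK hc hf hθt.2.le i hrr).1
  have hin : ∀ u, a ≤ u → u ≤ b' → |u| ≤ N * Real.exp (K * L) := fun u h1 h2 => by
    rw [abs_le] at *
    exact ⟨hba.1.trans h1, h2.trans hbb.2⟩
  have hlip := hLv (a + ρ) (b' - ρ) a b' hlt hci.lt (hin _ (by linarith) (by linarith))
    (hin _ (by linarith) (by linarith)) hba hbb
  have hd : |a + ρ - a| + |b' - ρ - b'| = 2 * ρ := by
    rw [add_sub_cancel_left, sub_sub_cancel_left, abs_neg, abs_of_pos hρ]; ring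
  rw [hd] at hlip
  -- Here v₀ is the speed for the full interval and v₁ that for the shrunk one: acceleration gains κ
  -- v₀ ≥ κ c, more than the Lipschitz error.
  have key : ∀ v₀ v₁ : ℝ, c ≤ v₀ → |v₁ - v₀| ≤ Lv * (2 * ρ) → (1 + κ) * v₀ ≤ v₁ → False := by
    intro v₀ v₁ h1 h2 h3
    have := (abs_le.1 h2).2
    have := mul_le_mul_of_nonneg_left h1 hκ.le
    linarith
  rw [← hxσ] at hcon'
  rcases hσ with rfl | rfl
  · rw [side_one, side_one] at hcon'
    exact key _ _ hsp.2 hlip.2 hcon'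
  · rw [side_neg_one, side_neg_one] at hcon'
    exact key _ _ hsp.1 hlip.1 hcon'

end HeleShaw

/-! ### Ordering of evolutions and approximation by finite unions -/

namespace HeleShaw

variable {A F : ℝ → ℝ} {V : ℝ → ℝ → ℝ} {m M C ℓ N K : ℝ}

lemma Gen.linSuper (hA : CoefBounds A F m M) (hV : VelBounds V C) (hK : 0 < K) {s L : ℝ}
    {S : ℝ → Set ℝ} (h : Gen A F V ℓ N K s L S) : LinSuper A F V s L S := by
  intro t ht x _ hx σ q v hσ hq H
  have hφ : HasFDerivAt (fun z : ℝ × ℝ => q * (σ * (x - z.1) - v * (t - z.2)))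
      (q • (σ • (-ContinuousLinearMap.fst ℝ ℝ ℝ) - v • (-ContinuousLinearMap.snd ℝ ℝ ℝ))) (x, t) :=
    (((hasFDerivAt_fst.const_sub x).const_mul σ).sub
      ((hasFDerivAt_snd.const_sub t).const_mul v)).const_mul q
  have hσ0 : σ ≠ 0 := by rcases hσ with rfl | rfl <;> norm_num
  have key := h.super_ineq hA hV hK ht hx hφ
    (by simpa using ⟨hq.ne', hσ0⟩) (by simpa using H)
  have e1 : (q • (σ • (-ContinuousLinearMap.fst ℝ ℝ ℝ) - v • (-ContinuousLinearMap.snd ℝ ℝ ℝ)))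
      ((1 : ℝ), (0 : ℝ)) = -σ * q := by simp; ring
  have e2 : (q • (σ • (-ContinuousLinearMap.fst ℝ ℝ ℝ) - v • (-ContinuousLinearMap.snd ℝ ℝ ℝ)))
      ((0 : ℝ), (1 : ℝ)) = q * v := by simp
  rw [e1, e2, abs_mul, abs_neg, abs_sign hσ, one_mul, abs_of_pos hq, mul_comm] at key
  exact le_of_mul_le_mul_left key hq

lemma Gen.restrict {s s' L : ℝ} {S : ℝ → Set ℝ} (h : Gen A F V ℓ N K s L S) (hs : s ≤ s') :
    Gen A F V ℓ N K s' L S where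
  opn t ht x hx := (h.opn t ⟨hs.trans ht.1, ht.2⟩ x hx).filter_mono
    (nhdsWithin_mono _ fun _ hz => hs.trans hz)
  mono t t' h1 := h.mono t t' (hs.trans h1)
  rusc t ht := h.rusc t ⟨hs.trans ht.1, ht.2⟩
  left t ht := by
    obtain ⟨r, hr, ι, hι, α, β, hf⟩ := h.left t ⟨hs.trans_lt ht.1, ht.2⟩
    exact ⟨max r s', ⟨le_max_right _ _, max_lt hr.2 ht.1⟩, ι, hι, α, β,
      hf.restrict (Icc_subset_Icc_left (le_max_left _ _))⟩

lemma Gen.eventually_mem {s L t x : ℝ} {S : ℝ → Set ℝ} (h : Gen A F V ℓ N K s L S)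
    (ht : t ∈ Ico s L) (hx : x ∈ S t) : ∀ᶠ τ in 𝓝[Ici s] t, x ∈ S τ := by
  have h2 : Tendsto (fun τ : ℝ => (x, τ)) (𝓝[Ici s] t) (𝓝[{z : ℝ × ℝ | s ≤ z.2}] (x, t)) :=
    (Continuous.continuousWithinAt (by fun_prop)).tendsto_nhdsWithin fun τ hτ => hτ
  exact h2.eventually (h.opn t ht x hx)

/-- Strict ordering at the initial time is preserved weakly. -/
lemma Gen.subset_super (hA : CoefBounds A F m M) (hV : VelBounds V C) (hK : 0 < K) {s₀ L : ℝ}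
    {S : ℝ → Set ℝ} (hS : Gen A F V ℓ N K s₀ L S) {s T : ℝ} {X : ℝ → Set ℝ}
    (hX : LinSuper A F V s T X) (hXe : IsOpenEvolution s T X) {s' : ℝ} (hs' : s₀ ≤ s')
    (h0 : closure (S s') ⊆ X s) {t : ℝ} (hst : s ≤ t) (htT : t < T) (hL : s' + (t - s) < L) :
    S (s' + (t - s)) ⊆ X t := by
  intro x hx
  have h1 := hS.eventually_mem ⟨by linarith, hL⟩ hx
  have h2 : Tendsto (fun k : ℝ => s' + k * (t - s)) (𝓝[Ioo 0 1] 1)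
      (𝓝[Ici s₀] (s' + (t - s))) := by
    have : ContinuousWithinAt (fun k : ℝ => s' + k * (t - s)) (Ioo 0 1) 1 :=
      Continuous.continuousWithinAt (by fun_prop)
    have := this.tendsto_nhdsWithin (t := Ici s₀) fun k hk => by
      have : 0 ≤ k * (t - s) := mul_nonneg hk.1.le (by linarith)
      simp only [mem_Ici]; linarith
    simpa using this
  have hne : (𝓝[Ioo (0 : ℝ) 1] 1).NeBot := by
    rw [nhdsWithin_Ioo_eq_nhdsLT one_pos]; infer_instance
  -- The limit k → 1 is avoided: by openness in time, x already belongs to the slowed evolution for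
  -- some k < 1.
  obtain ⟨k, hk, hk'⟩ := ((h2.eventually h1).and self_mem_nhdsWithin).exists
  refine compare_super hA hV hK hS hX hXe hs' hk'.1 hk'.2 h0 htT ?_ t
    ⟨hst, le_rfl⟩ (subset_closure hk)
  have : k * (t - s) ≤ 1 * (t - s) := mul_le_mul_of_nonneg_right hk'.2.le (by linarith)
  linarith

lemma Gen.subset_gen (hA : CoefBounds A F m M) (hV : VelBounds V C) (hK : 0 < K) {s₁ s₂ L : ℝ}
    {S₁ S₂ : ℝ → Set ℝ} (h₁ : Gen A F V ℓ N K s₁ L S₁) (h₂ : Gen A F V ℓ N K s₂ L S₂)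
    {s' : ℝ} (hs' : s₁ ≤ s') {t : ℝ} (hst : s₂ ≤ t) (htL : t < L) (hL : s' + (t - s₂) < L)
    (h0 : closure (S₁ s') ⊆ S₂ s₂) : S₁ (s' + (t - s₂)) ⊆ S₂ t :=
  h₁.subset_super hA hV hK (h₂.linSuper hA hV hK) (h₂.isOpenEvolution hK) hs' h0 hst htL hL

lemma IsComp.disjoint {U : Set ℝ} {p q : ℝ × ℝ} (hp : IsComp U p.1 p.2) (hq : IsComp U q.1 q.2)
    (hpq : p ≠ q) : p.2 ≤ q.1 ∨ q.2 ≤ p.1 := by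
  by_contra! h
  obtain ⟨x, hx⟩ := exists_between (max_lt (lt_min hp.lt h.2) (lt_min h.1 hq.lt))
  simp only [max_lt_iff, lt_min_iff] at hx
  exact hpq (Prod.ext (hp.eq_left hq ⟨hx.1.1, hx.2.1⟩ ⟨hx.1.2, hx.2.2⟩)
    (hp.eq_right hq ⟨hx.1.1, hx.2.1⟩ ⟨hx.1.2, hx.2.2⟩))

/-- A bounded open set with components that are not too short has finitely many of them. -/
lemma exists_finset_isComp {U : Set ℝ} (hU : IsOpen U) (hb : Bornology.IsBounded U) {d : ℝ}
    (hd : 0 < d) (h : ∀ a b, IsComp U a b → d ≤ b - a) :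
    ∃ f : Finset (ℝ × ℝ), (∀ p ∈ f, IsComp U p.1 p.2) ∧ U = ⋃ p ∈ f, Ioo p.1 p.2 := by
  obtain ⟨R, hR⟩ := hb.subset_closedBall 0
  rw [Real.closedBall_eq_Icc, zero_sub, zero_add] at hR
  have hfin : {p : ℝ × ℝ | IsComp U p.1 p.2}.Finite := by
    -- Components of length at least d have left endpoints at distance at least d, so the integer
    -- parts of a/d are distinct.
    refine Finite.of_finite_image (f := fun p : ℝ × ℝ => ⌊p.1 / d⌋)
      ((finite_Icc ⌊-R / d⌋ ⌊R / d⌋).subset ?_) ?_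
    · rintro _ ⟨p, hp, rfl⟩
      have h1 := IsComp.mem_Icc_bound hp hR
      have h2 := IsComp.lt hp
      refine ⟨Int.floor_mono ?_, Int.floor_mono ?_⟩
      · exact div_le_div_of_nonneg_right h1.1 hd.le
      · exact div_le_div_of_nonneg_right (h2.le.trans h1.2) hd.le
    · intro p hp q hq hpq
      by_contra hne
      have h1 := Int.abs_sub_lt_one_of_floor_eq_floor hpq
      rw [← sub_div, abs_div, abs_of_pos hd, div_lt_one hd, abs_lt] at h1
      rcases IsComp.disjoint hp hq hne with h2 | h2
      · linarith [h p.1 p.2 hp]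
      · linarith [h q.1 q.2 hq]
  refine ⟨hfin.toFinset, fun p hp => by simpa using hp, ?_⟩
  ext x
  simp only [Finite.mem_toFinset, mem_ofPred_eq, mem_iUnion, exists_prop, Prod.exists]
  refine ⟨fun hx => exists_isComp hU hb hx, ?_⟩
  rintro ⟨a, b, hc, hx⟩
  exact hc.sub hx

/-- Compact subsets of an open set are contained in finitely many shrunk components. -/
lemma exists_finset_cover {U : Set ℝ} (hU : IsOpen U) (hb : Bornology.IsBounded U)
    (hℓ : ∀ a b, IsComp U a b → ℓ < b - a) {R : ℝ} (hR : U ⊆ Icc (-R) R) {Q : Set ℝ}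
    (hQ : IsCompact Q) (hQU : Q ⊆ U) : ∃ f : Finset (ℝ × ℝ),
      (∀ p ∈ f, p.1 < p.2 ∧ ℓ ≤ p.2 - p.1 ∧ |p.1| ≤ R ∧ |p.2| ≤ R) ∧
      (∀ p ∈ f, ∀ q ∈ f, p ≠ q → p.2 ≤ q.1 ∨ q.2 ≤ p.1) ∧
      (∀ p ∈ f, Icc p.1 p.2 ⊆ U) ∧ Q ⊆ ⋃ p ∈ f, Ioo p.1 p.2 := by
  classical
  obtain ⟨δ, hδ, hδU⟩ := hQ.exists_thickening_subset_open hU hQU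
  obtain ⟨u, hu⟩ := hQ.elim_finite_subcover
    (fun p : {p : ℝ × ℝ // IsComp U p.1 p.2} => Ioo p.1.1 p.1.2) (fun _ => isOpen_Ioo)
    (fun x hx => by
      obtain ⟨a, b, hc, hx⟩ := exists_isComp hU hb (hQU hx)
      exact mem_iUnion.2 ⟨⟨(a, b), hc⟩, hx⟩)
  -- The shrinkage is less than the distance δ from Q to the complement of U, and small enough to
  -- keep length at least ℓ and a nonempty interval.
  set η : ℝ × ℝ → ℝ := fun p => min (δ / 2) (min ((p.2 - p.1 - ℓ) / 2) ((p.2 - p.1) / 4)) with hη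
  have hη0 : ∀ p : ℝ × ℝ, IsComp U p.1 p.2 → 0 < η p := fun p hp => by
    have := hp.lt; have := hℓ _ _ hp
    exact lt_min (by positivity) (lt_min (by linarith) (by linarith))
  have hη1 : ∀ p : ℝ × ℝ, η p < δ ∧ η p ≤ (p.2 - p.1 - ℓ) / 2 ∧ η p ≤ (p.2 - p.1) / 4 := fun p =>
    ⟨(min_le_left _ _).trans_lt (by linarith), (min_le_right _ _).trans (min_le_left _ _),
      (min_le_right _ _).trans (min_le_right _ _)⟩
  refine ⟨u.image fun p => (p.1.1 + η p.1, p.1.2 - η p.1), ?_, ?_, ?_, ?_⟩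
  · intro p hp
    obtain ⟨⟨p, hc⟩, -, rfl⟩ := Finset.mem_image.1 hp
    have h0 := hη0 p hc
    obtain ⟨-, h2, h3⟩ := hη1 p
    have h4 := hc.lt
    have h5 := hc.mem_Icc_bound hR
    refine ⟨by dsimp only; linarith, by dsimp only; linarith, ?_, ?_⟩ <;>
      rw [abs_le] <;> constructor <;> dsimp only <;> linarith
  · intro p hp q hq hpq
    obtain ⟨⟨p, hc⟩, -, rfl⟩ := Finset.mem_image.1 hp
    obtain ⟨⟨q, hc'⟩, -, rfl⟩ := Finset.mem_image.1 hq
    have h0 := hη0 p hc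
    have h1 := hη0 q hc'
    rcases hc.disjoint hc' (fun h => hpq (by simp [h])) with h | h
    · left; dsimp only; linarith
    · right; dsimp only; linarith
  · intro p hp
    obtain ⟨⟨p, hc⟩, -, rfl⟩ := Finset.mem_image.1 hp
    have h0 := hη0 p hc
    exact fun x hx => hc.sub ⟨by linarith [hx.1], by linarith [hx.2]⟩
  · intro x hx
    obtain ⟨⟨p, hc⟩, hp, hxp⟩ := mem_iUnion₂.1 (hu hx)
    refine mem_iUnion₂.2 ⟨_, Finset.mem_image_of_mem _ hp, ?_⟩
    have h1 := (hη1 p).1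
    have hfar : ∀ e ∉ U, δ ≤ |e - x| := fun e he => by
      by_contra! hlt
      exact he (hδU (Metric.mem_thickening_iff.2 ⟨x, hx, by rwa [Real.dist_eq]⟩))
    have h2 := hfar _ hc.left
    have h3 := hfar _ hc.right
    rw [abs_of_neg (by linarith [hxp.1])] at h2
    rw [abs_of_pos (by linarith [hxp.2])] at h3
    exact ⟨by dsimp only; linarith, by dsimp only; linarith⟩

/-! ### The maximal evolution -/

/-- The union of all generated evolutions that start from compact subsets of `U`. -/
def maxEvol (A F : ℝ → ℝ) (V : ℝ → ℝ → ℝ) (ℓ N K L : ℝ) (U : Set ℝ) (t : ℝ) : Set ℝ :=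
  {x | ∃ S, Gen A F V ℓ N K 0 L S ∧ closure (S 0) ⊆ U ∧ x ∈ S t}

section MaxEvol

variable {L R c c' : ℝ} {U : Set ℝ}

/-- The cover by shrunk components provides finitely many initial intervals around Q that are
compactly contained in U. Their strict excess of length over ℓ leaves room for the shrinkage. -/
lemma exists_gen_cover (hA : CoefBounds A F m M) (hV : VelBounds V C) (hK : 0 < K)
    (hgr : ∀ a b, a < b →
      |vL A F V a b| ≤ K * (1 + max |a| |b|) ∧ |vR A F V a b| ≤ K * (1 + max |a| |b|))
    (hL : 0 < L) (hU : IsOpen U) (hb : Bornology.IsBounded U)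
    (hℓ : ∀ a b, IsComp U a b → ℓ < b - a) (hR : U ⊆ Icc (-R) R) (hN : 1 + R ≤ N)
    {Q : Set ℝ} (hQ : IsCompact Q) (hQU : Q ⊆ U) :
    ∃ S, Gen A F V ℓ N K 0 L S ∧ closure (S 0) ⊆ U ∧ Q ⊆ S 0 := by
  obtain ⟨f, h1, h2, h3, h4⟩ := exists_finset_cover hU hb hℓ hR hQ hQU
  obtain ⟨S, hS0, hS⟩ := exists_gen (ℓ := ℓ) (N := N) hA hV hK hgr (L := L) f.card f 0 le_rfl hL.le
    (fun p hp => ⟨(h1 p hp).1, (h1 p hp).2.1, by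
      have := max_le (h1 p hp).2.2.1 (h1 p hp).2.2.2
      simp only [mul_zero, Real.exp_zero, mul_one]; linarith⟩) h2
  refine ⟨S, hS, ?_, hS0 ▸ h4⟩
  rw [hS0]
  refine (closure_minimal ?_ (f.finite_toSet.isClosed_biUnion fun p _ => isClosed_Icc)).trans
    (iUnion₂_subset h3)
  exact iUnion₂_mono fun p _ => Ioo_subset_Icc_self

lemma mono_maxEvol {t t' : ℝ} (ht : 0 ≤ t) (htt : t ≤ t') (hL : t' < L) :
    maxEvol A F V ℓ N K L U t ⊆ maxEvol A F V ℓ N K L U t' :=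
  fun _ ⟨S, hS, h0, hx⟩ => ⟨S, hS, h0, hS.mono t t' ht htt hL hx⟩

lemma opn_maxEvol {t x : ℝ} (ht : t ∈ Ico 0 L) (hx : x ∈ maxEvol A F V ℓ N K L U t) :
    ∀ᶠ z in 𝓝[{z : ℝ × ℝ | 0 ≤ z.2}] (x, t), z.1 ∈ maxEvol A F V ℓ N K L U z.2 := by
  obtain ⟨S, hS, h0, hx⟩ := hx
  filter_upwards [hS.opn t ht x hx] with z hz using ⟨S, hS, h0, hz⟩

lemma isOpen_maxEvol {t : ℝ} (ht : t ∈ Ico 0 L) : IsOpen (maxEvol A F V ℓ N K L U t) := by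
  rw [isOpen_iff_mem_nhds]
  rintro x ⟨S, hS, h0, hx⟩
  filter_upwards [(hS.isOpen ht).mem_nhds hx] with y hy using ⟨S, hS, h0, hy⟩

lemma bounded_maxEvol (hK : 0 < K) {t : ℝ} (ht : t ∈ Ico 0 L) :
    Bornology.IsBounded (maxEvol A F V ℓ N K L U t) :=
  (Metric.isBounded_Icc _ _).subset fun _ ⟨_, hS, _, hx⟩ => hS.subset_Icc hK ht hx

lemma maxEvol_zero (h : ∀ Q : Set ℝ, IsCompact Q → Q ⊆ U →
    ∃ S, Gen A F V ℓ N K 0 L S ∧ closure (S 0) ⊆ U ∧ Q ⊆ S 0) :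
    maxEvol A F V ℓ N K L U 0 = U := by
  ext x
  refine ⟨fun ⟨S, _, h0, hx⟩ => h0 (subset_closure hx), fun hx => ?_⟩
  obtain ⟨S, hS, h0, hQ⟩ := h {x} isCompact_singleton (singleton_subset_iff.2 hx)
  exact ⟨S, hS, h0, hQ rfl⟩

/-- The competitors form a directed family: one that starts around the closures of two given initial
sets contains both evolutions later, by comparison. Hence a single competitor covers a compact set.
-/
lemma exists_gen_of_compact (hA : CoefBounds A F m M) (hV : VelBounds V C) (hK : 0 < K)
    (h : ∀ Q : Set ℝ, IsCompact Q → Q ⊆ U →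
      ∃ S, Gen A F V ℓ N K 0 L S ∧ closure (S 0) ⊆ U ∧ Q ⊆ S 0)
    {t : ℝ} (ht : t ∈ Ico 0 L) {Q : Set ℝ} (hQ : IsCompact Q)
    (hQt : Q ⊆ maxEvol A F V ℓ N K L U t) :
    ∃ S, Gen A F V ℓ N K 0 L S ∧ closure (S 0) ⊆ U ∧ Q ⊆ S t := by
  have h0L : (0 : ℝ) ∈ Ico 0 L := ⟨le_rfl, ht.1.trans_lt ht.2⟩
  have hne : Nonempty {S // Gen A F V ℓ N K 0 L S ∧ closure (S 0) ⊆ U} := by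
    obtain ⟨S, hS, h0, -⟩ := h ∅ isCompact_empty (empty_subset _)
    exact ⟨S, hS, h0⟩
  obtain ⟨⟨S, hS, h0⟩, hi⟩ := hQ.elim_directed_cover
    (fun S : {S // Gen A F V ℓ N K 0 L S ∧ closure (S 0) ⊆ U} => S.1 t)
    (fun S => S.2.1.isOpen ht)
    (fun x hx => by
      obtain ⟨S, hS, h0, hx⟩ := hQt hx
      exact mem_iUnion.2 ⟨⟨S, hS, h0⟩, hx⟩)
    (by
      rintro ⟨S₁, h1, h1'⟩ ⟨S₂, h2, h2'⟩
      obtain ⟨S, hS, h0, hQ⟩ := h (closure (S₁ 0) ∪ closure (S₂ 0))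
        ((h1.bounded hK h0L).isCompact_closure.union (h2.bounded hK h0L).isCompact_closure)
        (union_subset h1' h2')
      refine ⟨⟨S, hS, h0⟩, ?_, ?_⟩
      · simpa using h1.subset_gen hA hV hK hS le_rfl ht.1 ht.2 (by simpa using ht.2)
          (subset_union_left.trans hQ)
      · simpa using h2.subset_gen hA hV hK hS le_rfl ht.1 ht.2 (by simpa using ht.2)
          (subset_union_right.trans hQ))
  exact ⟨S, hS, h0, hi⟩

/-- After a positive time, the maximal evolution is generated by finitely many intervals. -/
lemma exists_gen_eq_maxEvol (hA : CoefBounds A F m M) (hV : VelBounds V C) (hK : 0 < K)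
    (hgr : ∀ a b, a < b →
      |vL A F V a b| ≤ K * (1 + max |a| |b|) ∧ |vR A F V a b| ≤ K * (1 + max |a| |b|))
    (hc0 : 0 < c) (hc : SpeedBounds A F V ℓ (N * Real.exp (K * L)) c c')
    (h : ∀ Q : Set ℝ, IsCompact Q → Q ⊆ U →
      ∃ S, Gen A F V ℓ N K 0 L S ∧ closure (S 0) ⊆ U ∧ Q ⊆ S 0) {δ : ℝ} (hδ : δ ∈ Ioo 0 L) :
    ∃ S, Gen A F V ℓ N K δ L S ∧ ∀ t ∈ Ico δ L, S t = maxEvol A F V ℓ N K L U t := by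
  set X := maxEvol A F V ℓ N K L U with hX
  have hδ' : δ ∈ Ico 0 L := ⟨hδ.1.le, hδ.2⟩
  have hbd : ∀ x ∈ X δ, ∃ a b, x ∈ Ioo a b ∧ Ioo a b ⊆ X δ ∧ Adm ℓ N K δ a b := by
    rintro x ⟨S, hS, h0, hx⟩
    obtain ⟨s', hs', ι, _, α, β, hf⟩ := hS.left δ hδ
    have hδs := right_mem_Icc.2 hs'.2.le
    rw [hf.eq δ hδs] at hx
    obtain ⟨i, hi⟩ := mem_iUnion.1 hx
    exact ⟨_, _, hi, fun y hy => ⟨S, hS, h0, (hf.isComp hδs i).sub hy⟩, hf.adm δ hδs i⟩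
  have hXR : X δ ⊆ Icc (-(N * Real.exp (K * δ) - 1)) (N * Real.exp (K * δ) - 1) := by
    intro x hx
    obtain ⟨a, b, h1, -, h2⟩ := hbd x hx
    have h3 := h2.2
    have h4 := neg_abs_le a
    have h5 := le_abs_self b
    have h6 := le_max_left |a| |b|
    have h7 := le_max_right |a| |b|
    exact ⟨by linarith [h1.1], by linarith [h1.2]⟩
  have hadm : ∀ a b, IsComp (X δ) a b → a < b ∧ Adm ℓ N K δ a b := by
    intro a b hab
    obtain ⟨x, hx⟩ := exists_between hab.lt
    obtain ⟨a', b', h1, h2, h3⟩ := hbd x (hab.sub hx)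
    have h4 := hab.le_left h2 hx h1
    have h5 := hab.le_right h2 hx h1
    have h6 := hab.mem_Icc_bound hXR
    have h7 := hab.lt
    refine ⟨hab.lt, by linarith [h3.1], ?_⟩
    have : max |a| |b| ≤ N * Real.exp (K * δ) - 1 :=
      max_le (abs_le.2 ⟨by linarith, by linarith⟩) (abs_le.2 ⟨by linarith, by linarith⟩)
    linarith
  -- Each component at time δ contains a point already present at time 0 in some competitor, and
  -- with it the ball of radius cδ around this point.
  have hlen : ∀ a b, IsComp (X δ) a b → 2 * (c * δ) ≤ b - a := by
    intro a b hab
    obtain ⟨x, hx⟩ := exists_between hab.lt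
    obtain ⟨S, hS, h0, hxS⟩ := hab.sub hx
    obtain ⟨y, hy, hxy⟩ := hS.joined hA hV hK hc0 hc le_rfl hδ.1.le hδ.2 x hxS
    have hy' : y ∈ Ioo a b := by
      constructor <;> by_contra! hlt
      · exact hab.left ⟨S, hS, h0, hxy (mem_uIcc.2 (Or.inr ⟨hlt, hx.1.le⟩))⟩
      · exact hab.right ⟨S, hS, h0, hxy (mem_uIcc.2 (Or.inl ⟨hx.2.le, hlt⟩))⟩
    have hsub : Ioo (y - c * δ) (y + c * δ) ⊆ X δ := fun z hz =>
      ⟨S, hS, h0, hS.ball_subset hK hc0 hc le_rfl hδ.1.le hδ.2 y hy z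
        (by rw [sub_zero, abs_lt]; constructor <;> linarith [hz.1, hz.2])⟩
    have hcδ : 0 < c * δ := mul_pos hc0 hδ.1
    have hyy : y ∈ Ioo (y - c * δ) (y + c * δ) := ⟨by linarith, by linarith⟩
    linarith [hab.le_left hsub hy' hyy, hab.le_right hsub hy' hyy]
  obtain ⟨f, hf, hfX⟩ := exists_finset_isComp (isOpen_maxEvol hδ') (bounded_maxEvol hK hδ')
    (mul_pos two_pos (mul_pos hc0 hδ.1)) hlen
  obtain ⟨S, hS0, hS⟩ := exists_gen hA hV hK hgr (L := L) f.card f δ le_rfl hδ.2.le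
    (fun p hp => hadm _ _ (hf p hp)) (fun p hp q hq hpq => (hf p hp).disjoint (hf q hq) hpq)
  rw [← hfX] at hS0
  refine ⟨S, hS, fun t ht => ?_⟩
  -- Openness in time allows a backward shift by a small σ. This buys the strict initial inclusion
  -- needed for comparison in either direction.
  have hsmall : ∀ {s : ℝ} {S' : ℝ → Set ℝ} {y : ℝ}, Gen A F V ℓ N K s L S' → s < t → y ∈ S' t →
      ∀ r > 0, ∃ σ ∈ Ioo 0 r, s ≤ t - σ ∧ y ∈ S' (t - σ) := by
    intro s S' y hS' hst hy r hr
    have h1 := hS'.eventually_mem ⟨hst.le, ht.2⟩ hy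
    have h2 : ∀ᶠ τ in 𝓝[<] t, y ∈ S' τ := by
      rw [← nhdsWithin_Ioo_eq_nhdsLT hst]
      exact h1.filter_mono (nhdsWithin_mono _ fun τ hτ => hτ.1.le)
    obtain ⟨τ, h3, h4⟩ := (h2.and (Ioo_mem_nhdsLT (max_lt hst (sub_lt_self t hr)))).exists
    have h5 := max_lt_iff.1 h4.1
    exact ⟨t - τ, ⟨sub_pos.2 h4.2, by linarith [h5.2]⟩, by linarith [h5.1], by simpa using h3⟩
  rcases eq_or_lt_of_le ht.1 with rfl | hδt
  · exact hS0
  refine Subset.antisymm (fun x hx => ?_) ?_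
  · obtain ⟨σ, hσ, hσδ, hxσ⟩ := hsmall hS hδt hx 1 one_pos
    have hcσ : 0 < c * σ := mul_pos hc0 hσ.1
    have ht' : δ + σ ∈ Ico 0 L := ⟨by linarith [hδ.1, hσ.1], by linarith [ht.2]⟩
    -- Points spread by cσ during time σ, which covers the closure. Comparing S from time δ with a
    -- competitor from time δ + σ yields one inclusion.
    have hcl : closure (X δ) ⊆ X (δ + σ) := by
      intro y hy
      obtain ⟨z, ⟨S', hS', h0, hz⟩, hyz⟩ := Metric.mem_closure_iff.1 hy _ hcσ
      exact ⟨S', hS', h0, hS'.ball_subset hK hc0 hc hδ.1.le (by linarith [hσ.1]) ht'.2 z hz y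
        (by rwa [add_sub_cancel_left, ← Real.dist_eq])⟩
    obtain ⟨S', hS', h0, hQ⟩ := exists_gen_of_compact hA hV hK h ht'
      (bounded_maxEvol hK hδ').isCompact_closure hcl
    have := hS.subset_gen hA hV hK (hS'.restrict ht'.1) le_rfl (t := t) (by linarith) ht.2
      (by linarith [ht.2, hσ.1]) (hS0 ▸ hQ)
    rw [show δ + (t - (δ + σ)) = t - σ by ring] at this
    exact ⟨S', hS', h0, this hxσ⟩
  · rintro x ⟨S', hS', h0, hx⟩
    obtain ⟨σ, hσ, -, hxσ⟩ := hsmall hS' (hδ.1.trans hδt) hx δ hδ.1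
    -- For the other inclusion, the competitor is started earlier by σ instead.
    have hcl : closure (S' (δ - σ)) ⊆ S δ := by
      intro y hy
      obtain ⟨z, hz, hyz⟩ := Metric.mem_closure_iff.1 hy _ (mul_pos hc0 hσ.1)
      rw [hS0]
      exact ⟨S', hS', h0, hS'.ball_subset hK hc0 hc (by linarith [hσ.2]) (by linarith [hσ.1]) hδ.2
        z hz y (by rwa [sub_sub_cancel, ← Real.dist_eq])⟩
    have := hS'.subset_gen hA hV hK hS (by linarith [hσ.2]) ht.1 ht.2
      (by linarith [ht.2, hσ.1]) hcl
    rw [show δ - σ + (t - δ) = t - σ by ring] at this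
    exact this hxσ

/-- At positive times the union is generated by finitely many intervals. Right upper semicontinuity,
including at time 0, follows from the common maximal speed c' of the competitors. -/
lemma gen_maxEvol (hA : CoefBounds A F m M) (hV : VelBounds V C) (hK : 0 < K)
    (hgr : ∀ a b, a < b →
      |vL A F V a b| ≤ K * (1 + max |a| |b|) ∧ |vR A F V a b| ≤ K * (1 + max |a| |b|))
    (hc0 : 0 < c) (hc0' : 0 ≤ c') (hc : SpeedBounds A F V ℓ (N * Real.exp (K * L)) c c')
    (h : ∀ Q : Set ℝ, IsCompact Q → Q ⊆ U →
      ∃ S, Gen A F V ℓ N K 0 L S ∧ closure (S 0) ⊆ U ∧ Q ⊆ S 0) :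
    Gen A F V ℓ N K 0 L (maxEvol A F V ℓ N K L U) where
  opn t ht x hx := opn_maxEvol ht hx
  mono t t' h0 h1 h2 := mono_maxEvol h0 h1 h2
  rusc t ht ε hε := by
    have h1 : ∀ᶠ τ in 𝓝[>] t, c' * (τ - t) + ε / 2 < ε := by
      refine nhdsWithin_le_nhds (Tendsto.eventually_lt_const (v := ε / 2) (by linarith) ?_)
      have : Continuous fun τ => c' * (τ - t) + ε / 2 := by fun_prop
      simpa using this.tendsto t
    filter_upwards [h1, Ioo_mem_nhdsGT ht.2] with τ h1 h2
    rintro x ⟨S, hS, h0, hx⟩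
    obtain ⟨y, hy, hxy⟩ := hS.near hK hc0' hc ht.1 h2.1.le h2.2 x hx (ε / 2) (by linarith)
    exact Metric.mem_thickening_iff.2 ⟨y, ⟨S, hS, h0, hy⟩, by rw [Real.dist_eq]; linarith⟩
  left t ht := by
    obtain ⟨S, hS, hSX⟩ := exists_gen_eq_maxEvol hA hV hK hgr hc0 hc h
      (δ := t / 2) ⟨by linarith [ht.1], by linarith [ht.1, ht.2]⟩
    obtain ⟨s', hs', ι, hι, α, β, hf⟩ := hS.left t ⟨by linarith [ht.1], ht.2⟩
    exact ⟨s', ⟨by linarith [ht.1, hs'.1], hs'.2⟩, ι, hι, α, β, hf.congr fun τ hτ =>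
      (hSX τ ⟨hs'.1.trans hτ.1, hτ.2.trans_lt ht.2⟩).symm⟩

end MaxEvol

end HeleShaw

/-! ### Viscosity flows and linear test functions -/

namespace HeleShaw

variable {A F : ℝ → ℝ} {V : ℝ → ℝ → ℝ} {m M C ℓ N K T : ℝ} {Ω : Set (ℝ × ℝ)}

lemma IsTestFunction.exists_hasFDerivAt {φ : ℝ → ℝ → ℝ} (h : IsTestFunction T φ) {x t : ℝ}
    (ht : t ∈ Ioo 0 T) : ∃ φ' : ℝ × ℝ →L[ℝ] ℝ,
      HasFDerivAt (fun z : ℝ × ℝ => φ z.1 z.2) φ' (x, t) ∧ φ' (1, 0) = dx φ x t ∧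
        φ' (0, 1) = dt φ x t := by
  have hnh : (univ ×ˢ Ioo 0 T : Set (ℝ × ℝ)) ∈ 𝓝 (x, t) :=
    (isOpen_univ.prod isOpen_Ioo).mem_nhds ⟨mem_univ _, ht⟩
  have key := hasStrictFDerivAt_uncurry_coprod (𝕜 := ℝ) (u := (x, t)) (f := φ)
    (f₁ := fun x t => ContinuousLinearMap.toSpanSingleton ℝ (dx φ x t))
    (f₂ := fun x t => ContinuousLinearMap.toSpanSingleton ℝ (dt φ x t))
    (by filter_upwards [hnh] with z hz using (h.diff_x z.1 z.2 hz.2).hasDerivAt.hasFDerivAt)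
    (by filter_upwards [hnh] with z hz using (h.diff_t z.1 z.2 hz.2).hasDerivAt.hasFDerivAt)
    ((ContinuousLinearMap.toSpanSingletonCLE (𝕜 := ℝ) (E := ℝ)).continuous.continuousAt.comp
      (h.cont_x.continuousAt hnh))
    ((ContinuousLinearMap.toSpanSingletonCLE (𝕜 := ℝ) (E := ℝ)).continuous.continuousAt.comp
      (h.cont_t.continuousAt hnh))
  refine ⟨_, key.hasFDerivAt, ?_, ?_⟩ <;> simp [Function.HasUncurry.uncurry]

lemma dx_linear (x t q σ v : ℝ) :
    dx (fun y τ => q * (σ * (x - y) - v * (t - τ))) = fun _ _ => -σ * q := by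
  funext y τ
  have := ((((hasDerivAt_id y).const_sub x).const_mul σ).sub_const (v * (t - τ))).const_mul q
  rw [dx]
  exact (this.congr_deriv (by ring)).deriv

lemma dt_linear (x t q σ v : ℝ) :
    dt (fun y τ => q * (σ * (x - y) - v * (t - τ))) = fun _ _ => q * v := by
  funext y τ
  have := ((((hasDerivAt_id τ).const_sub t).const_mul v).const_sub (σ * (x - y))).const_mul q
  rw [dt]
  exact (this.congr_deriv (by ring)).deriv

lemma isTestFunction_linear (x t q σ v : ℝ) :
    IsTestFunction T (fun y τ => q * (σ * (x - y) - v * (t - τ))) where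
  diff_x _ _ _ := by fun_prop
  diff_xx _ _ _ := by rw [dx_linear]; fun_prop
  diff_t _ _ _ := by fun_prop
  cont := by fun_prop
  cont_x := by rw [dx_linear]; fun_prop
  cont_xx := by
    rw [dx_linear]
    have : dx (fun _ _ => -σ * q) = fun _ _ => 0 := by funext; simp [dx]
    rw [this]; fun_prop
  cont_t := by rw [dt_linear]; fun_prop

/-- A point of a relatively open set stays in it for nearby times, so the sub- and superflow
conditions concern the same set. -/
lemma IsOpenInStrip.lowerLimit_eq (h : IsOpenInStrip T Ω) : lowerLimit T Ω = Ω := by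
  obtain ⟨O, hO, rfl⟩ := h
  ext ⟨x, t⟩
  refine ⟨fun ⟨ht, c, hc, H⟩ => H t ht (by simpa using hc), fun hz => ⟨hz.2.2, ?_⟩⟩
  obtain ⟨c, hc, H⟩ := Metric.isOpen_iff.1 hO _ hz.1
  refine ⟨c, hc, fun s hs hst => ⟨H ?_, mem_univ _, hs⟩⟩
  rw [Metric.mem_ball, Prod.dist_eq, dist_self, Real.dist_eq]
  exact max_lt hc hst

lemma IsOpenInStrip.snd_mem (h : IsOpenInStrip T Ω) {z : ℝ × ℝ} (hz : z ∈ Ω) : z.2 ∈ Ico 0 T := by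
  obtain ⟨O, hO, rfl⟩ := h
  exact hz.2.2

lemma IsOpenInStrip.eventually (h : IsOpenInStrip T Ω) {z : ℝ × ℝ} (hz : z ∈ Ω) :
    ∀ᶠ w in 𝓝[{w : ℝ × ℝ | 0 ≤ w.2}] z, w ∈ Ω := by
  obtain ⟨O, hO, rfl⟩ := h
  filter_upwards [self_mem_nhdsWithin, mem_nhdsWithin_of_mem_nhds (hO.mem_nhds hz.1),
    mem_nhdsWithin_of_mem_nhds ((isOpen_Iio.preimage continuous_snd).mem_nhds hz.2.2.2)]
    with w h1 h2 h3 using ⟨h2, mem_univ _, h1, h3⟩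

lemma IsOpenInStrip.notMem_of_frontier (h : IsOpenInStrip T Ω) {x t : ℝ} (ht : 0 < t)
    (hz : (x, t) ∈ frontier Ω) : (x, t) ∉ Ω := fun hm => by
  refine hz.2 (mem_interior_iff_mem_nhds.2 ?_)
  have h1 := h.eventually hm
  have h2 : {w : ℝ × ℝ | 0 ≤ w.2} ∈ 𝓝 (x, t) := mem_of_superset
    ((isOpen_Ioi.preimage continuous_snd).mem_nhds (mem_preimage.2 (mem_Ioi.2 ht)))
    fun w hw => show 0 ≤ w.2 from le_of_lt hw
  rwa [nhdsWithin_eq_nhds.2 h2] at h1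

/-- Upper semicontinuity in time identifies the slices of the space-time closure with the closures
of the slices. It translates between the viscosity definition and the slicewise contact conditions.
-/
lemma UpperSemicont.mem_closure_slice (h : UpperSemicont T Ω) (hΩ : ∀ z ∈ Ω, z.2 ∈ Ico 0 T)
    {z : ℝ × ℝ} (ht : z.2 ∈ Ico 0 T) (hz : z ∈ closure Ω) : z.1 ∈ closure (slice Ω z.2) := by
  refine Metric.mem_closure_iff.2 fun ε hε => ?_
  obtain ⟨δ, hδ, H⟩ := Metric.eventually_nhds_iff.1
    (eventually_nhdsWithin_iff.1 (h z.2 ht (ε / 2) (by linarith)))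
  obtain ⟨w, hw, hzw⟩ := Metric.mem_closure_iff.1 hz (min δ (ε / 2)) (by positivity)
  rw [Prod.dist_eq, max_lt_iff, lt_min_iff, lt_min_iff] at hzw
  have h1 : w.1 ∈ slice Ω w.2 := hw
  obtain ⟨y, hy, hyw⟩ := Metric.mem_thickening_iff.1
    (H (by rw [dist_comm]; exact hzw.2.1) (hΩ w hw) h1)
  exact ⟨y, hy, by linarith [dist_triangle z.1 w.1 y, hzw.1.2]⟩

lemma mem_closure_of_slice {x t : ℝ} (hx : x ∈ closure (slice Ω t)) : (x, t) ∈ closure Ω :=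
  map_mem_closure (f := fun y : ℝ => (y, t)) (by fun_prop) hx fun _ hy => hy

lemma eventually_snd_mem {t x : ℝ} (ht : t ∈ Ioo 0 T) :
    ∀ᶠ z in 𝓝 ((x, t) : ℝ × ℝ), z.2 ∈ Ioo 0 T :=
  (isOpen_Ioo.preimage continuous_snd).mem_nhds ht

lemma IsFlow.isOpenEvolution (h : IsFlow A F V T Ω) (hΩ : IsOpenInStrip T Ω) :
    IsOpenEvolution 0 T (slice Ω) where
  opn t ht x hx := hΩ.eventually hx
  bdd t ht := by
    obtain ⟨-, p, hp, -⟩ := h.1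
    exact (hp t ht).2.1
  rusc t ht ε hε := by
    have := h.1.1 t ht ε hε
    rw [← nhdsWithin_Ioo_eq_nhdsGT ht.2]
    exact this.filter_mono (nhdsWithin_mono _ fun τ (hτ : τ ∈ Ioo t T) =>
      (⟨ht.1.trans hτ.1.le, hτ.2⟩ : τ ∈ Ico 0 T))
  lusc t ht ε hε := by
    have := h.1.1 t ⟨ht.1.le, ht.2⟩ ε hε
    rw [← nhdsWithin_Ioo_eq_nhdsLT ht.1]
    exact this.filter_mono (nhdsWithin_mono _ fun τ (hτ : τ ∈ Ioo 0 t) =>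
      (⟨hτ.1.le, hτ.2.trans ht.2⟩ : τ ∈ Ico 0 T))

lemma mem_frontier_of_slice {x t : ℝ} (hx : x ∈ closure (slice Ω t)) (hx' : x ∉ slice Ω t) :
    (x, t) ∈ frontier Ω :=
  ⟨mem_closure_of_slice hx, fun h => hx' (show (x, t) ∈ Ω from interior_subset h)⟩

lemma IsAssociated.eq_dsol (hA : CoefBounds A F m M) {p : ℝ → ℝ → ℝ}
    (hp : IsAssociated A F T Ω p) {t : ℝ} (ht : t ∈ Ico 0 T) (x : ℝ) :
    p x t = dsol A F (slice Ω t) x := by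
  obtain ⟨h1, h2, h3⟩ := hp t ht
  exact congrFun (hA.eq_dsol h1 h2 h3) x

lemma IsFlow.linSub (hA : CoefBounds A F m M) (h : IsFlow A F V T Ω) (hΩ : IsOpenInStrip T Ω) :
    LinSub A F V 0 T (slice Ω) := by
  obtain ⟨⟨husc, p, hp, H⟩, -⟩ := h
  intro t ht x hx hx' σ q v hσ hq hloc
  have key := H _ (isTestFunction_linear x t q σ v) x t ht (mem_frontier_of_slice hx hx') ?_
  · rw [dx_linear, dt_linear] at key
    simp only [abs_mul, abs_neg, abs_sign hσ, one_mul, abs_of_pos hq] at key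
    rcases key with h | h
    · exact absurd h hq.ne'
    · rw [mul_comm q v, ← sub_mul] at h
      linarith [nonpos_of_mul_nonpos_left h hq]
  · have h1 := eventually_nhdsWithin_iff.1 hloc
    refine eventually_nhdsWithin_iff.2 ?_
    filter_upwards [h1, eventually_snd_mem (x := x) ht] with z hz hz2 hzc
    have hz3 : z.2 ∈ Ico 0 T := ⟨hz2.1.le, hz2.2⟩
    have h2 := hz ⟨hzc.2, husc.mem_closure_slice (fun _ h => hΩ.snd_mem h) hz3 hzc.1⟩
    rw [hp.eq_dsol hA hz3, hp.eq_dsol hA ⟨ht.1.le, ht.2⟩, dsol_of_notMem hx']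
    simp only [sub_self, mul_zero]
    linarith

lemma IsFlow.linSuper (hA : CoefBounds A F m M) (h : IsFlow A F V T Ω) (hΩ : IsOpenInStrip T Ω) :
    LinSuper A F V 0 T (slice Ω) := by
  obtain ⟨-, -, p, hp, H⟩ := h
  rw [hΩ.lowerLimit_eq] at hp H
  intro t ht x hx hx' σ q v hσ hq hloc
  have key := H _ (isTestFunction_linear x t q σ v) x t ht (mem_frontier_of_slice hx hx') ?_
  · rw [dx_linear, dt_linear] at key
    simp only [abs_mul, abs_neg, abs_sign hσ, one_mul, abs_of_pos hq] at key
    rcases key with h | h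
    · exact absurd h hq.ne'
    · rw [mul_comm q v, ← sub_mul] at h
      linarith [nonneg_of_mul_nonneg_left h hq]
  · have h1 := eventually_nhdsWithin_iff.1 hloc
    refine eventually_nhdsWithin_iff.2 ?_
    filter_upwards [h1, eventually_snd_mem (x := x) ht] with z hz hz2 hzc
    have hz3 : z.2 ∈ Ico 0 T := ⟨hz2.1.le, hz2.2⟩
    have h2 := hz hzc
    rw [hp.eq_dsol hA hz3, hp.eq_dsol hA ⟨ht.1.le, ht.2⟩, dsol_of_notMem hx']
    simp only [sub_self, mul_zero]
    linarith

/-- The space-time set with the slices `X t`, `0 ≤ t < T`. -/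
def spaceTime (T : ℝ) (X : ℝ → Set ℝ) : Set (ℝ × ℝ) := {z | z.2 ∈ Ico 0 T ∧ z.1 ∈ X z.2}

lemma slice_spaceTime {X : ℝ → Set ℝ} {t : ℝ} (ht : t ∈ Ico 0 T) : slice (spaceTime T X) t = X t :=
  Set.ext fun _ => ⟨fun h => h.2, fun h => ⟨ht, h⟩⟩

/-! ### Generated evolutions are flows -/

section GenFlow

variable {L : ℝ} {X : ℝ → Set ℝ}

lemma Gen.isOpenInStrip (h : Gen A F V ℓ N K 0 L X) (hL : T ≤ L) :
    IsOpenInStrip T (spaceTime T X) := by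
  have hev : ∀ z ∈ spaceTime T X, ∃ O : Set (ℝ × ℝ), IsOpen O ∧ z ∈ O ∧
      O ∩ {w | 0 ≤ w.2} ⊆ {w | w.1 ∈ X w.2} := fun z hz =>
    mem_nhdsWithin.1 (h.opn z.2 ⟨hz.1.1, hz.1.2.trans_le hL⟩ z.1 hz.2)
  refine ⟨⋃₀ {O | IsOpen O ∧ O ∩ {w | 0 ≤ w.2} ⊆ {w | w.1 ∈ X w.2}},
    isOpen_sUnion fun O hO => hO.1, Subset.antisymm (fun z hz => ?_) ?_⟩
  · obtain ⟨O, h1, h2, h3⟩ := hev z hz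
    exact ⟨⟨O, ⟨h1, h3⟩, h2⟩, mem_univ _, hz.1⟩
  · rintro z ⟨⟨O, hO, hz⟩, -, hz2⟩
    exact ⟨hz2, hO.2 ⟨hz, hz2.1⟩⟩

lemma eventually_Ico_of_sides {t : ℝ} {P : ℝ → Prop} (ht : t ∈ Ico 0 T)
    (hl : 0 < t → ∀ᶠ s in 𝓝[<] t, P s) (h0 : P t) (hr : ∀ᶠ s in 𝓝[>] t, P s) :
    ∀ᶠ s in 𝓝[Ico 0 T] t, P s := by
  have hsub : Ico 0 T ⊆ Ico 0 t ∪ ({t} ∪ Ioi t) := fun s hs => by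
    rcases lt_trichotomy s t with h | h | h
    · exact Or.inl ⟨hs.1, h⟩
    · exact Or.inr (Or.inl h)
    · exact Or.inr (Or.inr h)
  refine Eventually.filter_mono (nhdsWithin_mono _ hsub) ?_
  rw [nhdsWithin_union, nhdsWithin_union, nhdsWithin_singleton]
  refine eventually_sup.2 ⟨?_, eventually_sup.2 ⟨by simpa using h0, hr⟩⟩
  rcases eq_or_lt_of_le ht.1 with rfl | h
  · simp
  · exact (hl h).filter_mono (nhdsWithin_mono _ fun _ hs => hs.2)

lemma Gen.upperSemicont (h : Gen A F V ℓ N K 0 L X) (hL : T ≤ L) :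
    UpperSemicont T (spaceTime T X) := by
  intro t ht ε hε
  have htL : t ∈ Ico 0 L := ⟨ht.1, ht.2.trans_le hL⟩
  have hself := Metric.self_subset_thickening hε (X t)
  refine (eventually_Ico_of_sides (P := fun s => X s ⊆ Metric.thickening ε (X t)) ht
    (fun h0 => ?_) hself (h.rusc t htL ε hε)).mp ?_
  · filter_upwards [Ioo_mem_nhdsLT h0] with s hs
    exact (h.mono s t hs.1.le hs.2.le htL.2).trans hself
  · filter_upwards [self_mem_nhdsWithin] with s hs hP
    rwa [slice_spaceTime hs, slice_spaceTime ht]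

/-- Forward in time this is monotonicity. Backward in time it needs continuity of the endpoints of
the finitely many intervals. -/
lemma Gen.lowerSemicont (h : Gen A F V ℓ N K 0 L X) (hL : T ≤ L) :
    LowerSemicont T (spaceTime T X) := by
  intro t ht ε hε
  have htL : t ∈ Ico 0 L := ⟨ht.1, ht.2.trans_le hL⟩
  refine (eventually_Ico_of_sides (P := fun s => X t ⊆ Metric.thickening ε (X s)) ht
    (fun h0 => ?_) (Metric.self_subset_thickening hε _) ?_).mp ?_
  · obtain ⟨s', hs', ι, hι, α, β, hf⟩ := h.left t ⟨h0, htL.2⟩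
    have h1 := hf.usc (right_mem_Icc.2 hs'.2.le) hε
    rw [← nhdsWithin_Ioo_eq_nhdsLT hs'.2]
    filter_upwards [h1.filter_mono (nhdsWithin_mono _ Ioo_subset_Icc_self)] with s hs using hs.2
  · filter_upwards [Ioo_mem_nhdsGT htL.2] with s hs
    exact (h.mono t s htL.1 hs.1.le hs.2).trans (Metric.self_subset_thickening hε _)
  · filter_upwards [self_mem_nhdsWithin] with s hs hP
    rwa [slice_spaceTime hs, slice_spaceTime ht]

lemma Gen.isAdmissible (h : Gen A F V ℓ N K 0 L X) (hK : 0 < K) (hL : T ≤ L) :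
    IsAdmissible T (spaceTime T X) where
  bounded := ((Metric.isBounded_Icc (-(N * Real.exp (K * L))) (N * Real.exp (K * L))).prod
    (Metric.isBounded_Ico 0 T)).subset fun z hz =>
      ⟨h.subset_Icc hK ⟨hz.1.1, hz.1.2.trans_le hL⟩ hz.2, hz.1⟩
  mono s t hs hst ht := by
    rw [slice_spaceTime ⟨hs, hst.trans_lt ht⟩, slice_spaceTime ⟨hs.trans hst, ht⟩]
    exact h.mono s t hs hst (ht.trans_le hL)
  open_slice t ht := by
    rw [slice_spaceTime ht]
    exact h.isOpen ⟨ht.1, ht.2.trans_le hL⟩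

lemma Gen.isAssociated (hA : CoefBounds A F m M) (h : Gen A F V ℓ N K 0 L X) (hK : 0 < K)
    (hL : T ≤ L) : IsAssociated A F T (spaceTime T X) (fun x t => dsol A F (X t) x) := by
  intro t ht
  have htL : t ∈ Ico 0 L := ⟨ht.1, ht.2.trans_le hL⟩
  rw [slice_spaceTime ht]
  exact ⟨h.isOpen htL, h.bounded hK htL,
    hA.isDirichletSolution_dsol (h.isOpen htL) (h.bounded hK htL)⟩

lemma Gen.isFlow (hA : CoefBounds A F m M) (hV : VelBounds V C) (h : Gen A F V ℓ N K 0 L X)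
    (hK : 0 < K) (hL : T ≤ L) : IsFlow A F V T (spaceTime T X) := by
  have hop := h.isOpenInStrip hL
  refine ⟨⟨h.upperSemicont hL, _, h.isAssociated hA hK hL, fun φ hφ x t ht hz H => Or.inr ?_⟩, ?_⟩
  · have hx : x ∉ X t := fun hx => hop.notMem_of_frontier ht.1 hz ⟨⟨ht.1.le, ht.2⟩, hx⟩
    have ht' : t ∈ Ico 0 T := ⟨ht.1.le, ht.2⟩
    have hxc : x ∈ closure (X t) := by
      have := (h.upperSemicont hL).mem_closure_slice (fun _ h => h.1) (z := (x, t)) ht' hz.1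
      rwa [slice_spaceTime ht'] at this
    obtain ⟨φ', h1, h2, h3⟩ := hφ.exists_hasFDerivAt (x := x) ht
    have key := h.sub_ineq hA hV hK ⟨ht.1, ht.2.trans_le hL⟩ hxc hx h1 ?_
    · rw [h2, h3] at key; linarith
    · have H' := eventually_nhdsWithin_iff.1 H
      refine eventually_nhdsWithin_iff.2 ?_
      filter_upwards [H', eventually_snd_mem (x := x) ht] with z hz hz2 hzc
      have h4 : z ∈ closure (spaceTime T X) := mem_closure_of_slice (x := z.1) (t := z.2) (by
        rw [slice_spaceTime ⟨hz2.1.le, hz2.2⟩]; exact hzc.2)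
      have h5 := hz ⟨h4, hzc.1⟩
      rw [dsol_of_notMem hx] at h5
      linarith
  · rw [hop.lowerLimit_eq]
    refine ⟨h.lowerSemicont hL, _, h.isAssociated hA hK hL, fun φ hφ x t ht hz H => ?_⟩
    have hx : x ∉ X t := fun hx => hop.notMem_of_frontier ht.1 hz ⟨⟨ht.1.le, ht.2⟩, hx⟩
    obtain ⟨φ', h1, h2, h3⟩ := hφ.exists_hasFDerivAt (x := x) ht
    rcases eq_or_ne (dx φ x t) 0 with h0 | h0
    · exact Or.inl (abs_eq_zero.2 h0)
    refine Or.inr ?_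
    have key := h.super_ineq hA hV hK ⟨ht.1, ht.2.trans_le hL⟩ hx h1 (h2 ▸ h0) ?_
    · rw [h2, h3] at key; linarith
    · filter_upwards [H] with z hz
      rw [dsol_of_notMem hx] at hz
      linarith

end GenFlow

/-! ### Uniqueness and the choice of constants -/

/-- A generated evolution contains every evolution with the subflow property and the same
initial set. -/
lemma subset_of_linSub (hA : CoefBounds A F m M) (hV : VelBounds V C) (hK : 0 < K)
    {L c c' : ℝ} {X Y : ℝ → Set ℝ} (hY : Gen A F V ℓ N K 0 L Y) (hL : T ≤ L) (hc0 : 0 < c)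
    (hc : SpeedBounds A F V ℓ (N * Real.exp (K * L)) c c')
    (hX : LinSub A F V 0 T X) (hXe : IsOpenEvolution 0 T X) (h0 : X 0 = Y 0) {t : ℝ}
    (ht : t ∈ Ico 0 T) : X t ⊆ Y t := by
  intro x hx
  rcases eq_or_lt_of_le ht.1 with rfl | ht0
  · exact h0 ▸ hx
  obtain ⟨Lv, hLv0, hLv⟩ := hA.exists_speed_lip hV (N * Real.exp (K * L))
  obtain ⟨σ, hσ, hxσ⟩ : ∃ σ ∈ Ioo 0 t, x ∈ X (t - σ) := by
    have h1 := hXe.opn t ht x hx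
    have h2 : Tendsto (fun τ : ℝ => (x, τ)) (𝓝[Ioo 0 t] t) (𝓝[{z : ℝ × ℝ | 0 ≤ z.2}] (x, t)) :=
      (Continuous.continuousWithinAt (by fun_prop)).tendsto_nhdsWithin fun τ hτ => hτ.1.le
    have hne : (𝓝[Ioo 0 t] t).NeBot := by
      rw [nhdsWithin_Ioo_eq_nhdsLT ht0]; infer_instance
    obtain ⟨τ, h3, h4⟩ := ((h2.eventually h1).and self_mem_nhdsWithin).exists
    exact ⟨t - τ, ⟨sub_pos.2 h4.2, by linarith [h4.1]⟩, by simpa using h3⟩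
  -- The time σ is shared: one half delays the start of Y and yields the margin ρ, and the other
  -- half bounds the total effect κ t of the acceleration.
  set κ := σ / (2 * t) with hκ
  have hσ0 := hσ.1
  have hκ0 : 0 < κ := by positivity
  have hκt : κ * t = σ / 2 := by rw [hκ]; field_simp
  set δ := σ / 2 with hδ
  have hδ0 : 0 < δ := by positivity
  obtain ⟨ρ, hρ0, hρ1, hρ2⟩ : ∃ ρ > 0, ρ < c * δ ∧ Lv * (2 * ρ) < κ * c := by
    have e1 : ∀ᶠ ρ : ℝ in 𝓝[>] 0, ρ < c * δ :=
      nhdsWithin_le_nhds (eventually_lt_nhds (by positivity))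
    have e2 : ∀ᶠ ρ : ℝ in 𝓝[>] 0, Lv * (2 * ρ) < κ * c := by
      refine nhdsWithin_le_nhds (Tendsto.eventually_lt_const (v := 0) (by positivity) ?_)
      have : Continuous fun ρ : ℝ => Lv * (2 * ρ) := by fun_prop
      simpa using this.tendsto 0
    obtain ⟨ρ, h1, h2, h3⟩ := (e1.and (e2.and self_mem_nhdsWithin)).exists
    exact ⟨ρ, h3, h1, h2⟩
  have htime : δ + (1 + κ) * (t - σ - 0) ≤ t := by nlinarith
  have hδL : δ < L := by linarith [hσ.2, ht.2]
  have hini : Metric.cthickening ρ (X 0) ⊆ Y δ := by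
    refine (Metric.cthickening_subset_thickening' (by positivity) hρ1 _).trans fun y hy => ?_
    obtain ⟨z, hz, hyz⟩ := Metric.mem_thickening_iff.1 hy
    exact hY.ball_subset hK hc0 hc le_rfl hδ0.le hδL z (h0 ▸ hz) y
      (by rwa [sub_zero, ← Real.dist_eq])
  have key := compare_sub hA hV hK hY hc hLv hX hXe hδ0.le hκ0 hρ0 hρ2 hini
    (b := t - σ) (by linarith [ht.2]) (by linarith [ht.2]) (t - σ) ⟨by linarith [hσ.2], le_rfl⟩
  refine hY.mono _ t ?_ htime (ht.2.trans_le hL) (key (Metric.self_subset_cthickening _ hxσ))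
  have : 0 ≤ (1 + κ) * (t - σ - 0) := mul_nonneg (by positivity) (by linarith [hσ.2])
  positivity

/-- Well-posedness for abstract coefficient bounds and a uniform lower bound for the length of
the components. -/
lemma exists_unique_flow (hA : CoefBounds A F m M) (hV : VelBounds V C) {U : Set ℝ}
    (hU : IsOpen U) (hb : Bornology.IsBounded U) (hℓ : ∀ a b, IsComp U a b → ℓ < b - a)
    (hlow : ∀ Q, ∃ c > 0, ∀ x q, m ^ 2 / (2 * M) * ℓ / M ≤ |q| → |q| ≤ Q → c ≤ V x q)
    (hT : 0 < T) :
    ∃ Ω : Set (ℝ × ℝ), (IsOpenInStrip T Ω ∧ IsFlow A F V T Ω ∧ slice Ω 0 = U) ∧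
      IsAdmissible T Ω ∧ ∀ Ω' : Set (ℝ × ℝ), IsOpenInStrip T Ω' → IsFlow A F V T Ω' →
        slice Ω' 0 = U → Ω' = Ω := by
  obtain ⟨R, hR⟩ := hb.subset_closedBall 0
  rw [Real.closedBall_eq_Icc, zero_sub, zero_add] at hR
  obtain ⟨K, hK, hgr⟩ := hA.exists_growth hV
  set N := 1 + R
  obtain ⟨c, hc0, hlow'⟩ := hA.exists_speed_lower hlow (N * Real.exp (K * T))
  set c' := K * (1 + |N * Real.exp (K * T)|) with hc'
  have hc0' : 0 ≤ c' := by positivity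
  have hc : SpeedBounds A F V ℓ (N * Real.exp (K * T)) c c' := by
    intro a b hab hℓ ha hb
    refine ⟨hlow' a b hab hℓ ha hb, ?_⟩
    -- The upper speed bound comes from the linear growth. The absolute value in c' only makes it
    -- nonnegative without knowing the sign of R.
    have h1 : K * (1 + max |a| |b|) ≤ c' := by
      have := (max_le ha hb).trans (le_abs_self _)
      rw [hc']; gcongr
    exact ⟨(le_abs_self _).trans ((hgr a b hab).1.trans h1),
      (le_abs_self _).trans ((hgr a b hab).2.trans h1)⟩
  have hcov : ∀ Q : Set ℝ, IsCompact Q → Q ⊆ U →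
      ∃ S, Gen A F V ℓ N K 0 T S ∧ closure (S 0) ⊆ U ∧ Q ⊆ S 0 := fun Q hQ hQU =>
    exists_gen_cover hA hV hK hgr hT hU hb hℓ hR le_rfl hQ hQU
  set Y := maxEvol A F V ℓ N K T U with hYdef
  have hY : Gen A F V ℓ N K 0 T Y := gen_maxEvol hA hV hK hgr hc0 hc0' hc hcov
  have hY0 : Y 0 = U := maxEvol_zero hcov
  refine ⟨spaceTime T Y, ⟨hY.isOpenInStrip le_rfl, hY.isFlow hA hV hK le_rfl,
    (slice_spaceTime ⟨le_rfl, hT⟩).trans hY0⟩, hY.isAdmissible hK le_rfl, ?_⟩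
  intro Ω' hop hfl h0
  have hXe := hfl.isOpenEvolution hop
  have hsl : ∀ t ∈ Ico 0 T, slice Ω' t = Y t := fun t ht => by
    refine Subset.antisymm (subset_of_linSub hA hV hK hY le_rfl hc0 hc
      (hfl.linSub hA hop) hXe (h0.trans hY0.symm) ht) ?_
    rintro x ⟨S, hS, hS0, hx⟩
    have := hS.subset_super hA hV hK (hfl.linSuper hA hop) hXe le_rfl (h0 ▸ hS0) ht.1 ht.2
      (by simpa using ht.2)
    exact this (by simpa using hx)
  ext ⟨x, t⟩
  constructor
  · intro hz
    have ht := hop.snd_mem hz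
    exact ⟨ht, hsl t ht ▸ hz⟩
  · rintro ⟨ht, hx⟩
    have : x ∈ slice Ω' t := hsl t ht ▸ hx
    exact this

/-- Sending a component interval to the connected component of its midpoint is injective: two
midpoints in one connected component would be joined by a segment in U through an endpoint. So there
are finitely many positive lengths. -/
lemma exists_length_bound {U : Set ℝ} (h : Finite (ConnectedComponents U)) :
    ∃ ℓ > 0, ∀ a b, IsComp U a b → ℓ < b - a := by
  have hmid : ∀ p : {p : ℝ × ℝ // IsComp U p.1 p.2}, (p.1.1 + p.1.2) / 2 ∈ Ioo p.1.1 p.1.2 :=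
    fun p => ⟨by linarith [p.2.lt], by linarith [p.2.lt]⟩
  let g : {p : ℝ × ℝ // IsComp U p.1 p.2} → ConnectedComponents U := fun p =>
    ((⟨(p.1.1 + p.1.2) / 2, p.2.sub (hmid p)⟩ : U) : ConnectedComponents U)
  have hg : Function.Injective g := by
    intro p q hpq
    by_contra hne
    have h1 := ConnectedComponents.coe_eq_coe'.1 hpq
    have hord : (Subtype.val '' connectedComponent
        (⟨(q.1.1 + q.1.2) / 2, q.2.sub (hmid q)⟩ : U)).OrdConnected :=
      (isPreconnected_connectedComponent.image _ continuous_subtype_val.continuousOn).ordConnected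
    have hsub := hord.uIcc_subset (mem_image_of_mem _ h1) (mem_image_of_mem _ mem_connectedComponent)
    have hU : uIcc ((p.1.1 + p.1.2) / 2) ((q.1.1 + q.1.2) / 2) ⊆ U :=
      hsub.trans (Subtype.coe_image_subset _ _)
    have hp := hmid p
    have hq := hmid q
    rcases p.2.disjoint q.2 (fun h => hne (Subtype.ext h)) with h2 | h2
    · exact p.2.right (hU (mem_uIcc.2 (Or.inl ⟨hp.2.le, h2.trans hq.1.le⟩)))
    · exact p.2.left (hU (mem_uIcc.2 (Or.inr ⟨hq.2.le.trans h2, hp.1.le⟩)))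
  have : Finite {p : ℝ × ℝ // IsComp U p.1 p.2} := Finite.of_injective g hg
  have hev : ∀ᶠ ℓ : ℝ in 𝓝[>] 0, ∀ p : {p : ℝ × ℝ // IsComp U p.1 p.2}, ℓ < p.1.2 - p.1.1 :=
    eventually_all.2 fun p => nhdsWithin_le_nhds (eventually_lt_nhds (sub_pos.2 p.2.lt))
  obtain ⟨ℓ, h1, h2⟩ := (hev.and self_mem_nhdsWithin).exists
  exact ⟨ℓ, h2, fun a b hab => h1 ⟨(a, b), hab⟩⟩

lemma exists_coefBounds (h : InteriorCoefficients A F) : ∃ m M, CoefBounds A F m M := by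
  obtain ⟨a, ha, hA⟩ := h.A_pos
  obtain ⟨f, hf, hF⟩ := h.F_pos
  obtain ⟨MA, hMA⟩ := h.A_bdd
  obtain ⟨MF, hMF⟩ := h.F_bdd
  obtain ⟨KF, hKF⟩ := h.F_lip
  exact ⟨min a f, max MA MF, lt_min ha hf, fun x => (min_le_left _ _).trans (hA x),
    fun x => (min_le_right _ _).trans (hF x), fun x => (hMA x).trans (le_max_left _ _),
    fun x => (hMF x).trans (le_max_right _ _), h.A_lip, hKF.continuous⟩

lemma exists_velBounds (h : VelocityStructure V) (hpos : ∀ x q, q ≠ 0 → 0 < V x q) :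
    ∃ C, VelBounds V C := by
  obtain ⟨C, hC, hlip, hst⟩ := h
  exact ⟨C, hC, hlip, velocity_mono fun γ h0 h1 x q => (hst γ h0 h1 x x q (by simpa using h0.le)).1,
    hpos⟩

lemma exists_velocity_lower {η : ℝ → ℝ} {w : ℝ} (hη : ContinuousOn η (Ici w))
    (hpos : ∀ s, w ≤ s → 0 < η s) (hV : ∀ x q, w ≤ |q| → η |q| ≤ V x q) (Q : ℝ) :
    ∃ c > 0, ∀ x q, w ≤ |q| → |q| ≤ Q → c ≤ V x q := by
  obtain ⟨c, hc, H⟩ := (isCompact_Icc (a := w) (b := Q)).exists_forall_le'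
    (hη.mono Icc_subset_Ici_self) (a := 0) fun s hs => hpos s hs.1
  exact ⟨c, hc, fun x q h1 h2 => (H _ ⟨h1, h2⟩).trans (hV x q h1)⟩

end HeleShaw

theorem theorem3p4 (A F : ℝ → ℝ) (V : ℝ → ℝ → ℝ)
    (hAF : HeleShaw.InteriorCoefficients A F)
    (hV : HeleShaw.VelocityStructure V)
    (Ω₀ : Set ℝ) (hΩ₀ : IsOpen Ω₀) (hΩ₀b : Bornology.IsBounded Ω₀)
    (hpos : HeleShaw.VelocityPositive V ∨
      (HeleShaw.VelocityPositiveAwayFromZero V ∧ Finite (ConnectedComponents Ω₀)))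
    (T : ℝ) (hT : 0 < T) :
    ∃ Ω : Set (ℝ × ℝ),
      (HeleShaw.IsOpenInStrip T Ω ∧ HeleShaw.IsFlow A F V T Ω ∧ HeleShaw.slice Ω 0 = Ω₀) ∧
      HeleShaw.IsAdmissible T Ω ∧
      ∀ Ω' : Set (ℝ × ℝ),
        HeleShaw.IsOpenInStrip T Ω' → HeleShaw.IsFlow A F V T Ω' →
        HeleShaw.slice Ω' 0 = Ω₀ → Ω' = Ω := by
  obtain ⟨m, M, hA⟩ := HeleShaw.exists_coefBounds hAF
  rcases hpos with ⟨η, hη, hη0, hηV⟩ | ⟨⟨η, hη, hη0, hηV⟩, hfin⟩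
  · obtain ⟨C, hVB⟩ := HeleShaw.exists_velBounds hV fun x q _ =>
      (hη0 _ (abs_nonneg q)).trans_le (hηV x q)
    -- With V positive also at slope zero no minimal length is needed, and the slope threshold
    -- becomes 0.
    refine HeleShaw.exists_unique_flow (ℓ := 0) hA hVB hΩ₀ hΩ₀b (fun a b h => sub_pos.2 h.lt)
      (fun Q => ?_) hT
    rw [mul_zero, zero_div]
    exact HeleShaw.exists_velocity_lower hη hη0 (fun x q _ => hηV x q) Q
  · obtain ⟨C, hVB⟩ := HeleShaw.exists_velBounds hV fun x q hq =>
      (hη0 _ (abs_pos.2 hq)).trans_le (hηV x q hq)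
    obtain ⟨ℓ, hℓ, hcomp⟩ := HeleShaw.exists_length_bound hfin
    have hm := hA.m_pos
    have hM := hA.M_pos
    -- The smallest boundary slope of an interval of length ℓ is bounded below by this number, so η
    -- is used only away from 0.
    have hw : 0 < m ^ 2 / (2 * M) * ℓ / M := by positivity
    exact HeleShaw.exists_unique_flow hA hVB hΩ₀ hΩ₀b hcomp
      (HeleShaw.exists_velocity_lower (hη.mono fun s hs => hw.trans_le hs)
        (fun s hs => hη0 s (hw.trans_le hs)) fun x q hq =>
          hηV x q (abs_pos.1 (hw.trans_le hq))) hT
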